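/- Let $d\ge 1$, $p\ge 0$ and $k\ge p+1$ be integers and let $K:\mathbb{R}^d\to\mathbb{R}$ be a (measurable) kernel. Given $n$ samples $X_1,\dots,X_n\in\mathbb{R}^d$, let $\rho_{\ell,i}$ be the Euclidean distance from $X_i$ to its $\ell$-th nearest neighbour among the other samples, and let $\mathcal T_i=\{j\ne i:\|X_j-X_i\|\le\rho_{\lceil\log n\rceil,i}\}$ be the set of its $\lceil\log n\rceil$ nearest neighbours. For tensors $a=(a_0,\dots,a_p)\in\mathbb{R}^{1\times d\times\cdots\times d^p}$ put $\log f_{a,x}(u)=a_0+\langle a_1,u-x\rangle+\cdots+a_p[u-x,\dots,u-x]$, and consider the local log-likelihood at $X_i$ with bandwidth $\rho_{k,i}$, $$\mathcal L_{X_i}(f_{a,X_i})=\sum_{j\in\mathcal T_i}K\Big(\frac{X_j-X_i}{\rho_{k,i}}\Big)\log f_{a,X_i}(X_j)-n\int K\Big(\frac{u-X_i}{\rho_{k,i}}\Big)f_{a,X_i}(u)\,du ,$$ for those $a$ for which the integral converges. Let $\widehat a(X_i)$ be a maximizer, $\widehat f_n(X_i)=f_{\widehat a(X_i),X_i}(X_i)=e^{\widehat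 a_0(X_i)}$, and $$\widehat H^{(n)}_{k,p,K}(X)=-\frac1n\sum_{i=1}^n\log\widehat f_n(X_i).$$ There is a constant $\widetilde B_{k,p,K,d}\in\mathbb{R}$, depending only on $k,p,K,d$, such that the following holds. Let $X_1,X_2,\dots$ be i.i.d. with a twice continuously differentiable density $f$ on $\mathbb{R}^d$. Suppose that (i) for all large $n$, almost surely, the maximization has a solution at each of $X_1,\dots,X_n$, and $\widehat a_0$ is uniquely determined by it (uniqueness is automatic if $K\ge0$ and $K$ is not almost everywhere $0$); (ii) (exchange of limits) with $H_1=-\log\widehat f_n(X_1)$, the expectations $\mathbb{E}|H_1|$ are finite and bounded for large $n$, the limit $\lim_{n\to\infty}\mathbb{E}[H_1\mid X_1=x]$ exists for almost every $x$ with respect to the law of $X_1$, and $$\lim_{n\to\infty}\mathbb{E}[H_1]=\mathbb{E}_{X_1}\Big[\lim_{n\to\infty}\mathbb{E}[H_1\mid X_1]\Big].$$ Then the differential entropy $H(X)=-\int f\log f$ is finite and $$\lim_{n\to\infty}\mathbb{E}\big[\widehat H^{(n)}_{k,p,K}(X)\big]=H(X)+\widetilde B_{k,p,K,d}.$$ Moreover,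 for $p=0$, the step kernel $K(u)=\mathbb{I}(\|u\|\le1)$ and any $k\ge1$, and for every twice continuously differentiable density $f$, condition (i) holds and the estimator is the Kozachenko--Leonenko estimator: for all large $n$, almost surely $\widehat f_n(X_i)=k/(n\,C_d\,\rho_{k,i}^d)$ for all $i\le n$, where $C_d=\pi^{d/2}/\Gamma(d/2+1)$. Under (ii) its asymptotic bias is $\psi(k)-\log k$, where $\psi=\Gamma'/\Gamma$ is the digamma function; that is, $\lim_{n\to\infty}\mathbb{E}[\widehat H^{(n)}_{k,0,K}(X)]=H(X)+\psi(k)-\log k$. -/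

import Mathlib

open MeasureTheory Filter Topology

noncomputable section

namespace LLDE

/-- `ℝ^d` with the Euclidean norm and Lebesgue measure. -/
abbrev E (d : ℕ) : Type := EuclideanSpace ℝ (Fin d)

/-- Parameters `a = (a_0, a_1, ..., a_p)` in `ℝ^{1 × d × d^2 × ... × d^p}`:
`a α` is a tensor of order `α`, given by its entries. -/
abbrev Param (d p : ℕ) : Type := (α : Fin (p + 1)) → (Fin (α : ℕ) → Fin d) → ℝ

/-- `a_0 + ⟨a_1, y⟩ + ⟨y, a_2 y⟩ + ... + a_p[y, ..., y]`. -/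
def tensorPoly {d p : ℕ} (a : Param d p) (y : E d) : ℝ :=
  ∑ α : Fin (p + 1), ∑ i : Fin (α : ℕ) → Fin d, a α i * ∏ l, y (i l)

/-- The constant coefficient `a_0`. -/
def constCoeff {d p : ℕ} (a : Param d p) : ℝ := a 0 (fun l => l.elim0)

/-- The exponential polynomial family: `f_{a,x}(u) = exp (a_0 + ⟨a_1, u - x⟩ + ...)`. -/
def expPoly {d p : ℕ} (a : Param d p) (x u : E d) : ℝ := Real.exp (tensorPoly a (u - x))

/-- Distance from `X i` to its `k`-th nearest neighbour among the other sample points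
(meaningful if `k` is at most the number of other points). -/
def nnDist {d n : ℕ} (k : ℕ) (X : Fin n → E d) (i : Fin n) : ℝ :=
  sInf {r : ℝ | 0 ≤ r ∧ k ≤ Set.ncard {j : Fin n | j ≠ i ∧ dist (X j) (X i) ≤ r}}

open Classical in
/-- The nearest neighbours of `X i` that are used by the estimator: the `⌈log n⌉` nearest ones,
`X i` itself excluded. -/
def nbrs {d n : ℕ} (X : Fin n → E d) (i : Fin n) : Finset (Fin n) :=
  Finset.univ.filter
    (fun j => j ≠ i ∧ dist (X j) (X i) ≤ nnDist ⌈Real.log (n : ℝ)⌉₊ X i)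

/-- The local log-likelihood `L_x(f_{a,x})` at `x = X i` with bandwidth `h`. -/
def localLogLik {d n p : ℕ} (K : E d → ℝ) (h : ℝ) (X : Fin n → E d) (i : Fin n)
    (a : Param d p) : ℝ :=
  (∑ j ∈ nbrs X i, K (h⁻¹ • (X j - X i)) * Real.log (expPoly a (X i) (X j)))
    - n * ∫ u : E d, K (h⁻¹ • (u - X i)) * expPoly a (X i) u

/-- The parameters for which the integral in the local log-likelihood converges. For a
nonnegative kernel the local log-likelihood is `-∞` at all other parameters. -/
def Admissible {d n p : ℕ} (K : E d → ℝ) (h : ℝ) (X : Fin n → E d) (i : Fin n)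
    (a : Param d p) : Prop :=
  Integrable (fun u : E d => K (h⁻¹ • (u - X i)) * expPoly a (X i) u)

/-- `a` maximizes the local log-likelihood at `X i`, with bandwidth the `k`-NN distance. -/
def IsMaximizer {d n p : ℕ} (k : ℕ) (K : E d → ℝ) (X : Fin n → E d) (i : Fin n)
    (a : Param d p) : Prop :=
  Admissible K (nnDist k X i) X i a ∧
    ∀ b : Param d p, Admissible K (nnDist k X i) X i b →
      localLogLik K (nnDist k X i) X i b ≤ localLogLik K (nnDist k X i) X i a

/-- The maximization at `X i` has a solution, and the solution determines the density estimate
`exp (a_0)`. (Tensors are not assumed symmetric, so only `a_0` is required to be unique.) -/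
def Solvable {d n : ℕ} (k p : ℕ) (K : E d → ℝ) (X : Fin n → E d) (i : Fin n) : Prop :=
  ∃ a : Param d p, IsMaximizer k K X i a ∧
    ∀ b : Param d p, IsMaximizer k K X i b → constCoeff b = constCoeff a

open Classical in
/-- The local likelihood density estimate at the sample point `X i`: the value `exp (a_0)` of
`f_{a, X i}` at `X i` for a maximizer `a` (and `0` if there is none). -/
def densityEstimate {d n : ℕ} (k p : ℕ) (K : E d → ℝ) (X : Fin n → E d) (i : Fin n) : ℝ :=
  if h : ∃ a : Param d p, IsMaximizer k K X i a then expPoly h.choose (X i) (X i) else 0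

/-- The resubstitution entropy estimator `-(1/n) ∑ i, log (f̂_n (X i))`. -/
def entropyEstimate {d n : ℕ} (k p : ℕ) (K : E d → ℝ) (X : Fin n → E d) : ℝ :=
  -(1 / (n : ℝ)) * ∑ i, Real.log (densityEstimate k p K X i)

/-- `f` is a twice continuously differentiable probability density on `ℝ^d`. -/
structure IsC2Density {d : ℕ} (f : E d → ℝ) : Prop where
  contDiff : ContDiff ℝ 2 f
  nonneg : ∀ x, 0 ≤ f x
  integral_eq_one : ∫ x, f x = 1

/-- The distribution on `ℝ^d` with density `f`. -/
def law {d : ℕ} (f : E d → ℝ) : Measure (E d) :=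
  volume.withDensity (fun x => ENNReal.ofReal (f x))

/-- The joint distribution of `n` i.i.d. samples with density `f`. -/
def sampleLaw {d : ℕ} (f : E d → ℝ) (n : ℕ) : Measure (Fin n → E d) :=
  Measure.pi (fun _ => law f)

/-- Differential entropy. -/
def entropy {d : ℕ} (f : E d → ℝ) : ℝ := -∫ x, f x * Real.log (f x)

/-- For all large `n`, almost surely, the maximization has a solution at every sample point. -/
def MaximizerExists {d : ℕ} (k p : ℕ) (K : E d → ℝ) (f : E d → ℝ) : Prop :=
  ∀ᶠ n : ℕ in atTop, ∀ᵐ X ∂(sampleLaw f n), ∀ i : Fin n, Solvable k p K X i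

/-- The first summand `H_1 = -log (f̂ (X_1))` of the estimator, for `n + 1` samples. -/
def firstTerm {d n : ℕ} (k p : ℕ) (K : E d → ℝ) (X : Fin (n + 1) → E d) : ℝ :=
  -Real.log (densityEstimate k p K X 0)

/-- `𝔼[H_1 | X_1 = x]` for `n + 1` samples: the other `n` samples are integrated out. -/
def condFirstTerm {d : ℕ} (k p : ℕ) (K : E d → ℝ) (f : E d → ℝ) (n : ℕ) (x : E d) : ℝ :=
  ∫ Y, firstTerm k p K (Fin.cons (α := fun _ => E d) x Y) ∂(sampleLaw f n)

/-- The exchange-of-limit assumption `lim 𝔼[H_1] = 𝔼_{X_1}[lim 𝔼[H_1 | X_1]]`: the expectations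
are finite (and `H_1` is bounded in `L^1`), the limit of the conditional expectation exists
almost everywhere, and the limit may be exchanged with the expectation over `X_1`. -/
structure ExchangeOfLimit {d : ℕ} (k p : ℕ) (K : E d → ℝ) (f : E d → ℝ) : Prop where
  bounded : ∃ C : ℝ, ∀ᶠ n : ℕ in atTop,
    Integrable (fun X : Fin (n + 1) → E d => firstTerm k p K X) (sampleLaw f (n + 1)) ∧
      ∫ X : Fin (n + 1) → E d, |firstTerm k p K X| ∂(sampleLaw f (n + 1)) ≤ C
  exchange : ∃ g : E d → ℝ,
    (∀ᵐ x ∂(law f), Tendsto (fun n : ℕ => condFirstTerm k p K f n x) atTop (𝓝 (g x))) ∧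
      Tendsto (fun n : ℕ => ∫ X : Fin (n + 1) → E d, firstTerm k p K X ∂(sampleLaw f (n + 1)))
        atTop (𝓝 (∫ x, g x ∂(law f)))

/-- The step kernel `𝕀(‖u‖ ≤ 1)`. -/
def stepKernel (d : ℕ) : E d → ℝ := Set.indicator (Metric.closedBall 0 1) (fun _ => 1)

/-- Volume `π^{d/2} / Γ(d/2 + 1)` of the unit ball of `ℝ^d`. -/
def unitBallVolume (d : ℕ) : ℝ := Real.pi ^ ((d : ℝ) / 2) / Real.Gamma ((d : ℝ) / 2 + 1)

/-- The digamma function `ψ = Γ' / Γ` on the reals. -/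
def digamma (x : ℝ) : ℝ := deriv Real.Gamma x / Real.Gamma x

end LLDE

end

/-! Condition on X_1 = x with f(x) > 0. The estimate at x sees only the m = ⌈log n⌉ nearest sample
points, and the local problem is equivariant: dilating the neighbours by s and putting the sample
size N in place of 1 shifts -a_0 by log N + d log s (`locTerm_smul`). In coordinates centred at x
and dilated by f(x)^(1/d), a sample point has a law ν that agrees with Lebesgue measure on the ball
of radius t about 0 up to a relative error L t, for small t (`exists_nearLebesgue_normLaw`). Hence
E[H_1 | X_1 = x] + log f(x) is the integral of a functional free of f and x against the law of the m
points nearest to 0 in a ν-sample; that law has density C(n, m) `outer`^(n - m) with respect to the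
m-fold product of ν (`integral_nearMeasure`).

For two such ν these laws differ by a factor exp(O(L r m + L r^(d+1) n)) on configurations within
radius r (`NearLebesgue.nearMeasure_le`). For r between n^(-1/d) and n^(-1/(d+1)) the exponent tends
to 0 while n r^d tends to infinity. The functional is unbounded and K is arbitrary, so
configurations leaving the ball need another argument. Samples of sizes q + 1 and 2q + 2 are
compared that use the same m: the functional changes by log 2 only, while far configurations become
rarer by a factor 4^m exp(-c q r^d) (`NearLebesgue.nearMeasure_far_le`). A first moment at the
smaller size therefore controls the far part at the larger one. Such moments come from (ii): bounded
E|H_1| gives, for almost every x, conditional moments of at most m²/2 along sequences with one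
sample size per m (`ae_eventually_le_sq`).

So lim E[H_1 | X_1 = x] + log f(x) is the same number for all good points and all admissible
densities (`GoodPoint.limit_unique`); this is the bias constant. Condition (ii) integrates it over
x, Fatou's lemma gives integrability of log f, and exchangeability passes from H_1 to the average.

For the step kernel and p = 0 the objective is k a_0 - N V ρ^d exp(a_0), maximized explicitly. For
the bias, V ρ^d is replaced by the ν-mass of the ball of radius ρ, the k-th order statistic of n
uniform variables, whose logarithm has mean H_{k-1} - H_n (harmonic numbers). Adding log(n + 1) -
log k and letting n grow yields ψ(k) - log k. -/

noncomputable section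
namespace LLDE

/-! ### Monotonicity and scaling of product measures -/

section General

variable {α : Type*} [MeasurableSpace α]

theorem pi_le_pi {ι : Type*} [Fintype ι] {μ ν : Measure α} [SigmaFinite μ] [SigmaFinite ν]
    (h : μ ≤ ν) :
    Measure.pi (fun _ : ι => μ) ≤ Measure.pi (fun _ : ι => ν) := by
  refine Measure.le_iff.2 fun s hs => ?_
  rw [Measure.pi_def, Measure.pi_def, toMeasure_apply _ _ hs, toMeasure_apply _ _ hs]
  refine (OuterMeasure.le_pi.2 fun s _ => (OuterMeasure.pi_pi_le _ s).trans ?_) s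
  exact Finset.prod_le_prod' fun i _ => h _

theorem pi_smul_measure {ι : Type*} [Fintype ι] (ν : Measure α) [IsFiniteMeasure ν] {c : ENNReal}
    (hc : c ≠ ⊤) :
    Measure.pi (fun _ : ι => c • ν) = c ^ Fintype.card ι • Measure.pi (fun _ : ι => ν) := by
  have : IsFiniteMeasure (c • ν) := ν.smul_finite hc
  refine Measure.pi_eq fun s _ => ?_
  simp [Measure.pi_pi, Finset.prod_mul_distrib, Finset.prod_const]

end General

/-! ### The joint law of the nearest points -/

/-- The points of `Y` selected by `e` are nearer to the origin than all the others. -/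
def IsNearest {d m n : ℕ} (e : Fin m → Fin n) (Y : Fin n → E d) : Prop :=
  ∀ j, j ∉ Set.range e → ‖fun i => Y (e i)‖ < ‖Y j‖

theorem exists_finset_lt_compl {n : ℕ} {g : Fin n → ℝ} (hg : Function.Injective g) {m : ℕ}
    (hm : m ≤ n) : ∃ S : Finset (Fin n), S.card = m ∧ ∀ i ∈ S, ∀ j ∉ S, g i < g j := by
  induction m with
  | zero => exact ⟨∅, by simp⟩
  | succ m ih =>
    obtain ⟨S, hS, hlt⟩ := ih (by omega)
    have hne : Sᶜ.Nonempty := by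
      rw [← Finset.card_pos, Finset.card_compl, Fintype.card_fin]; omega
    obtain ⟨a, ha, hmin⟩ := Sᶜ.exists_min_image g hne
    rw [Finset.mem_compl] at ha
    refine ⟨insert a S, by rw [Finset.card_insert_of_notMem ha, hS], fun i hi j hj => ?_⟩
    rw [Finset.mem_insert, not_or] at hj
    rcases Finset.mem_insert.1 hi with rfl | hi
    · exact lt_of_le_of_ne (hmin j (Finset.mem_compl.2 hj.2)) fun h => hj.1 (hg h).symm
    · exact hlt i hi j hj.2

theorem exists_isNearest {d m n : ℕ} (hm : 1 ≤ m) (hmn : m ≤ n) {Y : Fin n → E d}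
    (hY : Function.Injective fun j => ‖Y j‖) :
    ∃ S : {S : Finset (Fin n) // S.card = m}, IsNearest (S.1.orderEmbOfFin S.2) Y := by
  obtain ⟨S, hS, hlt⟩ := exists_finset_lt_compl hY hmn
  refine ⟨⟨S, hS⟩, fun j hj => ?_⟩
  rw [Finset.range_orderEmbOfFin, Finset.mem_coe] at hj
  have hlt' : ∀ i, ‖Y (S.orderEmbOfFin hS i)‖ < ‖Y j‖ :=
    fun i => hlt _ (Finset.orderEmbOfFin_mem S hS i) j hj
  exact (pi_norm_lt_iff ((norm_nonneg _).trans_lt (hlt' ⟨0, hm⟩))).2 hlt'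

/-- Two distinct m-sets each contain an index missing from the other, and each of these two points
would have to be strictly farther away than the other. -/
theorem disjoint_isNearest {d m n : ℕ} (S S' : {S : Finset (Fin n) // S.card = m}) (h : S ≠ S') :
    Disjoint {Y : Fin n → E d | IsNearest (S.1.orderEmbOfFin S.2) Y}
      {Y : Fin n → E d | IsNearest (S'.1.orderEmbOfFin S'.2) Y} := by
  rw [Set.disjoint_left]
  intro Y h1 h2
  have key : ∀ T T' : {S : Finset (Fin n) // S.card = m}, T ≠ T' → ∃ i ∈ T.1, i ∉ T'.1 := by
    intro T T' hT
    by_contra! hc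
    exact hT (Subtype.ext (Finset.eq_of_subset_of_card_le hc (by rw [T.2, T'.2])))
  obtain ⟨i, hi, hi'⟩ := key S S' h
  obtain ⟨j, hj, hj'⟩ := key S' S h.symm
  have hle : ∀ T : {S : Finset (Fin n) // S.card = m}, ∀ l ∈ T.1,
      ‖Y l‖ ≤ ‖fun i => Y (T.1.orderEmbOfFin T.2 i)‖ := by
    intro T l hl
    have : l ∈ Set.range (T.1.orderEmbOfFin T.2) := by simpa using hl
    obtain ⟨a, rfl⟩ := this
    exact norm_le_pi_norm (fun i => Y (T.1.orderEmbOfFin T.2 i)) a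
  have a1 := h1 j (by simpa using hj')
  have a2 := h2 i (by simpa using hi')
  linarith [hle S i hi, hle S' j hj]

theorem measurableSet_isNearest {d m n : ℕ} (e : Fin m → Fin n) :
    MeasurableSet {Y : Fin n → E d | IsNearest e Y} := by
  simp only [IsNearest, Set.ofPred_forall]
  refine MeasurableSet.iInter fun j => MeasurableSet.iInter fun _ => ?_
  exact measurableSet_lt (by fun_prop) (by fun_prop)

/-- Given the other points, a tie puts `Y i` on a fixed sphere, which is null. -/
theorem ae_norm_ne {d : ℕ} (ν : Measure (E d)) [IsProbabilityMeasure ν]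
    (hν : ∀ t, ν (Metric.sphere 0 t) = 0) {n : ℕ} {i j : Fin n} (hij : i ≠ j) :
    ∀ᵐ Y ∂(Measure.pi fun _ : Fin n => ν), ‖Y i‖ ≠ ‖Y j‖ := by
  obtain _ | n := n
  · exact i.elim0
  obtain ⟨l, rfl⟩ := Fin.exists_succAbove_eq hij.symm
  have hmp := measurePreserving_piFinSuccAbove (fun _ : Fin (n + 1) => ν) i
  have hmeas : MeasurableSet {q : E d × (Fin n → E d) | ‖q.1‖ ≠ ‖q.2 l‖} :=
    (measurableSet_eq_fun (by fun_prop) (by fun_prop)).compl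
  have h : ∀ᵐ q ∂(ν.prod (Measure.pi fun _ : Fin n => ν)), ‖q.1‖ ≠ ‖q.2 l‖ := by
    have hs : ∀ᵐ q ∂((Measure.pi fun _ : Fin n => ν).prod ν), ‖q.2‖ ≠ ‖q.1 l‖ := by
      rw [Measure.ae_prod_iff_ae_ae (p := fun q : (Fin n → E d) × E d => ‖q.2‖ ≠ ‖q.1 l‖)
        ((measurableSet_eq_fun (by fun_prop) (by fun_prop)).compl)]
      refine Eventually.of_forall fun y => ?_
      rw [ae_iff]
      convert hν ‖y l‖ using 2
      ext z; simp
    have := Measure.measurePreserving_swap (μ := ν) (ν := Measure.pi fun _ : Fin n => ν)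
    exact this.quasiMeasurePreserving.ae hs
  exact hmp.quasiMeasurePreserving.ae h

theorem ae_norm_injective {d : ℕ} (ν : Measure (E d)) [IsProbabilityMeasure ν]
    (hν : ∀ t, ν (Metric.sphere 0 t) = 0) (n : ℕ) :
    ∀ᵐ Y ∂(Measure.pi fun _ : Fin n => ν), Function.Injective fun j => ‖Y j‖ := by
  have : ∀ᵐ Y ∂(Measure.pi fun _ : Fin n => ν), ∀ i j : Fin n, i ≠ j → ‖Y i‖ ≠ ‖Y j‖ := by
    refine ae_all_iff.2 fun i => ae_all_iff.2 fun j => ?_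
    by_cases h : i = j
    · exact Eventually.of_forall fun _ h' => absurd h h'
    · filter_upwards [ae_norm_ne ν hν h] with Y hY _ using hY
  filter_upwards [this] with Y hY i j hij
  by_contra h
  exact hY i j h hij

/-- The probability that a point lies farther from the origin than all the points of `z`. -/
def outer {d : ℕ} (ν : Measure (E d)) {m : ℕ} (z : Fin m → E d) : ENNReal :=
  ν {y | ‖z‖ < ‖y‖}

theorem measurable_outer {d : ℕ} (ν : Measure (E d)) [SFinite ν] {m : ℕ} :
    Measurable (outer ν : (Fin m → E d) → ENNReal) := by
  have : MeasurableSet {q : (Fin m → E d) × E d | ‖q.1‖ < ‖q.2‖} :=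
    measurableSet_lt (by fun_prop) (by fun_prop)
  exact measurable_measure_prodMk_left this

/-- The joint law of the `m` points nearest to the origin among `n` independent points with law
`ν`, in random order. -/
def nearMeasure {d : ℕ} (ν : Measure (E d)) (n m : ℕ) : Measure (Fin m → E d) :=
  (n.choose m : ENNReal) •
    (Measure.pi fun _ : Fin m => ν).withDensity fun z => outer ν z ^ (n - m)

section Selection

variable {d : ℕ} (ν : Measure (E d)) [IsProbabilityMeasure ν] {n m : ℕ}

/-- Split the product over the selected and the remaining indices: for fixed selected points z, the
other n - m points all lie beyond ‖z‖ with probability `outer ν z` ^ (n - m). No measurability of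
`h` is assumed; integrability of the weighted `h` is read off from that of `G` by Fubini. -/
theorem setIntegral_isNearest (S : {S : Finset (Fin n) // S.card = m}) {G : (Fin n → E d) → ℝ}
    {h : (Fin m → E d) → ℝ} (hG : Integrable G (Measure.pi fun _ : Fin n => ν))
    (hGh : ∀ᵐ Y ∂(Measure.pi fun _ : Fin n => ν), IsNearest (S.1.orderEmbOfFin S.2) Y →
      G Y = h fun i => Y (S.1.orderEmbOfFin S.2 i)) :
    Integrable (fun z => (outer ν z).toReal ^ (n - m) * h z) (Measure.pi fun _ : Fin m => ν) ∧
    ∫ z, (outer ν z).toReal ^ (n - m) * h z ∂(Measure.pi fun _ : Fin m => ν) =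
      ∫ Y in {Y | IsNearest (S.1.orderEmbOfFin S.2) Y}, G Y ∂(Measure.pi fun _ : Fin n => ν) := by
  have hc : S.1ᶜ.card = n - m := by rw [Finset.card_compl, Fintype.card_fin, S.2]
  set σ : Fin m ⊕ Fin (n - m) ≃ Fin n := finSumEquivOfFinset S.2 hc with hσ
  have hmp := (measurePreserving_sumPiEquivProdPi_symm
    (fun _ : Fin m ⊕ Fin (n - m) => ν)).trans
    (measurePreserving_piCongrLeft (fun _ : Fin n => ν) σ)
  set Ψ := (MeasurableEquiv.sumPiEquivProdPi fun _ : Fin m ⊕ Fin (n - m) => E d).symm.trans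
    (MeasurableEquiv.piCongrLeft (fun _ : Fin n => E d) σ) with hΨ
  have hΨl : ∀ q i, Ψ q (S.1.orderEmbOfFin S.2 i) = q.1 i := by
    intro q i
    rw [← finSumEquivOfFinset_inl S.2 hc i]
    exact Equiv.piCongrLeft_apply_apply (fun _ : Fin n => E d) σ _ (Sum.inl i)
  have hΨr : ∀ q i, Ψ q (S.1ᶜ.orderEmbOfFin hc i) = q.2 i := by
    intro q i
    rw [← finSumEquivOfFinset_inr S.2 hc i]
    exact Equiv.piCongrLeft_apply_apply (fun _ : Fin n => E d) σ _ (Sum.inr i)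
  set A : Set (Fin n → E d) := {Y | IsNearest (S.1.orderEmbOfFin S.2) Y} with hA
  set B : Set ((Fin m → E d) × (Fin (n - m) → E d)) := {q | ∀ j, ‖q.1‖ < ‖q.2 j‖} with hB
  have hpre : Ψ ⁻¹' A = B := by
    ext q
    simp only [hA, hB, Set.mem_preimage, Set.mem_ofPred_eq, IsNearest, hΨl]
    constructor
    · intro h j
      have := h (S.1ᶜ.orderEmbOfFin hc j) (by
        rw [Finset.range_orderEmbOfFin, Finset.mem_coe]
        exact Finset.mem_compl.1 (Finset.orderEmbOfFin_mem S.1ᶜ hc j))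
      rwa [hΨr] at this
    · intro h j hj
      have : j ∈ Set.range (S.1ᶜ.orderEmbOfFin hc) := by simpa using hj
      obtain ⟨l, rfl⟩ := this
      rw [hΨr]; exact h l
  have hBm : MeasurableSet B := by
    rw [← hpre]; exact Ψ.measurable (measurableSet_isNearest _)
  set μ' := (Measure.pi fun _ : Fin m => ν).prod (Measure.pi fun _ : Fin (n - m) => ν) with hμ'
  have hGΨ : Integrable (G ∘ Ψ) μ' := hmp.integrable_comp_of_integrable hG
  have hae : (G ∘ Ψ) =ᵐ[μ'.restrict B] fun q => h q.1 := by
    rw [EventuallyEq, ae_restrict_iff' hBm]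
    filter_upwards [hmp.quasiMeasurePreserving.ae hGh] with q hq hqB
    have hmem : IsNearest (S.1.orderEmbOfFin S.2) (Ψ q) := by
      have : q ∈ Ψ ⁻¹' A := by rwa [hpre]
      exact this
    have := hq hmem
    simp only [Function.comp]
    refine this.trans ?_
    congr 1
    funext i
    exact hΨl q i
  have hint : Integrable (B.indicator fun q => h q.1) μ' := by
    rw [integrable_indicator_iff hBm]
    exact (hGΨ.integrableOn (s := B)).congr hae
  have hinner : ∀ z, ∫ y, B.indicator (fun q => h q.1) (z, y) ∂(Measure.pi fun _ : Fin (n - m) => ν)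
      = (outer ν z).toReal ^ (n - m) * h z := by
    intro z
    have hset : (fun y => B.indicator (fun q => h q.1) (z, y)) =
        (Set.univ.pi fun _ : Fin (n - m) => {y : E d | ‖z‖ < ‖y‖}).indicator fun _ => h z := by
      funext y
      simp only [Set.indicator, hB, Set.mem_ofPred_eq, Set.mem_univ_pi]
    have hms : MeasurableSet (Set.univ.pi fun _ : Fin (n - m) => {y : E d | ‖z‖ < ‖y‖}) :=
      MeasurableSet.univ_pi fun _ => measurableSet_lt measurable_const measurable_norm
    rw [hset, integral_indicator hms, setIntegral_const, smul_eq_mul, measureReal_def,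
      Measure.pi_pi, Finset.prod_const, Finset.card_univ, Fintype.card_fin, ENNReal.toReal_pow]
    rfl
  refine ⟨?_, ?_⟩
  · have := hint.integral_prod_left
    simpa only [hinner] using this
  · rw [← hmp.setIntegral_preimage_emb Ψ.measurableEmbedding, hpre]
    change _ = ∫ q in B, (G ∘ Ψ) q ∂μ'
    rw [integral_congr_ae hae, ← integral_indicator hBm, integral_prod _ hint]
    simp only [hinner]

/-- A function of a sample of `n` points that depends only on the `m` points nearest to the origin
is integrated with `nearMeasure`. -/
theorem integral_nearMeasure (hν : ∀ t, ν (Metric.sphere 0 t) = 0) (hm : 1 ≤ m) (hmn : m ≤ n)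
    {G : (Fin n → E d) → ℝ} {h : (Fin m → E d) → ℝ}
    (hG : Integrable G (Measure.pi fun _ : Fin n => ν))
    (hGh : ∀ᵐ Y ∂(Measure.pi fun _ : Fin n => ν), ∀ e : Fin m → Fin n, Function.Injective e →
      IsNearest e Y → G Y = h fun i => Y (e i)) :
    Integrable h (nearMeasure ν n m) ∧
      ∫ z, h z ∂(nearMeasure ν n m) = ∫ Y, G Y ∂(Measure.pi fun _ : Fin n => ν) := by
  have key := fun S : {S : Finset (Fin n) // S.card = m} => setIntegral_isNearest ν S hG
    (hGh.mono fun Y hY => hY _ (S.1.orderEmbOfFin S.2).injective)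
  have hlt : ∀ z : Fin m → E d, outer ν z ^ (n - m) < ⊤ :=
    fun z => ENNReal.pow_lt_top (measure_lt_top _ _)
  obtain ⟨S₀, hS₀⟩ := Finset.exists_subset_card_eq (s := (Finset.univ : Finset (Fin n)))
    (by simpa using hmn)
  have hmeas := (measurable_outer ν (m := m)).pow_const (n - m)
  constructor
  · refine Integrable.smul_measure ?_ (by simp)
    rw [integrable_withDensity_iff_integrable_smul' hmeas (Eventually.of_forall hlt)]
    simpa [ENNReal.toReal_pow] using (key ⟨S₀, hS₀.2⟩).1
  -- The events indexed by m-subsets partition the sample space up to ties and all contribute the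
  -- same integral, whence the factor C(n, m).
  · have huniv : (⋃ S : {S : Finset (Fin n) // S.card = m},
        {Y : Fin n → E d | IsNearest (S.1.orderEmbOfFin S.2) Y})
        =ᵐ[Measure.pi fun _ : Fin n => ν] Set.univ := by
      rw [eventuallyEq_univ]
      filter_upwards [ae_norm_injective ν hν n] with Y hY
      exact Set.mem_iUnion.2 (exists_isNearest hm hmn hY)
    rw [← setIntegral_univ (f := G), ← setIntegral_congr_set huniv,
      integral_iUnion_fintype (fun S => measurableSet_isNearest _) disjoint_isNearest
        (fun S => hG.integrableOn)]
    simp only [← (key _).2]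
    rw [Finset.sum_const, Finset.card_univ, Fintype.card_finset_len, Fintype.card_fin, nearMeasure,
      integral_smul_measure, integral_withDensity_eq_integral_toReal_smul hmeas
        (Eventually.of_forall hlt)]
    simp [ENNReal.toReal_pow]

theorem isProbabilityMeasure_nearMeasure (hν : ∀ t, ν (Metric.sphere 0 t) = 0) (hm : 1 ≤ m)
    (hmn : m ≤ n) : IsProbabilityMeasure (nearMeasure ν n m) := by
  obtain ⟨h1, h2⟩ := integral_nearMeasure ν hν hm hmn (G := fun _ => 1) (h := fun _ => 1)
    (integrable_const _) (Eventually.of_forall fun _ _ _ _ => rfl)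
  have hfin : IsFiniteMeasure (nearMeasure ν n m) := by
    simpa [integrable_const_iff] using h1
  rw [isProbabilityMeasure_iff_real]
  simpa using h2

end Selection

end LLDE
end

/-! ### Comparison of laws that are nearly Lebesgue near the origin -/

noncomputable section
namespace LLDE

/-- `ν` is a probability measure that is close to Lebesgue measure near the origin, with a linear
rate. -/
structure NearLebesgue {d : ℕ} (ν : Measure (E d)) (L δ : ℝ) : Prop where
  isProb : IsProbabilityMeasure ν
  ac : ν ≪ volume
  pos : 0 < δ
  nonneg : 0 ≤ L
  upper : ∀ t, 0 ≤ t → t ≤ δ → ν.restrict (Metric.closedBall 0 t) ≤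
    ENNReal.ofReal (1 + L * t) • volume.restrict (Metric.closedBall 0 t)
  lower : ∀ t, 0 ≤ t → t ≤ δ → ENNReal.ofReal (1 - L * t) •
    volume.restrict (Metric.closedBall 0 t) ≤ ν.restrict (Metric.closedBall 0 t)

/-- Volume of the unit ball. -/
def ballVol (d : ℕ) : ℝ := volume.real (Metric.closedBall (0 : E d) 1)

theorem ballVol_pos (d : ℕ) : 0 < ballVol d :=
  ENNReal.toReal_pos (Metric.measure_closedBall_pos _ _ one_pos).ne' measure_closedBall_lt_top.ne

theorem volume_real_closedBall {d : ℕ} {t : ℝ} (ht : 0 ≤ t) :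
    volume.real (Metric.closedBall (0 : E d) t) = ballVol d * t ^ d := by
  rw [Measure.addHaar_real_closedBall' _ _ ht, mul_comm]
  simp [ballVol]

/-- Turns the ratio (1 + x) / (1 - x) of upper and lower density bounds into an exponential, so that
exponents add up over products. -/
theorem one_add_le_exp_mul_one_sub {x : ℝ} (h0 : 0 ≤ x) (h1 : x ≤ 1 / 2) :
    1 + x ≤ Real.exp (4 * x) * (1 - x) := by
  have h := Real.add_one_le_exp (4 * x)
  nlinarith

theorem nearMeasure_restrict {d : ℕ} (ν : Measure (E d)) (n m : ℕ) {R : Set (Fin m → E d)}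
    (hR : MeasurableSet R) {s : Set (Fin m → E d)} (hs : MeasurableSet s) :
    (nearMeasure ν n m).restrict R s = (n.choose m : ENNReal) *
      ∫⁻ z in s, outer ν z ^ (n - m) ∂((Measure.pi fun _ : Fin m => ν).restrict R) := by
  rw [nearMeasure, Measure.restrict_smul, Measure.smul_apply, restrict_withDensity hR,
    withDensity_apply _ hs, smul_eq_mul]

/-- Falling factorials compared factor by factor: 2q + 1 ≤ 4 (q + 1 - m) by the hypothesis, and
every factor belonging to `q` is at least q + 1 - m. -/
theorem choose_two_mul_add_one_le {q m : ℕ} (h : 2 * m ≤ q + 1) :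
    (2 * q + 1).choose m ≤ 4 ^ m * q.choose m := by
  refine Nat.le_of_mul_le_mul_left ?_ m.factorial_pos
  calc m.factorial * (2 * q + 1).choose m = (2 * q + 1).descFactorial m :=
        (Nat.descFactorial_eq_factorial_mul_choose _ _).symm
    _ ≤ (2 * q + 1) ^ m := Nat.descFactorial_le_pow _ _
    _ ≤ (4 * (q + 1 - m)) ^ m := Nat.pow_le_pow_left (by omega) _
    _ = 4 ^ m * (q + 1 - m) ^ m := mul_pow _ _ _
    _ ≤ 4 ^ m * q.descFactorial m := Nat.mul_le_mul_left _ (Nat.pow_sub_le_descFactorial _ _)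
    _ = m.factorial * (4 ^ m * q.choose m) := by
        rw [Nat.descFactorial_eq_factorial_mul_choose]; ring

theorem measurableSet_norm_le {d m : ℕ} (r : ℝ) : MeasurableSet {z : Fin m → E d | ‖z‖ ≤ r} :=
  measurableSet_le measurable_norm measurable_const

theorem measurableSet_lt_norm {d m : ℕ} (r : ℝ) : MeasurableSet {z : Fin m → E d | r < ‖z‖} :=
  measurableSet_lt measurable_const measurable_norm

namespace NearLebesgue

variable {d : ℕ} {ν ν₁ ν₂ : Measure (E d)} {L δ L₁ L₂ δ₁ δ₂ : ℝ}

/-- Brings two laws to common constants before they are compared. -/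
theorem mono (h : NearLebesgue ν L₁ δ₁) (hL : L₁ ≤ L₂) (hδ : δ₂ ≤ δ₁) (hδ' : 0 < δ₂) :
    NearLebesgue ν L₂ δ₂ where
  isProb := h.isProb
  ac := h.ac
  pos := hδ'
  nonneg := h.nonneg.trans hL
  upper t h0 ht := (h.upper t h0 (ht.trans hδ)).trans fun s => by
    simp only [Measure.smul_apply, smul_eq_mul]
    gcongr
  lower t h0 ht := le_trans (fun s => by
    simp only [Measure.smul_apply, smul_eq_mul]
    gcongr) (h.lower t h0 (ht.trans hδ))

theorem sphere_null (h : NearLebesgue ν L δ) (hd : 1 ≤ d) (t : ℝ) :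
    ν (Metric.sphere 0 t) = 0 := by
  have : Nonempty (Fin d) := ⟨⟨0, hd⟩⟩
  exact h.ac (Measure.addHaar_sphere _ _ _)

theorem real_le (h : NearLebesgue ν L δ) {t : ℝ} (h0 : 0 ≤ t) (ht : t ≤ δ) :
    ν.real (Metric.closedBall 0 t) ≤ (1 + L * t) * (ballVol d * t ^ d) := by
  have h1 := h.upper t h0 ht Set.univ
  have hL := h.nonneg
  simp only [Measure.restrict_apply_univ, Measure.smul_apply, smul_eq_mul] at h1
  have h2 := ENNReal.toReal_mono (ENNReal.mul_ne_top ENNReal.ofReal_ne_top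
    measure_closedBall_lt_top.ne) h1
  rw [ENNReal.toReal_mul, ENNReal.toReal_ofReal (by positivity)] at h2
  rwa [← volume_real_closedBall h0]

theorem le_real (h : NearLebesgue ν L δ) {t : ℝ} (h0 : 0 ≤ t) (ht : t ≤ δ) (hLt : L * t ≤ 1) :
    (1 - L * t) * (ballVol d * t ^ d) ≤ ν.real (Metric.closedBall 0 t) := by
  have := h.isProb
  have h1 := h.lower t h0 ht Set.univ
  simp only [Measure.restrict_apply_univ, Measure.smul_apply, smul_eq_mul] at h1
  have h2 := ENNReal.toReal_mono (measure_ne_top _ _) h1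
  rw [ENNReal.toReal_mul, ENNReal.toReal_ofReal (by linarith)] at h2
  rwa [← volume_real_closedBall h0]

theorem compl_closedBall (t : ℝ) : {y : E d | t < ‖y‖} = (Metric.closedBall 0 t)ᶜ := by
  ext y; simp

theorem outer_eq (h : NearLebesgue ν L δ) {m : ℕ} (z : Fin m → E d) :
    outer ν z = ENNReal.ofReal (1 - ν.real (Metric.closedBall 0 ‖z‖)) := by
  have := h.isProb
  rw [outer, compl_closedBall, ← probReal_compl_eq_one_sub Metric.isClosed_closedBall.measurableSet,
    ofReal_measureReal]

/-- Ratio bound for the laws restricted to a small ball. -/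
theorem restrict_le (h₁ : NearLebesgue ν₁ L δ) (h₂ : NearLebesgue ν₂ L δ) {r : ℝ} (h0 : 0 ≤ r)
    (hr : r ≤ δ) (hLr : L * r ≤ 1 / 2) :
    ν₁.restrict (Metric.closedBall 0 r) ≤
      ENNReal.ofReal (Real.exp (4 * (L * r))) • ν₂.restrict (Metric.closedBall 0 r) := by
  have hL := h₁.nonneg
  refine (h₁.upper r h0 hr).trans fun s => ?_
  have hlow := h₂.lower r h0 hr s
  simp only [Measure.smul_apply, smul_eq_mul] at hlow ⊢
  calc ENNReal.ofReal (1 + L * r) * volume.restrict (Metric.closedBall 0 r) s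
      ≤ ENNReal.ofReal (Real.exp (4 * (L * r)) * (1 - L * r)) *
          volume.restrict (Metric.closedBall 0 r) s := by
        gcongr
        exact one_add_le_exp_mul_one_sub (by positivity) hLr
    _ = ENNReal.ofReal (Real.exp (4 * (L * r))) * (ENNReal.ofReal (1 - L * r) *
          volume.restrict (Metric.closedBall 0 r) s) := by
        rw [ENNReal.ofReal_mul (Real.exp_pos _).le, mul_assoc]
    _ ≤ _ := by gcongr

theorem pi_restrict_le (h₁ : NearLebesgue ν₁ L δ) (h₂ : NearLebesgue ν₂ L δ) {r : ℝ} (h0 : 0 ≤ r)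
    (hr : r ≤ δ) (hLr : L * r ≤ 1 / 2) (m : ℕ) :
    (Measure.pi fun _ : Fin m => ν₁).restrict {z | ‖z‖ ≤ r} ≤
      ENNReal.ofReal (Real.exp (4 * (L * r) * m)) •
        (Measure.pi fun _ : Fin m => ν₂).restrict {z | ‖z‖ ≤ r} := by
  have := h₁.isProb
  have := h₂.isProb
  have hset : {z : Fin m → E d | ‖z‖ ≤ r} = Set.univ.pi fun _ => Metric.closedBall 0 r := by
    ext z; simp [pi_norm_le_iff_of_nonneg h0]
  have hfin : IsFiniteMeasure
      (ENNReal.ofReal (Real.exp (4 * (L * r))) • ν₂.restrict (Metric.closedBall 0 r)) :=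
    Measure.smul_finite _ ENNReal.ofReal_ne_top
  rw [hset, Measure.restrict_pi_pi, Measure.restrict_pi_pi]
  refine (pi_le_pi (restrict_le h₁ h₂ h0 hr hLr)).trans_eq ?_
  rw [pi_smul_measure _ ENNReal.ofReal_ne_top, Fintype.card_fin,
    ← ENNReal.ofReal_pow (Real.exp_pos _).le, ← Real.exp_nat_mul, mul_comm (m : ℝ)]

/-- With t = ‖z‖ and V = `ballVol d`, the two masses of the ball of radius t differ by at most 2 L t
V t^d, which is of order r^(d+1). Since `outer ν₂ z` is at least 1/2, the additive error becomes a
relative one. -/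
theorem outer_le (h₁ : NearLebesgue ν₁ L δ) (h₂ : NearLebesgue ν₂ L δ) {r : ℝ} (hr : r ≤ δ)
    (hLr : L * r ≤ 1 / 2) (hV : ballVol d * r ^ d ≤ 1 / 4) {m : ℕ} {z : Fin m → E d}
    (hz : ‖z‖ ≤ r) :
    outer ν₁ z ≤ ENNReal.ofReal (Real.exp (4 * L * ballVol d * r ^ (d + 1))) * outer ν₂ z := by
  rw [h₁.outer_eq, h₂.outer_eq, ← ENNReal.ofReal_mul (Real.exp_pos _).le]
  refine ENNReal.ofReal_le_ofReal ?_
  have hz0 := norm_nonneg z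
  set t := ‖z‖
  have hL := h₁.nonneg
  have hVp := ballVol_pos d
  have hLt : L * t ≤ L * r := by gcongr
  have htd : ballVol d * t ^ d ≤ ballVol d * r ^ d := by gcongr
  have hb1 := h₁.le_real hz0 (hz.trans hr) (by linarith)
  have hb2 := h₂.real_le hz0 (hz.trans hr)
  have htd0 : 0 ≤ ballVol d * t ^ d := by positivity
  have hsm : (1 + L * t) * (ballVol d * t ^ d) ≤ 1 / 2 := by nlinarith
  have hx : L * t * (ballVol d * t ^ d) ≤ L * ballVol d * r ^ (d + 1) := by
    calc L * t * (ballVol d * t ^ d) = L * ballVol d * t ^ (d + 1) := by ring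
      _ ≤ _ := by gcongr
  have hx0 : 0 ≤ L * t * (ballVol d * t ^ d) := by positivity
  have hexp := Real.add_one_le_exp (4 * L * ballVol d * r ^ (d + 1))
  set x := L * ballVol d * r ^ (d + 1)
  have : (1 - ν₁.real (Metric.closedBall 0 t)) ≤
      (4 * L * ballVol d * r ^ (d + 1) + 1) * (1 - ν₂.real (Metric.closedBall 0 t)) := by
    have e : 4 * L * ballVol d * r ^ (d + 1) = 4 * x := by ring
    rw [e]
    nlinarith
  refine this.trans ?_
  gcongr
  linarith

/-- Ratio bound for the laws of the nearest points. -/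
theorem nearMeasure_le (h₁ : NearLebesgue ν₁ L δ) (h₂ : NearLebesgue ν₂ L δ) {r : ℝ} (h0 : 0 ≤ r)
    (hr : r ≤ δ) (hLr : L * r ≤ 1 / 2) (hV : ballVol d * r ^ d ≤ 1 / 4) (n m : ℕ) :
    (nearMeasure ν₁ n m).restrict {z | ‖z‖ ≤ r} ≤
      ENNReal.ofReal (Real.exp (4 * (L * r) * m + 4 * L * ballVol d * r ^ (d + 1) * n)) •
        (nearMeasure ν₂ n m).restrict {z | ‖z‖ ≤ r} := by
  have hL := h₁.nonneg
  have hVp := ballVol_pos d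
  have := h₂.isProb
  refine Measure.le_iff.2 fun s hs => ?_
  have hR := measurableSet_norm_le (d := d) (m := m) r
  rw [Measure.smul_apply, nearMeasure_restrict _ _ _ hR hs, nearMeasure_restrict _ _ _ hR hs,
    smul_eq_mul, mul_left_comm]
  gcongr
  have hpi := pi_restrict_le h₁ h₂ h0 hr hLr m
  set x := 4 * L * ballVol d * r ^ (d + 1)
  have hx : 0 ≤ x := by positivity
  have hmeas := (measurable_outer ν₂ (m := m)).pow_const (n - m)
  -- The weight is exchanged before the reference measure: the former costs n - m factors with
  -- exponent of order r^(d+1), the latter m factors with exponent of order r.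
  calc ∫⁻ z in s, outer ν₁ z ^ (n - m) ∂((Measure.pi fun _ : Fin m => ν₁).restrict {z | ‖z‖ ≤ r})
      ≤ ∫⁻ z in s, (ENNReal.ofReal (Real.exp x) * outer ν₂ z) ^ (n - m)
          ∂((Measure.pi fun _ : Fin m => ν₁).restrict {z | ‖z‖ ≤ r}) := by
        refine lintegral_mono_ae (ae_restrict_of_ae ?_)
        filter_upwards [ae_restrict_mem hR] with z hz
        gcongr
        exact outer_le h₁ h₂ hr hLr hV hz
    _ ≤ ∫⁻ z in s, (ENNReal.ofReal (Real.exp x) * outer ν₂ z) ^ (n - m)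
          ∂(ENNReal.ofReal (Real.exp (4 * (L * r) * m)) •
            (Measure.pi fun _ : Fin m => ν₂).restrict {z | ‖z‖ ≤ r}) :=
        lintegral_mono' (Measure.restrict_mono le_rfl hpi) le_rfl
    _ = ENNReal.ofReal (Real.exp (4 * (L * r) * m)) * (ENNReal.ofReal (Real.exp x) ^ (n - m) *
          ∫⁻ z in s, outer ν₂ z ^ (n - m)
            ∂((Measure.pi fun _ : Fin m => ν₂).restrict {z | ‖z‖ ≤ r})) := by
        rw [Measure.restrict_smul, lintegral_smul_measure, smul_eq_mul]
        simp only [mul_pow]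
        rw [lintegral_const_mul _ hmeas]
    _ ≤ _ := by
        rw [← mul_assoc]
        gcongr
        rw [← ENNReal.ofReal_pow (Real.exp_pos _).le, ← ENNReal.ofReal_mul (Real.exp_pos _).le,
          ← Real.exp_nat_mul, ← Real.exp_add]
        refine ENNReal.ofReal_le_ofReal (Real.exp_le_exp.2 ?_)
        have : ((n - m : ℕ) : ℝ) ≤ n := by exact_mod_cast Nat.sub_le _ _
        nlinarith

/-- Far configurations: more sample points make them much less likely. -/
theorem nearMeasure_far_le (h : NearLebesgue ν L δ) {r : ℝ} (h0 : 0 ≤ r) (hr : r ≤ δ)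
    (hLr : L * r ≤ 1 / 2) {q m : ℕ} (hq : 2 * m ≤ q + 1) :
    (nearMeasure ν (2 * q + 1) m).restrict {z | r < ‖z‖} ≤
      ENNReal.ofReal (4 ^ m * Real.exp (-(ballVol d * r ^ d / 2)) ^ (q + 1)) •
        (nearMeasure ν q m).restrict {z | r < ‖z‖} := by
  have := h.isProb
  have hVp := ballVol_pos d
  refine Measure.le_iff.2 fun s hs => ?_
  have hR := measurableSet_lt_norm (d := d) (m := m) r
  rw [Measure.smul_apply, nearMeasure_restrict _ _ _ hR hs, nearMeasure_restrict _ _ _ hR hs,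
    smul_eq_mul]
  rcases Nat.lt_or_ge q m with hlt | hge
  · omega
  set e := Real.exp (-(ballVol d * r ^ d / 2)) with he
  have hout : ∀ z : Fin m → E d, r < ‖z‖ →
      outer ν z ^ (2 * q + 1 - m) ≤ ENNReal.ofReal (e ^ (q + 1)) * outer ν z ^ (q - m) := by
    intro z hz
    -- The larger sample has q + 1 additional points, each of which must also avoid the ball of
    -- radius r.
    have e1 : 2 * q + 1 - m = (q + 1) + (q - m) := by omega
    rw [e1, pow_add, ENNReal.ofReal_pow (Real.exp_pos _).le]
    gcongr
    rw [h.outer_eq]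
    refine ENNReal.ofReal_le_ofReal ?_
    have hb := h.le_real h0 hr (by linarith)
    have hm : ν.real (Metric.closedBall 0 r) ≤ ν.real (Metric.closedBall 0 ‖z‖) :=
      measureReal_mono (Metric.closedBall_subset_closedBall hz.le)
    have hexp := Real.add_one_le_exp (-(ballVol d * r ^ d / 2))
    have : 0 ≤ ballVol d * r ^ d := by positivity
    nlinarith
  calc ((2 * q + 1).choose m : ENNReal) * ∫⁻ z in s, outer ν z ^ (2 * q + 1 - m)
          ∂((Measure.pi fun _ : Fin m => ν).restrict {z | r < ‖z‖})
      ≤ ((4 ^ m * q.choose m : ℕ) : ENNReal) * ∫⁻ z in s, ENNReal.ofReal (e ^ (q + 1)) *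
          outer ν z ^ (q - m) ∂((Measure.pi fun _ : Fin m => ν).restrict {z | r < ‖z‖}) := by
        gcongr ?_ * ?_
        · exact_mod_cast choose_two_mul_add_one_le hq
        · refine lintegral_mono_ae (ae_restrict_of_ae ?_)
          filter_upwards [ae_restrict_mem hR] with z hz using hout z hz
    _ = _ := by
        rw [lintegral_const_mul _ ((measurable_outer ν).pow_const _),
          ENNReal.ofReal_mul (by positivity), ENNReal.ofReal_pow (by norm_num : (0 : ℝ) ≤ 4)]
        push_cast
        rw [show ENNReal.ofReal 4 = 4 by norm_num]
        ring

end NearLebesgue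

section Compare

variable {α : Type*} [MeasurableSpace α]

theorem integral_le_of_measure_le {μ ν : Measure α} {c : ℝ} (hc : 0 ≤ c) {g : α → ℝ}
    (hg : ∀ x, 0 ≤ g x) (hgν : Integrable g ν) (hle : μ ≤ ENNReal.ofReal c • ν) :
    ∫ x, g x ∂μ ≤ c * ∫ x, g x ∂ν := by
  have h1 := integral_mono_measure hle (Eventually.of_forall hg)
    (hgν.smul_measure ENNReal.ofReal_ne_top)
  rwa [integral_smul_measure, ENNReal.toReal_ofReal hc, smul_eq_mul] at h1

/-- Two measures with density ratio close to `1` on `R` and small contributions from outside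
have close integrals. -/
theorem abs_integral_sub_le {μ ν : Measure α} {R : Set α} (hR : MeasurableSet R) {c D β : ℝ}
    (hc : 1 ≤ c) {g : α → ℝ} (hgμ : Integrable g μ) (hgν : Integrable g ν)
    (h1 : μ.restrict R ≤ ENNReal.ofReal c • ν.restrict R)
    (h2 : ν.restrict R ≤ ENNReal.ofReal c • μ.restrict R)
    (hDμ : ∫ x, |g x| ∂μ ≤ D) (hDν : ∫ x, |g x| ∂ν ≤ D)
    (hβμ : ∫ x in Rᶜ, |g x| ∂μ ≤ β) (hβν : ∫ x in Rᶜ, |g x| ∂ν ≤ β) :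
    |∫ x, g x ∂μ - ∫ x, g x ∂ν| ≤ (c - 1) * (2 * D) + 2 * β := by
  have hc0 : 0 ≤ c := by linarith
  -- For nonnegative functions the two integrals over R agree up to a factor c in both directions;
  -- positive and negative parts then give the signed case.
  have part : ∀ g : α → ℝ, (∀ x, 0 ≤ g x) → Integrable g μ → Integrable g ν →
      |∫ x in R, g x ∂μ - ∫ x in R, g x ∂ν| ≤
        (c - 1) * (∫ x in R, g x ∂μ + ∫ x in R, g x ∂ν) := by
    intro g hg hμ hν
    have a1 := integral_le_of_measure_le hc0 hg (hν.integrableOn (s := R)) h1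
    have a2 := integral_le_of_measure_le hc0 hg (hμ.integrableOn (s := R)) h2
    have p1 : 0 ≤ ∫ x in R, g x ∂μ := integral_nonneg hg
    have p2 : 0 ≤ ∫ x in R, g x ∂ν := integral_nonneg hg
    rw [abs_le]
    constructor <;> nlinarith
  have hp := part (fun x => max (g x) 0) (fun x => le_max_right _ _) hgμ.pos_part hgν.pos_part
  have hn := part (fun x => max (-g x) 0) (fun x => le_max_right _ _) hgμ.neg_part hgν.neg_part
  have sub : ∀ ρ : Measure α, Integrable g ρ → ∫ x in R, g x ∂ρ =
      ∫ x in R, max (g x) 0 ∂ρ - ∫ x in R, max (-g x) 0 ∂ρ := by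
    intro ρ hρ
    rw [← integral_sub hρ.pos_part.integrableOn hρ.neg_part.integrableOn]
    congr 1; funext x
    rcases le_total 0 (g x) with h | h <;> simp [h]
  have add : ∀ ρ : Measure α, Integrable g ρ → ∫ x in R, |g x| ∂ρ =
      ∫ x in R, max (g x) 0 ∂ρ + ∫ x in R, max (-g x) 0 ∂ρ := by
    intro ρ hρ
    rw [← integral_add hρ.pos_part.integrableOn hρ.neg_part.integrableOn]
    congr 1; funext x
    rcases le_total 0 (g x) with h | h <;> simp [h, abs_of_nonneg, abs_of_nonpos]
  have hle : ∀ ρ : Measure α, Integrable g ρ → ∫ x in R, |g x| ∂ρ ≤ ∫ x, |g x| ∂ρ :=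
    fun ρ hρ => setIntegral_le_integral hρ.abs (Eventually.of_forall fun x => abs_nonneg _)
  have hcompl : ∀ ρ : Measure α, |∫ x in Rᶜ, g x ∂ρ| ≤ ∫ x in Rᶜ, |g x| ∂ρ :=
    fun ρ => abs_integral_le_integral_abs
  have e1 := integral_add_compl hR hgμ
  have e2 := integral_add_compl hR hgν
  have s1 := sub μ hgμ
  have s2 := sub ν hgν
  have t1 := add μ hgμ
  have t2 := add ν hgν
  have l1 := hle μ hgμ
  have l2 := hle ν hgν
  have c1 := hcompl μ
  have c2 := hcompl ν
  have hfin : (c - 1) * (∫ x in R, |g x| ∂μ + ∫ x in R, |g x| ∂ν) ≤ (c - 1) * (2 * D) :=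
    mul_le_mul_of_nonneg_left (by linarith) (by linarith)
  rw [t1, t2] at hfin
  rw [abs_le] at hp hn c1 c2 ⊢
  constructor <;> nlinarith

end Compare

end LLDE
end

/-! ### Choice of radius and sample sizes, and the limit for nearly Lebesgue laws -/

noncomputable section
namespace LLDE

/-- Along `q = growth m` both `q + 1` and `2 q + 2` sample points use `m` nearest neighbours. -/
def growth (m : ℕ) : ℕ := ⌊Real.exp ((m : ℝ) - 1)⌋₊

/-- Radius of the ball that contains the nearest neighbours with high probability. -/
def radius (d m : ℕ) : ℝ := Real.exp (-(2 * m / (2 * d + 1)))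

theorem growth_le (m : ℕ) : (growth m : ℝ) ≤ Real.exp ((m : ℝ) - 1) :=
  Nat.floor_le (Real.exp_pos _).le

theorem lt_growth_add_one (m : ℕ) : Real.exp ((m : ℝ) - 1) < growth m + 1 :=
  Nat.lt_floor_add_one _

/-- Doubling stays within one step of ⌈log⌉ because e > 2; for m ≥ 3 the surplus (e - 2) e^(m-1)
absorbs the additive 2. -/
theorem two_mul_growth_add_two_le {m : ℕ} (hm : 3 ≤ m) :
    2 * (growth m : ℝ) + 2 ≤ Real.exp m := by
  have h := growth_le m
  have h3 : (3 : ℝ) ≤ m := by exact_mod_cast hm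
  have e1 : Real.exp m = Real.exp 1 * Real.exp ((m : ℝ) - 1) := by rw [← Real.exp_add]; ring_nf
  have e2 := Real.exp_one_gt_d9
  have e3 : Real.exp 1 * Real.exp 1 ≤ Real.exp ((m : ℝ) - 1) := by
    rw [← Real.exp_add]; exact Real.exp_le_exp.2 (by linarith)
  rw [e1]
  nlinarith

/-- `growth m + 1` is the least integer above e^(m-1), hence the smallest sample size that uses m
neighbours. -/
theorem ceil_log_eq {m N : ℕ} (hm : 1 ≤ m) (h1 : growth m + 1 ≤ N) (h2 : (N : ℝ) ≤ Real.exp m) :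
    ⌈Real.log (N : ℝ)⌉₊ = m := by
  have h1' : (growth m : ℝ) + 1 ≤ N := by exact_mod_cast h1
  have hpos : (0 : ℝ) < N := by have := Nat.cast_nonneg (α := ℝ) (growth m); linarith
  rw [Nat.ceil_eq_iff (by omega)]
  constructor
  · rw [Real.lt_log_iff_exp_lt hpos]
    push_cast [hm]
    exact (lt_growth_add_one m).trans_le h1'
  · rwa [Real.log_le_iff_le_exp hpos]

theorem ceil_log_growth {m : ℕ} (hm : 3 ≤ m) :
    ⌈Real.log ((growth m + 1 : ℕ) : ℝ)⌉₊ = m ∧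
      ⌈Real.log ((2 * growth m + 1 + 1 : ℕ) : ℝ)⌉₊ = m := by
  have h := two_mul_growth_add_two_le hm
  have h0 := Nat.cast_nonneg (α := ℝ) (growth m)
  exact ⟨ceil_log_eq (by omega) le_rfl (by push_cast; linarith),
    ceil_log_eq (by omega) (by omega) (by push_cast; linarith)⟩

theorem eventually_mul_le_exp {b c : ℝ} (hb : 0 < b) (hc : 0 < c) (A : ℝ) :
    ∀ᶠ m : ℕ in atTop, A * m ≤ c * Real.exp (b * m) := by
  have h1 : Tendsto (fun m : ℕ => b * (m : ℝ)) atTop atTop :=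
    tendsto_natCast_atTop_atTop.const_mul_atTop hb
  have h2 := (Real.tendsto_exp_div_pow_atTop 1).comp h1
  filter_upwards [h2.eventually_ge_atTop (|A| / (c * b)), eventually_ge_atTop 1] with m hm hm1
  have hm0 : (0 : ℝ) < m := by exact_mod_cast hm1
  simp only [Function.comp, pow_one] at hm
  rw [div_le_div_iff₀ (by positivity) (by positivity)] at hm
  have := le_abs_self A
  have h3 : b * (|A| * m) ≤ b * (c * Real.exp (b * m)) := by linarith
  have h4 := le_of_mul_le_mul_left h3 hb
  nlinarith

theorem eventually_two_mul_le_growth : ∀ᶠ m : ℕ in atTop, 2 * m ≤ growth m + 1 := by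
  filter_upwards [eventually_mul_le_exp one_pos (Real.exp_pos (-1)) 2] with m hm
  have := lt_growth_add_one m
  rw [← Real.exp_add] at hm
  have e : -1 + 1 * (m : ℝ) = m - 1 := by ring
  rw [e] at hm
  have : (2 * m : ℝ) ≤ (growth m : ℝ) + 1 := by linarith
  exact_mod_cast this

theorem tendsto_growth : Tendsto growth atTop atTop := by
  refine tendsto_atTop_mono' atTop ?_ (tendsto_sub_atTop_nat 1)
  filter_upwards [eventually_two_mul_le_growth] with m hm
  omega

theorem tendsto_pow_mul_exp {b : ℝ} (hb : 0 < b) (k : ℕ) :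
    Tendsto (fun m : ℕ => (m : ℝ) ^ k * Real.exp (-(b * m))) atTop (𝓝 0) := by
  have h1 : Tendsto (fun m : ℕ => b * (m : ℝ)) atTop atTop :=
    tendsto_natCast_atTop_atTop.const_mul_atTop hb
  have h2 := ((Real.tendsto_pow_mul_exp_neg_atTop_nhds_zero k).comp h1).const_mul (b ^ k)⁻¹
  rw [mul_zero] at h2
  refine h2.congr fun m => ?_
  simp only [Function.comp, mul_pow]
  field_simp

theorem radius_pos (d m : ℕ) : 0 < radius d m := Real.exp_pos _

theorem radius_eq (d m : ℕ) : radius d m = Real.exp (-(2 * (1 / (2 * d + 1)) * m)) := by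
  rw [radius]; congr 1; ring

theorem tendsto_radius (d : ℕ) : Tendsto (radius d) atTop (𝓝 0) := by
  have h := tendsto_pow_mul_exp (b := 2 * (1 / (2 * d + 1))) (by positivity) 0
  refine h.congr fun m => ?_
  rw [radius_eq, pow_zero, one_mul]

/-- The exponent 2 / (2d + 1) in `radius` lies between 1 / (d + 1) and 1 / d. Thus `growth m` times
the d-th power of the radius grows at least like e^(m/(2d+1)), while with the (d+1)-st power it
decays like e^(-m/(2d+1)). -/
theorem le_growth_mul_radius (d m : ℕ) :
    Real.exp (-1) * Real.exp (1 / (2 * d + 1) * m) ≤ (growth m + 1) * radius d m ^ d := by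
  have h := (lt_growth_add_one m).le
  calc Real.exp (-1) * Real.exp (1 / (2 * d + 1) * m)
      = Real.exp ((m : ℝ) - 1) * radius d m ^ d := by
        rw [radius, ← Real.exp_nat_mul, ← Real.exp_add, ← Real.exp_add]
        congr 1
        field_simp
        ring
    _ ≤ _ := by
        have := radius_pos d m
        gcongr

theorem growth_mul_radius_le (d : ℕ) {m : ℕ} (hm : 3 ≤ m) :
    radius d m ^ (d + 1) * ((2 * growth m + 1 : ℕ) : ℝ) ≤ Real.exp (-(1 / (2 * d + 1) * m)) := by
  have h := two_mul_growth_add_two_le hm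
  have hr := radius_pos d m
  calc radius d m ^ (d + 1) * ((2 * growth m + 1 : ℕ) : ℝ)
      ≤ radius d m ^ (d + 1) * Real.exp m := by
        gcongr
        push_cast
        linarith
    _ = _ := by
        rw [radius, ← Real.exp_nat_mul, ← Real.exp_add]
        congr 1
        push_cast
        field_simp
        ring

theorem sq_add_two_le (m : ℕ) : (m : ℝ) ^ 2 + 2 ≤ 3 * Real.exp m := by
  have h := Real.quadratic_le_exp_of_nonneg (Nat.cast_nonneg (α := ℝ) m)
  have := Nat.cast_nonneg (α := ℝ) m
  nlinarith

/-- The binomial ratio costs at most e^(2m) and the moment at most 3 e^m; the exponentially growing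
exponent eventually exceeds 4m, which leaves 3 e^(-m). -/
theorem tendsto_far_factor (d : ℕ) : Tendsto (fun m : ℕ => 4 ^ m *
    Real.exp (-(ballVol d * radius d m ^ d / 2)) ^ (growth m + 1) * ((m : ℝ) ^ 2 + 2))
    atTop (𝓝 0) := by
  have hV := ballVol_pos d
  have hlim : Tendsto (fun m : ℕ => 3 * Real.exp (-(m : ℝ))) atTop (𝓝 0) := by
    have := (tendsto_pow_mul_exp one_pos 0).const_mul 3
    simpa using this
  refine squeeze_zero' (Eventually.of_forall fun m => by positivity) ?_ hlim
  filter_upwards [eventually_mul_le_exp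
    (b := 1 / (2 * (d : ℝ) + 1)) (c := ballVol d / 2 * Real.exp (-1)) (by positivity)
    (by positivity) 4] with m h2
  have h1 := sq_add_two_le m
  have h3 := le_growth_mul_radius d m
  have h4 : (4 : ℝ) ^ m ≤ Real.exp (2 * m) := by
    have : (4 : ℝ) ≤ Real.exp 2 := by
      have := Real.exp_one_gt_d9
      rw [show (2 : ℝ) = 1 + 1 by norm_num, Real.exp_add]; nlinarith
    calc (4 : ℝ) ^ m ≤ Real.exp 2 ^ m := by gcongr
      _ = _ := by rw [← Real.exp_nat_mul, mul_comm]
  have h5 : Real.exp (-(ballVol d * radius d m ^ d / 2)) ^ (growth m + 1) ≤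
      Real.exp (-(4 * m)) := by
    rw [← Real.exp_nat_mul]
    refine Real.exp_le_exp.2 ?_
    push_cast
    nlinarith
  calc _ ≤ Real.exp (2 * m) * Real.exp (-(4 * m)) * (3 * Real.exp m) := by gcongr
    _ = 3 * Real.exp (-(m : ℝ)) := by
      rw [← Real.exp_add, mul_left_comm, ← Real.exp_add]
      ring_nf

/-- Exponent of the density ratio of two near-Lebesgue laws on the ball of radius `radius d m`. -/
def ratioExp (d : ℕ) (L : ℝ) (m : ℕ) : ℝ :=
  4 * (L * radius d m) * m + 4 * L * ballVol d * radius d m ^ (d + 1) * ((2 * growth m + 1 : ℕ) : ℝ)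

theorem ratioExp_nonneg (d : ℕ) {L : ℝ} (hL : 0 ≤ L) (m : ℕ) : 0 ≤ ratioExp d L m := by
  have := radius_pos d m
  have := ballVol_pos d
  unfold ratioExp
  positivity

/-- The exponent is O(m e^(-bm)) with b = 1 / (2d + 1), and this decay also beats the factor m² that
stands for the first moments. -/
theorem tendsto_ratio_factor (d : ℕ) {L : ℝ} (hL : 0 ≤ L) :
    Tendsto (fun m : ℕ => (Real.exp (ratioExp d L m) - 1) * (2 * (m : ℝ) ^ 2)) atTop (𝓝 0) := by
  have hV := ballVol_pos d
  set b : ℝ := 1 / (2 * d + 1) with hb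
  have hb0 : 0 < b := by positivity
  set A := 4 * L + 4 * L * ballVol d with hA
  have hA0 : 0 ≤ A := by positivity
  have hle : ∀ᶠ m : ℕ in atTop, ratioExp d L m ≤ A * ((m : ℝ) ^ 1 * Real.exp (-(b * m))) := by
    filter_upwards [eventually_ge_atTop 3] with m hm
    have h1 := growth_mul_radius_le d hm
    have h2 : radius d m ≤ Real.exp (-(b * m)) := by
      rw [radius_eq]
      refine Real.exp_le_exp.2 ?_
      have : 0 ≤ b * m := by positivity
      rw [← hb]; linarith
    have hm1 : (1 : ℝ) ≤ m := by exact_mod_cast (by omega : 1 ≤ m)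
    have he := Real.exp_pos (-(b * m))
    have h3 : 4 * (L * radius d m) * m ≤ 4 * (L * Real.exp (-(b * m))) * m := by gcongr
    have h4 : 4 * L * ballVol d * (radius d m ^ (d + 1) * ((2 * growth m + 1 : ℕ) : ℝ)) ≤
        4 * L * ballVol d * (m * Real.exp (-(b * m))) := by
      have : Real.exp (-(b * m)) ≤ m * Real.exp (-(b * m)) := by nlinarith
      exact mul_le_mul_of_nonneg_left (h1.trans this) (by positivity)
    rw [ratioExp, hA]
    linarith
  have hsmall : ∀ᶠ m : ℕ in atTop, ratioExp d L m ≤ 1 := by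
    have h := (tendsto_pow_mul_exp hb0 1).const_mul A
    rw [mul_zero] at h
    filter_upwards [hle, h.eventually_le_const one_pos] with m h1 h2 using h1.trans h2
  have hlim := (tendsto_pow_mul_exp hb0 3).const_mul (4 * A)
  rw [mul_zero] at hlim
  refine squeeze_zero' (Eventually.of_forall fun m => ?_) ?_ hlim
  · have := Real.one_le_exp (ratioExp_nonneg d hL m)
    have : 0 ≤ Real.exp (ratioExp d L m) - 1 := by linarith
    positivity
  · filter_upwards [hle, hsmall] with m h1 h2
    have h0 := ratioExp_nonneg d hL m
    have h3 := Real.abs_exp_sub_one_le (x := ratioExp d L m) (by rwa [abs_of_nonneg h0])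
    rw [abs_of_nonneg h0] at h3
    have h4 := (le_abs_self _).trans h3
    calc (Real.exp (ratioExp d L m) - 1) * (2 * (m : ℝ) ^ 2)
        ≤ (2 * (A * ((m : ℝ) ^ 1 * Real.exp (-(b * m))))) * (2 * (m : ℝ) ^ 2) := by
          gcongr
          linarith
      _ = _ := by ring

/-- Moment bounds for functions `ψ₀ m`, `ψ₁ m` of the `m` nearest points among `growth m` and
`2 * growth m + 1` points, respectively. -/
def Controlled {d : ℕ} (ν : Measure (E d)) (ψ₀ ψ₁ : ∀ m : ℕ, (Fin m → E d) → ℝ) : Prop :=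
  ∀ᶠ m : ℕ in atTop, (∀ z, |ψ₁ m z| ≤ |ψ₀ m z| + 2) ∧
    (Integrable (ψ₀ m) (nearMeasure ν (growth m) m) ∧
      ∫ z, |ψ₀ m z| ∂(nearMeasure ν (growth m) m) ≤ (m : ℝ) ^ 2) ∧
    (Integrable (ψ₁ m) (nearMeasure ν (2 * growth m + 1) m) ∧
      ∫ z, |ψ₁ m z| ∂(nearMeasure ν (2 * growth m + 1) m) ≤ (m : ℝ) ^ 2)

variable {d : ℕ} {ν ν₁ ν₂ : Measure (E d)} {L δ L₁ L₂ δ₁ δ₂ : ℝ}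
  {ψ₀ ψ₁ : ∀ m : ℕ, (Fin m → E d) → ℝ}

theorem eventually_radius_small (hd : 1 ≤ d) (L : ℝ) {δ : ℝ} (hδ : 0 < δ) : ∀ᶠ m in atTop,
    radius d m ≤ δ ∧ L * radius d m ≤ 1 / 2 ∧ ballVol d * radius d m ^ d ≤ 1 / 4 := by
  have h := tendsto_radius d
  have h1 : Tendsto (fun m => L * radius d m) atTop (𝓝 0) := by simpa using h.const_mul L
  have h2 : Tendsto (fun m => ballVol d * radius d m ^ d) atTop (𝓝 0) := by
    simpa [zero_pow (by omega : d ≠ 0)] using (h.pow d).const_mul (ballVol d)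
  filter_upwards [h.eventually_le_const hδ, h1.eventually_le_const (by norm_num : (0 : ℝ) < 1 / 2),
    h2.eventually_le_const (by norm_num : (0 : ℝ) < 1 / 4)] with m a b c using ⟨a, b, c⟩

theorem compl_norm_le {m : ℕ} (r : ℝ) : {z : Fin m → E d | ‖z‖ ≤ r}ᶜ = {z | r < ‖z‖} := by
  ext z; simp

/-- Nothing bounds the functional far from the origin pointwise. Its far part under the larger
sample is dominated by `ψ₀` under the smaller one, where the first moment is at most m², times the
factor of `NearLebesgue.nearMeasure_far_le`. -/
theorem Controlled.tendsto_far (hd : 1 ≤ d) (h : NearLebesgue ν L δ) (hψ : Controlled ν ψ₀ ψ₁) :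
    Tendsto (fun m => ∫ z in {z : Fin m → E d | ‖z‖ ≤ radius d m}ᶜ, |ψ₁ m z|
      ∂(nearMeasure ν (2 * growth m + 1) m)) atTop (𝓝 0) := by
  have := h.isProb
  refine squeeze_zero' (Eventually.of_forall fun m => integral_nonneg fun z => abs_nonneg _) ?_
    (tendsto_far_factor d)
  filter_upwards [hψ, eventually_radius_small hd L h.pos, eventually_two_mul_le_growth,
    eventually_ge_atTop 1] with m ⟨hle, ⟨hi₀, hb₀⟩, _⟩ ⟨hr, hLr, _⟩ hq hm
  have hprob := isProbabilityMeasure_nearMeasure ν (h.sphere_null hd) hm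
    (by omega : m ≤ growth m)
  have hfar := h.nearMeasure_far_le (radius_pos d m).le hr hLr hq
  rw [compl_norm_le]
  set κ := 4 ^ m * Real.exp (-(ballVol d * radius d m ^ d / 2)) ^ (growth m + 1)
  have hκ : 0 ≤ κ := by positivity
  have hint : Integrable (fun z => |ψ₀ m z| + 2) (nearMeasure ν (growth m) m) :=
    hi₀.abs.add (integrable_const _)
  have hint' : Integrable (fun z => |ψ₀ m z| + 2)
      ((nearMeasure ν (2 * growth m + 1) m).restrict {z | radius d m < ‖z‖}) :=
    (hint.integrableOn.smul_measure ENNReal.ofReal_ne_top).mono_measure hfar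
  calc ∫ z in {z | radius d m < ‖z‖}, |ψ₁ m z| ∂(nearMeasure ν (2 * growth m + 1) m)
      ≤ ∫ z in {z | radius d m < ‖z‖}, (|ψ₀ m z| + 2) ∂(nearMeasure ν (2 * growth m + 1) m) :=
        integral_mono_of_nonneg (Eventually.of_forall fun z => abs_nonneg _) hint'
          (Eventually.of_forall hle)
    _ ≤ κ * ∫ z in {z | radius d m < ‖z‖}, (|ψ₀ m z| + 2) ∂(nearMeasure ν (growth m) m) :=
        integral_le_of_measure_le hκ (fun z => by positivity) hint.integrableOn hfar
    _ ≤ κ * ∫ z, (|ψ₀ m z| + 2) ∂(nearMeasure ν (growth m) m) := by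
        exact mul_le_mul_of_nonneg_left
          (setIntegral_le_integral hint (Eventually.of_forall fun z => by positivity)) hκ
    _ ≤ κ * ((m : ℝ) ^ 2 + 2) := by
        gcongr
        rw [integral_add hi₀.abs (integrable_const _)]
        simpa using hb₀

/-- The law of the nearest points is asymptotically the same for all near-Lebesgue laws. -/
theorem Controlled.tendsto_sub (hd : 1 ≤ d) (h₁ : NearLebesgue ν₁ L₁ δ₁)
    (h₂ : NearLebesgue ν₂ L₂ δ₂) (hψ₁ : Controlled ν₁ ψ₀ ψ₁) (hψ₂ : Controlled ν₂ ψ₀ ψ₁) :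
    Tendsto (fun m => ∫ z, ψ₁ m z ∂(nearMeasure ν₁ (2 * growth m + 1) m) -
      ∫ z, ψ₁ m z ∂(nearMeasure ν₂ (2 * growth m + 1) m)) atTop (𝓝 0) := by
  have hδ : 0 < min δ₁ δ₂ := lt_min h₁.pos h₂.pos
  have h₁' := h₁.mono (le_max_left L₁ L₂) (min_le_left δ₁ δ₂) hδ
  have h₂' := h₂.mono (le_max_right L₁ L₂) (min_le_right δ₁ δ₂) hδ
  set L := max L₁ L₂
  set δ := min δ₁ δ₂
  have f1 := hψ₁.tendsto_far hd h₁
  have f2 := hψ₂.tendsto_far hd h₂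
  have hlim := (tendsto_ratio_factor d h₁'.nonneg).add ((f1.add f2).const_mul 2)
  simp only [add_zero, mul_zero] at hlim
  refine squeeze_zero_norm' ?_ hlim
  filter_upwards [hψ₁, hψ₂, eventually_radius_small hd L hδ] with m ⟨_, _, hi1, hb1⟩
    ⟨_, _, hi2, hb2⟩ ⟨hr, hLr, hV⟩
  have n1 : 0 ≤ ∫ z in {z : Fin m → E d | ‖z‖ ≤ radius d m}ᶜ, |ψ₁ m z|
      ∂(nearMeasure ν₁ (2 * growth m + 1) m) := integral_nonneg fun _ => abs_nonneg _
  have n2 : 0 ≤ ∫ z in {z : Fin m → E d | ‖z‖ ≤ radius d m}ᶜ, |ψ₁ m z|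
      ∂(nearMeasure ν₂ (2 * growth m + 1) m) := integral_nonneg fun _ => abs_nonneg _
  rw [Real.norm_eq_abs]
  exact abs_integral_sub_le (measurableSet_norm_le _)
    (Real.one_le_exp (ratioExp_nonneg d h₁'.nonneg m)) hi1 hi2
    (h₁'.nearMeasure_le h₂' (radius_pos d m).le hr hLr hV _ _)
    (h₂'.nearMeasure_le h₁' (radius_pos d m).le hr hLr hV _ _) hb1 hb2
    (by linarith) (by linarith)

end LLDE
end

/-! ### The local problem at the origin: dilations and reduction to the neighbours -/

noncomputable section
namespace LLDE

variable {d p m n k : ℕ} {K : E d → ℝ}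

/-- Distance from the origin to its `k`-th nearest neighbour in the configuration `z`. -/
def kDist (k : ℕ) {m : ℕ} (z : Fin m → E d) : ℝ :=
  sInf {r : ℝ | 0 ≤ r ∧ k ≤ Set.ncard {j | ‖z j‖ ≤ r}}

theorem kDist_smul {s : ℝ} (hs : 0 < s) (z : Fin m → E d) :
    kDist k (s • z) = s * kDist k z := by
  rw [kDist, kDist, ← smul_eq_mul, ← Real.sInf_smul_of_nonneg hs.le]
  congr 1
  ext r
  rw [Set.mem_smul_set_iff_inv_smul_mem₀ hs.ne']
  have : ∀ x : ℝ, s * x ≤ r ↔ x ≤ s⁻¹ * r := fun x => by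
    rw [inv_mul_eq_div, le_div_iff₀ hs, mul_comm]
  simp only [Set.mem_ofPred_eq, Pi.smul_apply, norm_smul, Real.norm_eq_abs, abs_of_pos hs, this,
    smul_eq_mul]
  rw [mul_nonneg_iff_of_pos_left (by positivity)]

/-- The parameter of the polynomial `y ↦ P (s y) + c`. -/
def scaleParam (s c : ℝ) (a : Param d p) : Param d p :=
  fun α i => s ^ (α : ℕ) * a α i + if α = 0 then c else 0

theorem tensorPoly_scaleParam (s c : ℝ) (a : Param d p) (y : E d) :
    tensorPoly (scaleParam s c a) y = tensorPoly a (s • y) + c := by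
  have h2 : ∑ α : Fin (p + 1), ∑ i : Fin (α : ℕ) → Fin d,
      (if α = 0 then c else 0) * ∏ l, y (i l) = c := by
    rw [Finset.sum_eq_single (0 : Fin (p + 1))]
    · have : IsEmpty (Fin ((0 : Fin (p + 1)) : ℕ)) := inferInstanceAs (IsEmpty (Fin 0))
      simp only [Finset.univ_eq_empty, Finset.prod_empty, mul_one, if_true, Finset.univ_unique,
        Finset.sum_singleton]
    · intro α _ hα
      simp [hα]
    · simp
  simp only [tensorPoly, scaleParam, add_mul, Finset.sum_add_distrib, h2]
  congr 1
  refine Finset.sum_congr rfl fun α _ => Finset.sum_congr rfl fun i _ => ?_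
  simp [Finset.prod_mul_distrib]
  ring

theorem constCoeff_scaleParam (s c : ℝ) (a : Param d p) :
    constCoeff (scaleParam s c a) = constCoeff a + c := by
  simp [constCoeff, scaleParam]

theorem scaleParam_scaleParam_inv {s : ℝ} (hs : s ≠ 0) (c : ℝ) (a : Param d p) :
    scaleParam s c (scaleParam s⁻¹ (-c) a) = a := by
  funext α i
  simp only [scaleParam]
  by_cases h : α = 0
  · subst h; simp
  · simp only [h, if_false, add_zero]
    rw [← mul_assoc, ← mul_pow, mul_inv_cancel₀ hs, one_pow, one_mul]

theorem tensorPoly_zero (a : Param d p) : tensorPoly a 0 = constCoeff a := by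
  rw [tensorPoly, Finset.sum_eq_single (0 : Fin (p + 1))]
  · have : IsEmpty (Fin ((0 : Fin (p + 1)) : ℕ)) := inferInstanceAs (IsEmpty (Fin 0))
    simp only [Finset.univ_eq_empty, Finset.prod_empty, mul_one, constCoeff, Finset.univ_unique,
      Finset.sum_singleton]
    congr 1
  · intro α _ hα
    have : 0 < (α : ℕ) := Fin.pos_iff_ne_zero.2 hα
    refine Finset.sum_eq_zero fun i _ => ?_
    rw [Finset.prod_eq_zero (Finset.mem_univ ⟨0, this⟩) (by simp), mul_zero]
  · simp

/-- The integrand of the local log-likelihood at the origin with bandwidth `h`. -/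
def kernelExp (K : E d → ℝ) (h : ℝ) (a : Param d p) (u : E d) : ℝ :=
  K (h⁻¹ • u) * Real.exp (tensorPoly a u)

/-- Local log-likelihood at the origin for the neighbours `z` in a sample of size `N`. -/
def locObj (K : E d → ℝ) (N h : ℝ) (z : Fin m → E d) (a : Param d p) : ℝ :=
  ∑ j, K (h⁻¹ • z j) * tensorPoly a (z j) - N * ∫ u, kernelExp K h a u

/-- `a` maximizes the local log-likelihood at the origin. -/
def LocMax (k : ℕ) (K : E d → ℝ) (N : ℝ) (z : Fin m → E d) (a : Param d p) : Prop :=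
  Integrable (kernelExp K (kDist k z) a) ∧ ∀ b : Param d p, Integrable (kernelExp K (kDist k z) b) →
    locObj K N (kDist k z) z b ≤ locObj K N (kDist k z) z a

/-- The local maximization has a solution, with a unique constant coefficient. -/
def LocSolvable (k p : ℕ) (K : E d → ℝ) (N : ℝ) (z : Fin m → E d) : Prop :=
  ∃ a : Param d p, LocMax k K N z a ∧ ∀ b : Param d p, LocMax k K N z b →
    constCoeff b = constCoeff a

open Classical in
/-- Minus the logarithm of the local density estimate, as a function of the neighbours. The
default value has the same behaviour under dilations. -/
def locTerm (k p : ℕ) (K : E d → ℝ) (N : ℝ) (z : Fin m → E d) : ℝ :=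
  if h : LocSolvable k p K N z then -constCoeff h.choose else Real.log N + d * Real.log ‖z‖

theorem locTerm_eq {N : ℝ} {z : Fin m → E d} (h : LocSolvable k p K N z) {a : Param d p}
    (ha : LocMax k K N z a) : locTerm k p K N z = -constCoeff a := by
  rw [locTerm, dif_pos h, h.choose_spec.2 a ha]

section Scaling

variable {N s : ℝ}

theorem kernelExp_smul (hs : 0 < s) (ρ c : ℝ) (a : Param d p) (v : E d) :
    kernelExp K (s * ρ) a (s • v) = Real.exp (-c) * kernelExp K ρ (scaleParam s c a) v := by
  rw [kernelExp, kernelExp, tensorPoly_scaleParam, smul_smul, mul_inv, mul_comm s⁻¹, mul_assoc,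
    inv_mul_cancel₀ hs.ne', mul_one, Real.exp_add, Real.exp_neg]
  field_simp

theorem integrable_kernelExp_smul (hs : 0 < s) (ρ c : ℝ) (a : Param d p) :
    Integrable (kernelExp K (s * ρ) a) ↔ Integrable (kernelExp K ρ (scaleParam s c a)) := by
  rw [← integrable_comp_smul_iff volume (kernelExp K (s * ρ) a) hs.ne']
  simp only [kernelExp_smul hs ρ c]
  exact integrable_const_mul_iff (IsUnit.mk0 _ (Real.exp_pos _).ne') _

theorem integral_kernelExp_smul (hs : 0 < s) (ρ c : ℝ) (a : Param d p) :
    ∫ u, kernelExp K (s * ρ) a u =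
      s ^ d * Real.exp (-c) * ∫ u, kernelExp K ρ (scaleParam s c a) u := by
  have h := Measure.integral_comp_smul volume (kernelExp K (s * ρ) a) s
  simp only [kernelExp_smul hs ρ c, finrank_euclideanSpace, Fintype.card_fin, smul_eq_mul] at h
  rw [integral_const_mul, abs_of_pos (by positivity)] at h
  rw [mul_assoc, h, mul_inv_cancel_left₀ (by positivity)]

theorem locObj_smul (hs : 0 < s) (hN : 0 < N) (ρ : ℝ) (z : Fin m → E d) (a : Param d p) :
    locObj K N (s * ρ) (s • z) a =
      locObj K 1 ρ z (scaleParam s (Real.log (N * s ^ d)) a) -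
        Real.log (N * s ^ d) * ∑ j, K (ρ⁻¹ • z j) := by
  have hc : Real.exp (-Real.log (N * s ^ d)) = (N * s ^ d)⁻¹ := by
    rw [Real.exp_neg, Real.exp_log (by positivity)]
  rw [locObj, locObj, integral_kernelExp_smul hs ρ (Real.log (N * s ^ d)), hc]
  simp only [tensorPoly_scaleParam, Pi.smul_apply, smul_smul, mul_inv, mul_add,
    Finset.sum_add_distrib, ← Finset.sum_mul]
  have e1 : s⁻¹ * ρ⁻¹ * s = ρ⁻¹ := by field_simp
  rw [e1]
  field_simp
  ring

/-- Substitute u = s v in the integral. Adding log(N s^d) to the polynomial absorbs both the sample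
size and the Jacobian, and what is left over does not depend on `a`, so maximizers correspond under
`scaleParam`. -/
theorem locMax_smul_iff (hs : 0 < s) (hN : 0 < N) (z : Fin m → E d) (a : Param d p) :
    LocMax k K N (s • z) a ↔ LocMax k K 1 z (scaleParam s (Real.log (N * s ^ d)) a) := by
  set c := Real.log (N * s ^ d)
  simp only [LocMax, kDist_smul hs, locObj_smul hs hN, integrable_kernelExp_smul hs _ c,
    sub_le_sub_iff_right]
  refine and_congr_right fun _ => ⟨fun h b hb => ?_, fun h b hb => h _ hb⟩
  have := h (scaleParam s⁻¹ (-c) b)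
  rw [scaleParam_scaleParam_inv hs.ne'] at this
  exact this hb

theorem locSolvable_smul_iff (hs : 0 < s) (hN : 0 < N) (z : Fin m → E d) :
    LocSolvable k p K N (s • z) ↔ LocSolvable k p K 1 z := by
  simp only [LocSolvable, locMax_smul_iff hs hN]
  constructor
  · rintro ⟨a, ha, hu⟩
    refine ⟨_, ha, fun b hb => ?_⟩
    have := hu (scaleParam s⁻¹ (-Real.log (N * s ^ d)) b)
    rw [scaleParam_scaleParam_inv hs.ne', constCoeff_scaleParam] at this
    rw [constCoeff_scaleParam, ← this hb]
    ring
  · rintro ⟨a, ha, hu⟩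
    refine ⟨scaleParam s⁻¹ (-Real.log (N * s ^ d)) a, ?_, fun b hb => ?_⟩
    · rwa [scaleParam_scaleParam_inv hs.ne']
    · have := hu _ hb
      rw [constCoeff_scaleParam] at this ⊢
      linarith

/-- For s = f(x)^(-1/d) the last term is -log f(x): this is how the entropy appears. `hz` serves the
default branch, where the logarithm of ‖s • z‖ must split. -/
theorem locTerm_smul (hs : 0 < s) (hN : 0 < N) {z : Fin m → E d} (hz : 0 < ‖z‖) :
    locTerm k p K N (s • z) = locTerm k p K 1 z + Real.log N + d * Real.log s := by
  by_cases h : LocSolvable k p K 1 z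
  · have h' := (locSolvable_smul_iff hs hN z).2 h
    obtain ⟨a, ha, _⟩ := id h'
    rw [locTerm_eq h' ha, locTerm_eq h ((locMax_smul_iff hs hN z a).1 ha), constCoeff_scaleParam,
      Real.log_mul hN.ne' (by positivity), Real.log_pow]
    ring
  · have h' := (locSolvable_smul_iff (k := k) (p := p) (K := K) hs hN z).not.2 h
    rw [locTerm, locTerm, dif_neg h, dif_neg h', norm_smul, Real.norm_eq_abs, abs_of_pos hs,
      Real.log_mul hs.ne' hz.ne', Real.log_one]
    ring

end Scaling

section Reduction

theorem nnDist_zero (X : Fin (n + 1) → E d) :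
    nnDist k X 0 = kDist k fun j : Fin n => X j.succ - X 0 := by
  have hset : ∀ r : ℝ, {j : Fin (n + 1) | j ≠ 0 ∧ dist (X j) (X 0) ≤ r} =
      Fin.succ '' {j : Fin n | ‖X j.succ - X 0‖ ≤ r} := by
    intro r
    ext j
    simp only [Set.mem_ofPred_eq, Set.mem_image, dist_eq_norm]
    constructor
    · rintro ⟨h0, hr⟩
      obtain ⟨i, rfl⟩ := Fin.exists_succ_eq.2 h0
      exact ⟨i, hr, rfl⟩
    · rintro ⟨i, hi, rfl⟩
      exact ⟨Fin.succ_ne_zero i, hi⟩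
  simp only [nnDist, kDist, hset, Set.ncard_image_of_injective _ (Fin.succ_injective n)]

theorem ncard_norm_le_of_norm_le {z : Fin m → E d} {r : ℝ} (hr : ‖z‖ ≤ r) :
    Set.ncard {j | ‖z j‖ ≤ r} = m := by
  have : {j | ‖z j‖ ≤ r} = Set.univ :=
    Set.eq_univ_of_forall fun j => (norm_le_pi_norm z j).trans hr
  rw [this, Set.ncard_univ, Nat.card_eq_fintype_card, Fintype.card_fin]

/-- A point outside the range of `e` enters a ball about the origin only after all m ≥ k selected
points have entered it. -/
theorem IsNearest.kDist_eq {e : Fin m → Fin n} (he : Function.Injective e) {Y : Fin n → E d}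
    (h : IsNearest e Y) (hk : k ≤ m) : kDist k Y = kDist k fun i => Y (e i) := by
  unfold kDist
  congr 1
  ext r
  simp only [Set.mem_ofPred_eq]
  refine and_congr_right fun _ => ?_
  have hsub : e '' {i | ‖Y (e i)‖ ≤ r} ⊆ {j | ‖Y j‖ ≤ r} := by
    rintro _ ⟨i, hi, rfl⟩; exact hi
  rcases le_or_gt ‖fun i => Y (e i)‖ r with hr | hr
  · have h1 := ncard_norm_le_of_norm_le hr
    have h2 := Set.ncard_le_ncard hsub (Set.toFinite _)
    rw [Set.ncard_image_of_injective _ he, h1] at h2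
    exact ⟨fun _ => by rw [h1]; exact hk, fun _ => hk.trans h2⟩
  · have : {j | ‖Y j‖ ≤ r} = e '' {i | ‖Y (e i)‖ ≤ r} := by
      refine Set.Subset.antisymm (fun j hj => ?_) hsub
      by_contra hc
      have hj' : j ∉ Set.range e := by
        rintro ⟨i, rfl⟩
        exact hc ⟨i, hj, rfl⟩
      have := h j hj'
      have hj2 : ‖Y j‖ ≤ r := hj
      linarith
    rw [this, Set.ncard_image_of_injective _ he]

theorem kDist_card (z : Fin m → E d) : kDist m z = ‖z‖ := by
  have : {r : ℝ | 0 ≤ r ∧ m ≤ Set.ncard {j | ‖z j‖ ≤ r}} = Set.Ici ‖z‖ := by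
    ext r
    simp only [Set.mem_ofPred_eq, Set.mem_Ici]
    constructor
    · rintro ⟨h0, hr⟩
      refine (pi_norm_le_iff_of_nonneg h0).2 fun j => ?_
      have h1 := Set.eq_of_subset_of_ncard_le (Set.subset_univ {j | ‖z j‖ ≤ r}) (by
        rw [Set.ncard_univ, Nat.card_eq_fintype_card, Fintype.card_fin]; exact hr)
      have : j ∈ {j | ‖z j‖ ≤ r} := by rw [h1]; trivial
      exact this
    · intro hr
      exact ⟨(norm_nonneg z).trans hr, (ncard_norm_le_of_norm_le hr).ge⟩
  rw [kDist, this, csInf_Ici]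

variable {X : Fin (n + 1) → E d} {e : Fin m → Fin n}

/-- The cut-off distance is the norm of the selected configuration (`kDist_card`), and the strict
inequality in `IsNearest` excludes further points at that distance. -/
theorem nbrs_zero (hlog : ⌈Real.log ((n + 1 : ℕ) : ℝ)⌉₊ = m)
    (he : Function.Injective e) (h : IsNearest e fun j => X j.succ - X 0) :
    nbrs X 0 = Finset.univ.map ⟨fun i => (e i).succ, (Fin.succ_injective n).comp he⟩ := by
  ext j
  rw [nbrs, hlog, nnDist_zero, h.kDist_eq he le_rfl, kDist_card]
  simp only [Finset.mem_filter, Finset.mem_univ, true_and, Finset.mem_map,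
    Function.Embedding.coeFn_mk, dist_eq_norm]
  constructor
  · rintro ⟨h0, hle⟩
    obtain ⟨i, rfl⟩ := Fin.exists_succ_eq.2 h0
    by_contra hc
    have hi : i ∉ Set.range e := by
      rintro ⟨l, rfl⟩
      exact hc ⟨l, rfl⟩
    exact absurd (h i hi) (not_lt.2 hle)
  · rintro ⟨i, rfl⟩
    exact ⟨Fin.succ_ne_zero _, norm_le_pi_norm (fun i => X (e i).succ - X 0) i⟩

theorem isMaximizer_zero_iff (hk : k ≤ m)
    (hlog : ⌈Real.log ((n + 1 : ℕ) : ℝ)⌉₊ = m) (he : Function.Injective e)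
    (h : IsNearest e fun j => X j.succ - X 0) (a : Param d p) :
    IsMaximizer k K X 0 a ↔ LocMax k K ((n : ℝ) + 1) (fun i => X (e i).succ - X 0) a := by
  have hρ : nnDist k X 0 = kDist k fun i => X (e i).succ - X 0 := by
    rw [nnDist_zero, h.kDist_eq he hk]
  have hadm : ∀ b : Param d p, Admissible K (nnDist k X 0) X 0 b ↔
      Integrable (kernelExp K (kDist k fun i => X (e i).succ - X 0) b) := by
    intro b
    rw [hρ]
    have e1 : (fun u : E d => K ((kDist k fun i => X (e i).succ - X 0)⁻¹ • (u - X 0)) *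
        expPoly b (X 0) u) = fun u =>
          kernelExp K (kDist k fun i => X (e i).succ - X 0) b (u - X 0) := rfl
    rw [Admissible, e1]
    refine ⟨fun hi => ?_, fun hi => hi.comp_sub_right _⟩
    simpa using hi.comp_add_right (X 0)
  have hobj : ∀ b : Param d p, localLogLik K (nnDist k X 0) X 0 b =
      locObj K ((n : ℝ) + 1) (kDist k fun i => X (e i).succ - X 0)
        (fun i => X (e i).succ - X 0) b := by
    intro b
    have e1 : ∫ u : E d, K ((kDist k fun i => X (e i).succ - X 0)⁻¹ • (u - X 0)) *
        expPoly b (X 0) u = ∫ u, kernelExp K (kDist k fun i => X (e i).succ - X 0) b u :=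
      integral_sub_right_eq_self (kernelExp K (kDist k fun i => X (e i).succ - X 0) b) (X 0)
    rw [localLogLik, nbrs_zero hlog he h, hρ, e1, locObj, Finset.sum_map]
    simp [expPoly, Real.log_exp]
  simp only [IsMaximizer, LocMax, hadm, hobj]

theorem solvable_zero_iff (hk : k ≤ m)
    (hlog : ⌈Real.log ((n + 1 : ℕ) : ℝ)⌉₊ = m) (he : Function.Injective e)
    (h : IsNearest e fun j => X j.succ - X 0) :
    Solvable k p K X 0 ↔
      LocSolvable k p K ((n : ℝ) + 1) (fun i => X (e i).succ - X 0) := by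
  simp only [Solvable, LocSolvable, isMaximizer_zero_iff hk hlog he h]

/-- Uniqueness of the constant coefficient makes the estimate independent of the maximizer picked by
choice. -/
theorem log_densityEstimate {n : ℕ} {X : Fin n → E d} {i : Fin n} (h : Solvable k p K X i)
    {a : Param d p} (ha : IsMaximizer k K X i a) :
    densityEstimate k p K X i = Real.exp (constCoeff a) := by
  obtain ⟨b, hb, hu⟩ := h
  have hex : ∃ a : Param d p, IsMaximizer k K X i a := ⟨b, hb⟩
  rw [densityEstimate, dif_pos hex, expPoly, sub_self, tensorPoly_zero, hu _ hex.choose_spec,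
    hu _ ha]

theorem firstTerm_eq_locTerm (hk : k ≤ m)
    (hlog : ⌈Real.log ((n + 1 : ℕ) : ℝ)⌉₊ = m) (he : Function.Injective e)
    (h : IsNearest e fun j => X j.succ - X 0) (hs : Solvable k p K X 0) :
    firstTerm k p K X = locTerm k p K ((n : ℝ) + 1) fun i => X (e i).succ - X 0 := by
  obtain ⟨a, ha, _⟩ := id hs
  rw [firstTerm, log_densityEstimate hs ha, Real.log_exp,
    locTerm_eq ((solvable_zero_iff hk hlog he h).1 hs)
      ((isMaximizer_zero_iff hk hlog he h a).1 ha)]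

end Reduction

end LLDE
end

/-! ### Normalized coordinates at a sample point -/

noncomputable section
namespace LLDE

variable {d p m n k : ℕ} {K : E d → ℝ} {f : E d → ℝ}

theorem IsC2Density.integrable (hf : IsC2Density f) : Integrable f := by
  by_contra h
  have := hf.integral_eq_one
  rw [integral_undef h] at this
  exact zero_ne_one this

theorem IsC2Density.isProbabilityMeasure (hf : IsC2Density f) : IsProbabilityMeasure (law f) := by
  constructor
  rw [law, withDensity_apply _ MeasurableSet.univ, Measure.restrict_univ,
    ← ofReal_integral_eq_lintegral_ofReal hf.integrable (Eventually.of_forall hf.nonneg),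
    hf.integral_eq_one, ENNReal.ofReal_one]

theorem law_ac (f : E d → ℝ) : law f ≪ volume := withDensity_absolutelyContinuous _ _

theorem IsC2Density.measurable (hf : IsC2Density f) : Measurable f :=
  hf.contDiff.continuous.measurable

theorem IsC2Density.ae_pos (hf : IsC2Density f) : ∀ᵐ x ∂(law f), 0 < f x := by
  rw [law, ae_withDensity_iff hf.measurable.ennreal_ofReal]
  refine Eventually.of_forall fun x hx => ?_
  by_contra h
  exact hx (ENNReal.ofReal_of_nonpos (not_lt.1 h))

/-- Dilation factor that normalizes the density at `x` to `1`. -/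
def dilation (f : E d → ℝ) (x : E d) : ℝ := f x ^ ((d : ℝ)⁻¹)

theorem dilation_pos {x : E d} (hx : 0 < f x) : 0 < dilation f x := Real.rpow_pos_of_pos hx _

theorem dilation_pow (hd : 1 ≤ d) {x : E d} (hx : 0 < f x) : dilation f x ^ d = f x := by
  rw [dilation, Real.rpow_inv_natCast_pow hx.le (by omega)]

theorem log_dilation (hd : 1 ≤ d) {x : E d} (hx : 0 < f x) :
    d * Real.log (dilation f x) = Real.log (f x) := by
  rw [← Real.log_pow, dilation_pow hd hx]

/-- The law with density `f`, in coordinates centred at `x` in which its density at `x` is `1`. -/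
def normLaw (f : E d → ℝ) (x : E d) : Measure (E d) :=
  (law f).map fun y => dilation f x • (y - x)

theorem measurable_normalize (f : E d → ℝ) (x : E d) :
    Measurable fun y => dilation f x • (y - x) := by fun_prop

theorem volume_preimage_normalize (hd : 1 ≤ d) {x : E d} (hx : 0 < f x) (s : Set (E d)) :
    volume ((fun y => dilation f x • (y - x)) ⁻¹' s) = ENNReal.ofReal (f x)⁻¹ * volume s := by
  have h1 : (fun y => dilation f x • (y - x)) ⁻¹' s =
      (fun y => y + -x) ⁻¹' ((fun y => dilation f x • y) ⁻¹' s) := by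
    simp only [← sub_eq_add_neg]; rfl
  rw [h1, measure_preimage_add_right, Measure.addHaar_preimage_smul _ (dilation_pos hx).ne',
    finrank_euclideanSpace, Fintype.card_fin, dilation_pow hd hx, abs_of_pos (by positivity)]

/-- Differentiability at x gives |f y - f x| ≤ M ‖y - x‖ for ‖y - x‖ < ε. With l = `dilation f x`,
normalized radius t is original radius t / l, so the relative error is at most M t / (l f(x)). The
radius l ε / 2 keeps t / l strictly below ε. -/
theorem exists_nearLebesgue_normLaw (hd : 1 ≤ d) (hf : IsC2Density f) {x : E d} (hx : 0 < f x) :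
    ∃ L δ, NearLebesgue (normLaw f x) L δ := by
  have := hf.isProbabilityMeasure
  have hdiff : DifferentiableAt ℝ f x := (hf.contDiff.differentiable (by norm_num)) x
  obtain ⟨M, hM, hbig⟩ := hdiff.isBigO_sub.exists_pos
  obtain ⟨ε, hε, hb⟩ := Metric.eventually_nhds_iff.1 hbig.bound
  have hl := dilation_pos hx
  have hmeas := measurable_normalize f x
  set l := dilation f x with hl_def
  refine ⟨M / (l * f x), l * ε / 2, ⟨Measure.isProbabilityMeasure_map hmeas.aemeasurable, ?_,
    by positivity, by positivity, ?_, ?_⟩⟩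
  · refine Measure.AbsolutelyContinuous.mk fun s hs h0 => ?_
    rw [normLaw, Measure.map_apply hmeas hs]
    refine law_ac f ?_
    rw [volume_preimage_normalize hd hx, h0, mul_zero]
  all_goals
    intro t ht0 ht
    refine Measure.le_iff.2 fun s hs => ?_
    have hsB : MeasurableSet (s ∩ Metric.closedBall 0 t) :=
      hs.inter Metric.isClosed_closedBall.measurableSet
    have hpre : MeasurableSet ((fun y => l • (y - x)) ⁻¹' (s ∩ Metric.closedBall 0 t)) :=
      hmeas hsB
    have hdev : ∀ y ∈ (fun y => l • (y - x)) ⁻¹' (s ∩ Metric.closedBall 0 t),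
        |f y - f x| ≤ f x * (M / (l * f x) * t) := by
      rintro y ⟨_, hy⟩
      rw [mem_closedBall_zero_iff, norm_smul, Real.norm_eq_abs, abs_of_pos hl] at hy
      have hy' : ‖y - x‖ ≤ t / l := by rwa [le_div_iff₀ hl, mul_comm]
      have hlt : t / l < ε := by rw [div_lt_iff₀ hl]; nlinarith
      have h1 := hb (show dist y x < ε by rw [dist_eq_norm]; linarith)
      rw [Real.norm_eq_abs] at h1
      calc |f y - f x| ≤ M * ‖y - x‖ := h1
        _ ≤ M * (t / l) := by gcongr
        _ = _ := by field_simp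
    simp only [Measure.smul_apply, smul_eq_mul, Measure.restrict_apply hs]
    rw [normLaw, Measure.map_apply hmeas hsB, law, withDensity_apply _ hpre]
    have hvol := volume_preimage_normalize hd hx (s ∩ Metric.closedBall 0 t)
    rw [← hl_def] at hvol
  · calc ∫⁻ y in (fun y => l • (y - x)) ⁻¹' (s ∩ Metric.closedBall 0 t), ENNReal.ofReal (f y)
        ≤ ∫⁻ y in (fun y => l • (y - x)) ⁻¹' (s ∩ Metric.closedBall 0 t),
            ENNReal.ofReal (f x * (1 + M / (l * f x) * t)) := by
          refine setLIntegral_mono' hpre fun y hy => ENNReal.ofReal_le_ofReal ?_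
          have := (abs_le.1 (hdev y hy)).2
          linarith
      _ = _ := by
          rw [setLIntegral_const, hvol, ENNReal.ofReal_mul hx.le, mul_comm (ENNReal.ofReal (f x)),
            mul_assoc, ← mul_assoc (ENNReal.ofReal (f x)), ← ENNReal.ofReal_mul hx.le,
            mul_inv_cancel₀ hx.ne', ENNReal.ofReal_one, one_mul]
  · calc _ = ∫⁻ y in (fun y => l • (y - x)) ⁻¹' (s ∩ Metric.closedBall 0 t),
            ENNReal.ofReal (f x * (1 - M / (l * f x) * t)) := by
          rw [setLIntegral_const, hvol, ENNReal.ofReal_mul hx.le, mul_comm (ENNReal.ofReal (f x)),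
            mul_assoc, ← mul_assoc (ENNReal.ofReal (f x)), ← ENNReal.ofReal_mul hx.le,
            mul_inv_cancel₀ hx.ne', ENNReal.ofReal_one, one_mul]
      _ ≤ _ := by
          refine setLIntegral_mono' hpre fun y hy => ENNReal.ofReal_le_ofReal ?_
          have := (abs_le.1 (hdev y hy)).1
          linarith

/-- Sample points in terms of their normalized coordinates. -/
def unnormalize (f : E d → ℝ) (x : E d) (Z : Fin n → E d) : Fin n → E d :=
  fun j => x + (dilation f x)⁻¹ • Z j

theorem measurePreserving_unnormalize (hf : IsC2Density f) {x : E d} (hx : 0 < f x) :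
    MeasurePreserving (unnormalize (n := n) f x) (Measure.pi fun _ => normLaw f x)
      (sampleLaw f n) := by
  have := hf.isProbabilityMeasure
  have hmeas := measurable_normalize f x
  have hmeas' : Measurable fun z : E d => x + (dilation f x)⁻¹ • z := by fun_prop
  have := Measure.isProbabilityMeasure_map (μ := law f) hmeas.aemeasurable
  have : IsProbabilityMeasure (normLaw f x) := this
  refine measurePreserving_pi _ _ fun _ => ⟨hmeas', ?_⟩
  rw [normLaw, Measure.map_map hmeas' hmeas]
  have : (fun z : E d => x + (dilation f x)⁻¹ • z) ∘ (fun y => dilation f x • (y - x)) = id := by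
    funext y
    simp [smul_smul, inv_mul_cancel₀ (dilation_pos hx).ne']
  rw [this, Measure.map_id]

theorem IsNearest.smul {e : Fin m → Fin n} {Y : Fin n → E d} (h : IsNearest e Y) {s : ℝ}
    (hs : 0 < s) : IsNearest e fun j => s • Y j := by
  intro j hj
  have e1 : (fun i => s • Y (e i)) = s • fun i => Y (e i) := rfl
  simp only [e1, norm_smul, Real.norm_eq_abs, abs_of_pos hs]
  exact mul_lt_mul_of_pos_left (h j hj) hs

theorem ae_ne_zero (ν : Measure (E d)) [IsProbabilityMeasure ν]
    (hν : ∀ t, ν (Metric.sphere 0 t) = 0) (n : ℕ) :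
    ∀ᵐ Y ∂(Measure.pi fun _ : Fin n => ν), ∀ j, Y j ≠ 0 := by
  refine ae_all_iff.2 fun j => ?_
  have h : ∀ᵐ y ∂ν, y ≠ 0 := by
    rw [ae_iff]
    convert hν 0 using 2
    ext z; simp
  exact (measurePreserving_eval (fun _ : Fin n => ν) j).quasiMeasurePreserving.ae h

/-- A functional of the other sample points that is given by the nearest ones, in normalized
coordinates, is integrated with `nearMeasure`. -/
theorem integral_near_normLaw (hd : 1 ≤ d) (hf : IsC2Density f) {x : E d} (hx : 0 < f x)
    (hm : 1 ≤ m) (hmn : m ≤ n) {H : (Fin n → E d) → ℝ} {h : (Fin m → E d) → ℝ}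
    (hH : Integrable H (sampleLaw f n))
    (hHh : ∀ᵐ Y ∂(sampleLaw f n), ∀ Z : Fin n → E d, Y = unnormalize f x Z →
      (∀ j, Z j ≠ 0) → ∀ e : Fin m → Fin n, Function.Injective e → IsNearest e Z →
      H Y = h fun i => Z (e i)) :
    Integrable h (nearMeasure (normLaw f x) n m) ∧
      ∫ z, h z ∂(nearMeasure (normLaw f x) n m) = ∫ Y, H Y ∂(sampleLaw f n) := by
  obtain ⟨L, δ, hnl⟩ := exists_nearLebesgue_normLaw hd hf hx
  have := hnl.isProb
  have hmp := measurePreserving_unnormalize (n := n) hf hx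
  have key := integral_nearMeasure (normLaw f x) (hnl.sphere_null hd) hm hmn
    (G := H ∘ unnormalize f x) (h := h) (hmp.integrable_comp_of_integrable hH) (by
      filter_upwards [hmp.quasiMeasurePreserving.ae hHh,
        ae_ne_zero (normLaw f x) (hnl.sphere_null hd) n] with Z hZ h0 e he hn
      exact hZ Z rfl h0 e he hn)
  refine ⟨key.1, key.2.trans ?_⟩
  rw [← hmp.map_eq, integral_map hmp.measurable.aemeasurable
    (by rw [hmp.map_eq]; exact hH.aestronglyMeasurable)]
  rfl

/-- `firstTerm` with the first sample point fixed. -/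
def firstTermAt (k p : ℕ) (K : E d → ℝ) (x : E d) (Y : Fin n → E d) : ℝ :=
  firstTerm k p K (Fin.cons (α := fun _ => E d) x Y)

/-- The dilation by the inverse of `dilation f x` contributes -log f(x); after recentring, the
right-hand side knows neither `f` nor `x`. -/
theorem firstTermAt_unnormalize (hd : 1 ≤ d) {x : E d} (hx : 0 < f x) (hm : 1 ≤ m) (hk : k ≤ m)
    (hlog : ⌈Real.log ((n + 1 : ℕ) : ℝ)⌉₊ = m) {Z : Fin n → E d} (h0 : ∀ j, Z j ≠ 0)
    {e : Fin m → Fin n} (he : Function.Injective e) (hn : IsNearest e Z)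
    (hs : Solvable k p K (Fin.cons (α := fun _ => E d) x (unnormalize f x Z)) 0) :
    firstTermAt k p K x (unnormalize f x Z) + Real.log (f x) =
      locTerm k p K 1 (fun i => Z (e i)) + Real.log ((n : ℝ) + 1) := by
  have hl := dilation_pos hx
  set X : Fin (n + 1) → E d := Fin.cons (α := fun _ => E d) x (unnormalize f x Z) with hX
  have hsub : ∀ j : Fin n, X j.succ - X 0 = (dilation f x)⁻¹ • Z j := by
    intro j
    simp [hX, unnormalize]
  have hn' : IsNearest e fun j => X j.succ - X 0 := by
    simp only [hsub]
    exact hn.smul (inv_pos.2 hl)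
  rw [firstTermAt, firstTerm_eq_locTerm hk hlog he hn' hs]
  have e1 : (fun i => X (e i).succ - X 0) = (dilation f x)⁻¹ • fun i => Z (e i) := by
    funext i; exact hsub (e i)
  have hz : 0 < ‖fun i => Z (e i)‖ :=
    (norm_pos_iff.2 (h0 (e ⟨0, hm⟩))).trans_le (norm_le_pi_norm (fun i => Z (e i)) ⟨0, hm⟩)
  rw [e1, locTerm_smul (inv_pos.2 hl) (by positivity) hz, Real.log_inv, ← log_dilation hd hx]
  ring

theorem integral_firstTermAt (hd : 1 ≤ d) (hf : IsC2Density f) {x : E d} (hx : 0 < f x)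
    (hm : 1 ≤ m) (hmn : m ≤ n) (hk : k ≤ m) (hlog : ⌈Real.log ((n + 1 : ℕ) : ℝ)⌉₊ = m)
    (hint : Integrable (firstTermAt k p K x) (sampleLaw f n))
    (hs : ∀ᵐ Y ∂(sampleLaw f n), Solvable k p K (Fin.cons (α := fun _ => E d) x Y) 0) :
    let h := fun z : Fin m → E d => locTerm k p K 1 z + Real.log ((n : ℝ) + 1)
    Integrable h (nearMeasure (normLaw f x) n m) ∧
      ∫ z, h z ∂(nearMeasure (normLaw f x) n m) = condFirstTerm k p K f n x + Real.log (f x) ∧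
      ∫ z, |h z| ∂(nearMeasure (normLaw f x) n m) ≤
        ∫ Y, |firstTermAt k p K x Y| ∂(sampleLaw f n) + |Real.log (f x)| := by
  intro h
  have := hf.isProbabilityMeasure
  have : IsProbabilityMeasure (sampleLaw f n) := by unfold sampleLaw; infer_instance
  have hint' : Integrable (fun Y => firstTermAt k p K x Y + Real.log (f x)) (sampleLaw f n) :=
    hint.add (integrable_const _)
  have hae : ∀ᵐ Y ∂(sampleLaw f n), ∀ Z : Fin n → E d, Y = unnormalize f x Z →
      (∀ j, Z j ≠ 0) → ∀ e : Fin m → Fin n, Function.Injective e → IsNearest e Z →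
      firstTermAt k p K x Y + Real.log (f x) = h fun i => Z (e i) := by
    filter_upwards [hs] with Y hY Z hZ h0 e he hn
    subst hZ
    exact firstTermAt_unnormalize hd hx hm hk hlog h0 he hn hY
  obtain ⟨h1, h2⟩ := integral_near_normLaw hd hf hx hm hmn hint' hae
  obtain ⟨_, h3⟩ := integral_near_normLaw hd hf hx hm hmn (h := fun z => |h z|) hint'.abs
    (hae.mono fun Y hY Z hZ h0 e he hn => by rw [hY Z hZ h0 e he hn])
  refine ⟨h1, ?_, ?_⟩
  · rw [h2, integral_add hint (integrable_const _)]
    simp [condFirstTerm, firstTermAt]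
  · rw [h3]
    calc ∫ Y, |firstTermAt k p K x Y + Real.log (f x)| ∂(sampleLaw f n)
        ≤ ∫ Y, (|firstTermAt k p K x Y| + |Real.log (f x)|) ∂(sampleLaw f n) :=
          integral_mono hint'.abs (hint.abs.add (integrable_const _)) fun Y => abs_add_le _ _
      _ = _ := by
          rw [integral_add hint.abs (integrable_const _)]
          simp

end LLDE
end

/-! ### Good points and universality of the bias -/

noncomputable section
namespace LLDE

section Moments

variable {α : Type*} [MeasurableSpace α] {μ : Measure α}

/-- Bounded expectations make the sum of u_m / m² integrable, hence finite almost everywhere, so its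
terms tend to 0. Taking one sample size per m gives a bound polynomial in m although the sample
grows exponentially in m. -/
theorem ae_eventually_le_sq {u : ℕ → α → ENNReal} {C : ENNReal} (hC : C ≠ ⊤)
    (hu : ∀ᶠ m in atTop, AEMeasurable (u m) μ ∧ ∫⁻ x, u m x ∂μ ≤ C) :
    ∀ᵐ x ∂μ, ∀ᶠ m : ℕ in atTop, u m x ≤ ENNReal.ofReal ((m : ℝ) ^ 2 / 2) := by
  obtain ⟨M, hM⟩ := eventually_atTop.1 hu
  set w : ℕ → ENNReal := fun m => ENNReal.ofReal (1 / ((m + M : ℕ) : ℝ) ^ 2) with hw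
  have hsum : ∑' m, w m ≠ ⊤ := by
    have h : Summable fun m : ℕ => 1 / ((m + M : ℕ) : ℝ) ^ 2 :=
      (summable_nat_add_iff M).2 (Real.summable_one_div_nat_pow.2 one_lt_two)
    exact h.tsum_ofReal_ne_top
  have hint : ∫⁻ x, ∑' m, w m * u (m + M) x ∂μ ≠ ⊤ := by
    rw [lintegral_tsum fun m => (hM (m + M) (by omega)).1.const_mul _]
    refine ne_top_of_le_ne_top (ENNReal.mul_ne_top hsum hC) ?_
    rw [← ENNReal.tsum_mul_right]
    refine ENNReal.tsum_le_tsum fun m => ?_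
    rw [lintegral_const_mul' _ _ ENNReal.ofReal_ne_top]
    gcongr
    exact (hM (m + M) (by omega)).2
  filter_upwards [ae_lt_top' (AEMeasurable.tsum fun m =>
    (hM (m + M) (by omega)).1.const_mul _) hint] with x hx
  have h0 := ENNReal.tendsto_atTop_zero_of_tsum_ne_top hx.ne
  rw [← map_add_atTop_eq_nat M, eventually_map]
  filter_upwards [h0.eventually_le_const (show (0 : ENNReal) < ENNReal.ofReal (1 / 2) by simp),
    eventually_ge_atTop 1] with m hm hm1
  have hpos : (0 : ℝ) < ((m + M : ℕ) : ℝ) := by exact_mod_cast (by omega : 0 < m + M)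
  calc u (m + M) x = ENNReal.ofReal (((m + M : ℕ) : ℝ) ^ 2) * (w m * u (m + M) x) := by
        rw [← mul_assoc, hw, ← ENNReal.ofReal_mul (by positivity), mul_one_div_cancel (by positivity),
          ENNReal.ofReal_one, one_mul]
    _ ≤ ENNReal.ofReal (((m + M : ℕ) : ℝ) ^ 2) * ENNReal.ofReal (1 / 2) := by gcongr
    _ = _ := by rw [← ENNReal.ofReal_mul (by positivity), mul_one_div]

end Moments

variable {d p m n k : ℕ} {K : E d → ℝ} {f : E d → ℝ}

theorem measurePreserving_cons (hf : IsC2Density f) (n : ℕ) :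
    MeasurePreserving (fun q : E d × (Fin n → E d) => Fin.cons (α := fun _ => E d) q.1 q.2)
      ((law f).prod (sampleLaw f n)) (sampleLaw f (n + 1)) := by
  have := hf.isProbabilityMeasure
  have h := (measurePreserving_piFinSuccAbove (fun _ : Fin (n + 1) => law f) 0).symm
  have e : ⇑(MeasurableEquiv.piFinSuccAbove (fun _ : Fin (n + 1) => E d) 0).symm =
      fun q : E d × (Fin n → E d) => Fin.cons (α := fun _ => E d) q.1 q.2 := by
    funext q
    simp [MeasurableEquiv.piFinSuccAbove, Fin.insertNthEquiv]
  rw [e] at h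
  exact h

/-- The asymptotic assumptions hold for the conditional problem at `x`. -/
structure GoodPoint (k p : ℕ) (K f : E d → ℝ) (x : E d) : Prop where
  pos : 0 < f x
  integrable : ∀ᶠ n : ℕ in atTop, Integrable (firstTermAt (n := n) k p K x) (sampleLaw f n)
  solvable : ∀ᶠ n : ℕ in atTop, ∀ᵐ Y ∂(sampleLaw f n),
    Solvable k p K (Fin.cons (α := fun _ => E d) x Y) 0
  moment₀ : ∀ᶠ m : ℕ in atTop,
    ∫ Y, |firstTermAt k p K x Y| ∂(sampleLaw f (growth m)) ≤ (m : ℝ) ^ 2 / 2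
  moment₁ : ∀ᶠ m : ℕ in atTop,
    ∫ Y, |firstTermAt k p K x Y| ∂(sampleLaw f (2 * growth m + 1)) ≤ (m : ℝ) ^ 2 / 2

theorem tendsto_two_mul_growth : Tendsto (fun m => 2 * growth m + 1) atTop atTop :=
  tendsto_atTop_mono (fun m => by omega) tendsto_growth

theorem lintegral_enorm_firstTermAt_le (hf : IsC2Density f) {n : ℕ} {C : ℝ}
    (hi : Integrable (firstTerm (n := n) k p K) (sampleLaw f (n + 1)))
    (hC : ∫ X, |firstTerm (n := n) k p K X| ∂(sampleLaw f (n + 1)) ≤ C) :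
    ∫⁻ x, ∫⁻ Y, ‖firstTermAt k p K x Y‖ₑ ∂(sampleLaw f n) ∂(law f) ≤ ENNReal.ofReal C := by
  have hp := hf.isProbabilityMeasure
  have hpn : ∀ n, IsProbabilityMeasure (sampleLaw f n) := fun n => by
    unfold sampleLaw; infer_instance
  have hn : Integrable (fun q : E d × (Fin n → E d) => firstTermAt k p K q.1 q.2)
      ((law f).prod (sampleLaw f n)) :=
    (measurePreserving_cons hf n).integrable_comp_of_integrable hi
  rw [← lintegral_prod _ hn.aestronglyMeasurable.enorm]
  have h2 : ∫ q : E d × (Fin n → E d), |firstTermAt k p K q.1 q.2|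
      ∂((law f).prod (sampleLaw f n)) ≤ C := by
    refine le_trans (le_of_eq ?_) hC
    rw [← (measurePreserving_cons hf n).map_eq, integral_map
      (measurePreserving_cons hf n).measurable.aemeasurable
      (by rw [(measurePreserving_cons hf n).map_eq]; exact hi.abs.aestronglyMeasurable)]
    rfl
  simp only [← Real.norm_eq_abs] at h2
  rw [integral_norm_eq_lintegral_enorm hn.aestronglyMeasurable] at h2
  rw [← ENNReal.ofReal_toReal hn.2.ne]
  exact ENNReal.ofReal_le_ofReal h2

/-- Fubini, applied to the first sample point against the others, turns the joint assumptions into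
conditional ones. The moment bounds are extracted only along the two sequences of sample sizes that
the comparison uses. -/
theorem ae_goodPoint (hf : IsC2Density f) (hmax : MaximizerExists k p K f)
    (hex : ExchangeOfLimit k p K f) : ∀ᵐ x ∂(law f), GoodPoint k p K f x := by
  have hp := hf.isProbabilityMeasure
  have hpn : ∀ n, IsProbabilityMeasure (sampleLaw f n) := fun n => by
    unfold sampleLaw; infer_instance
  obtain ⟨C, hC⟩ := hex.bounded
  have hint : ∀ᶠ n : ℕ in atTop, Integrable
      (fun q : E d × (Fin n → E d) => firstTermAt k p K q.1 q.2)
      ((law f).prod (sampleLaw f n)) := by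
    filter_upwards [hC] with n hn
    exact (measurePreserving_cons hf n).integrable_comp_of_integrable hn.1
  have hbound : ∀ᶠ n : ℕ in atTop,
      AEMeasurable (fun x => ∫⁻ Y, ‖firstTermAt k p K x Y‖ₑ ∂(sampleLaw f n)) (law f) ∧
      ∫⁻ x, ∫⁻ Y, ‖firstTermAt k p K x Y‖ₑ ∂(sampleLaw f n) ∂(law f) ≤ ENNReal.ofReal C := by
    filter_upwards [hint, hC] with n hn hCn
    exact ⟨hn.aestronglyMeasurable.enorm.lintegral_prod_right',
      lintegral_enorm_firstTermAt_le hf hCn.1 hCn.2⟩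
  have hI : ∀ᵐ x ∂(law f), ∀ᶠ n : ℕ in atTop,
      Integrable (firstTermAt (n := n) k p K x) (sampleLaw f n) := by
    obtain ⟨N, hN⟩ := eventually_atTop.1 hint
    have : ∀ᵐ x ∂(law f), ∀ n, N ≤ n →
        Integrable (firstTermAt (n := n) k p K x) (sampleLaw f n) := by
      refine ae_all_iff.2 fun n => ?_
      by_cases hn : N ≤ n
      · filter_upwards [(hN n hn).prod_right_ae] with x hx _ using hx
      · exact Eventually.of_forall fun _ h => absurd h hn
    filter_upwards [this] with x hx using eventually_atTop.2 ⟨N, hx⟩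
  have hS : ∀ᵐ x ∂(law f), ∀ᶠ n : ℕ in atTop, ∀ᵐ Y ∂(sampleLaw f n),
      Solvable k p K (Fin.cons (α := fun _ => E d) x Y) 0 := by
    obtain ⟨N, hN⟩ := eventually_atTop.1 hmax
    have : ∀ᵐ x ∂(law f), ∀ n, N ≤ n → ∀ᵐ Y ∂(sampleLaw f n),
        Solvable k p K (Fin.cons (α := fun _ => E d) x Y) 0 := by
      refine ae_all_iff.2 fun n => ?_
      by_cases hn : N ≤ n
      · have h1 := (measurePreserving_cons hf n).quasiMeasurePreserving.ae
          (hN (n + 1) (by omega))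
        filter_upwards [Measure.ae_ae_of_ae_prod h1] with x hx _
        filter_upwards [hx] with Y hY using hY 0
      · exact Eventually.of_forall fun _ h => absurd h hn
    filter_upwards [this] with x hx using eventually_atTop.2 ⟨N, hx⟩
  have hm : ∀ g : ℕ → ℕ, Tendsto g atTop atTop → ∀ᵐ x ∂(law f), ∀ᶠ m : ℕ in atTop,
      ∫⁻ Y, ‖firstTermAt k p K x Y‖ₑ ∂(sampleLaw f (g m)) ≤ ENNReal.ofReal ((m : ℝ) ^ 2 / 2) :=
    fun g hg => ae_eventually_le_sq
      (u := fun m x => ∫⁻ Y, ‖firstTermAt k p K x Y‖ₑ ∂(sampleLaw f (g m)))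
      ENNReal.ofReal_ne_top (hg.eventually hbound)
  have conv : ∀ (x : E d) (n m : ℕ), Integrable (firstTermAt (n := n) k p K x) (sampleLaw f n) →
      ∫⁻ Y, ‖firstTermAt k p K x Y‖ₑ ∂(sampleLaw f n) ≤ ENNReal.ofReal ((m : ℝ) ^ 2 / 2) →
      ∫ Y, |firstTermAt k p K x Y| ∂(sampleLaw f n) ≤ (m : ℝ) ^ 2 / 2 := by
    intro x n m hi hle
    simp only [← Real.norm_eq_abs]
    rw [integral_norm_eq_lintegral_enorm hi.aestronglyMeasurable]
    exact ENNReal.toReal_le_of_le_ofReal (by positivity) hle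
  filter_upwards [hf.ae_pos, hI, hS, hm _ tendsto_growth, hm _ tendsto_two_mul_growth] with
    x h1 h2 h3 h4 h5
  refine ⟨h1, h2, h3, ?_, ?_⟩
  · filter_upwards [h4, tendsto_growth.eventually h2] with m a b using conv _ _ _ b a
  · filter_upwards [h5, tendsto_two_mul_growth.eventually h2] with m a b using conv _ _ _ b a

/-- The limit functionals of the nearest points whose expectations are compared. -/
def nearTerm (k p : ℕ) (K : E d → ℝ) (N : ℕ → ℕ) (m : ℕ) (z : Fin m → E d) : ℝ :=
  locTerm k p K 1 z + Real.log ((N m : ℝ) + 1)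

/-- Half of the bound m² is the conditional moment; the other half absorbs the constant |log f(x)|
for large m. -/
theorem GoodPoint.eventually_near (hd : 1 ≤ d) (hf : IsC2Density f) {x : E d}
    (h : GoodPoint k p K f x) : ∀ᶠ m : ℕ in atTop,
      (Integrable (nearTerm k p K growth m) (nearMeasure (normLaw f x) (growth m) m) ∧
        ∫ z, |nearTerm k p K growth m z| ∂(nearMeasure (normLaw f x) (growth m) m) ≤
          (m : ℝ) ^ 2) ∧
      (Integrable (nearTerm k p K (fun m => 2 * growth m + 1) m)
          (nearMeasure (normLaw f x) (2 * growth m + 1) m) ∧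
        ∫ z, |nearTerm k p K (fun m => 2 * growth m + 1) m z|
          ∂(nearMeasure (normLaw f x) (2 * growth m + 1) m) ≤ (m : ℝ) ^ 2) ∧
      ∫ z, nearTerm k p K (fun m => 2 * growth m + 1) m z
          ∂(nearMeasure (normLaw f x) (2 * growth m + 1) m) =
        condFirstTerm k p K f (2 * growth m + 1) x + Real.log (f x) := by
  have hlog : ∀ᶠ m : ℕ in atTop, |Real.log (f x)| ≤ (m : ℝ) ^ 2 / 2 := by
    have h1 : Tendsto (fun m : ℕ => (m : ℝ) ^ 2 / 2) atTop atTop :=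
      ((tendsto_pow_atTop two_ne_zero).comp tendsto_natCast_atTop_atTop).atTop_div_const two_pos
    exact h1.eventually_ge_atTop _
  filter_upwards [hlog, h.moment₀, h.moment₁, tendsto_growth.eventually h.integrable,
    tendsto_two_mul_growth.eventually h.integrable, tendsto_growth.eventually h.solvable,
    tendsto_two_mul_growth.eventually h.solvable, eventually_ge_atTop (max k 3),
    eventually_two_mul_le_growth] with m hl b0 b1 i0 i1 s0 s1 hmk hmq
  have hk : k ≤ m := (le_max_left _ _).trans hmk
  have hm3 : 3 ≤ m := (le_max_right _ _).trans hmk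
  obtain ⟨c0, c1⟩ := ceil_log_growth hm3
  have r0 := integral_firstTermAt hd hf h.pos (by omega) (by omega) hk c0 i0 s0
  have r1 := integral_firstTermAt hd hf h.pos (by omega) (by omega) hk c1 i1 s1
  exact ⟨⟨r0.1, r0.2.2.trans (by linarith)⟩, ⟨r1.1, r1.2.2.trans (by linarith)⟩, r1.2.1⟩

/-- Both sample sizes use the same m points and the same `locTerm`, so the functionals differ by
exactly log 2, within the slack 2 of `Controlled`. -/
theorem GoodPoint.controlled (hd : 1 ≤ d) (hf : IsC2Density f) {x : E d}
    (h : GoodPoint k p K f x) : Controlled (normLaw f x) (nearTerm k p K growth)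
      (nearTerm k p K fun m => 2 * growth m + 1) := by
  filter_upwards [h.eventually_near hd hf] with m hm
  refine ⟨fun z => ?_, hm.1, hm.2.1⟩
  have e : ((2 * growth m + 1 : ℕ) : ℝ) + 1 = 2 * ((growth m : ℝ) + 1) := by push_cast; ring
  have h2 : nearTerm k p K (fun m => 2 * growth m + 1) m z =
      nearTerm k p K growth m z + Real.log 2 := by
    simp only [nearTerm]
    rw [e, Real.log_mul two_ne_zero (by positivity)]
    ring
  rw [h2]
  have h3 : |Real.log 2| ≤ 2 := by
    rw [abs_of_nonneg (Real.log_nonneg one_le_two)]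
    linarith [Real.log_two_lt_d9]
  exact (abs_add_le _ _).trans (by linarith)

/-- The limit of the conditional expectation, recentred by `log f`, does not depend on the density
or on the point. -/
theorem GoodPoint.limit_unique (hd : 1 ≤ d) {f₁ f₂ : E d → ℝ} (hf₁ : IsC2Density f₁)
    (hf₂ : IsC2Density f₂) {x₁ x₂ : E d} (h₁ : GoodPoint k p K f₁ x₁)
    (h₂ : GoodPoint k p K f₂ x₂) {g₁ g₂ : ℝ}
    (hg₁ : Tendsto (fun n => condFirstTerm k p K f₁ n x₁) atTop (𝓝 g₁))
    (hg₂ : Tendsto (fun n => condFirstTerm k p K f₂ n x₂) atTop (𝓝 g₂)) :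
    g₁ + Real.log (f₁ x₁) = g₂ + Real.log (f₂ x₂) := by
  obtain ⟨L₁, δ₁, hl₁⟩ := exists_nearLebesgue_normLaw hd hf₁ h₁.pos
  obtain ⟨L₂, δ₂, hl₂⟩ := exists_nearLebesgue_normLaw hd hf₂ h₂.pos
  have key := Controlled.tendsto_sub hd hl₁ hl₂ (h₁.controlled hd hf₁) (h₂.controlled hd hf₂)
  -- The limits over all n are needed only along n = 2 `growth m` + 1.
  have lim := ((hg₁.comp tendsto_two_mul_growth).add_const (Real.log (f₁ x₁))).sub
    ((hg₂.comp tendsto_two_mul_growth).add_const (Real.log (f₂ x₂)))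
  have hzero := tendsto_nhds_unique (lim.congr' ?_) key
  · linarith
  · filter_upwards [h₁.eventually_near hd hf₁, h₂.eventually_near hd hf₂] with m a b
    rw [a.2.2, b.2.2]
    rfl

/-! ### Exchangeability of the sample points -/

section Exchangeability

variable {X : Fin n → E d} (σ : Equiv.Perm (Fin n)) (i : Fin n)

theorem nnDist_perm : nnDist k (X ∘ σ) i = nnDist k X (σ i) := by
  have : ∀ r : ℝ, {j | j ≠ σ i ∧ dist (X j) (X (σ i)) ≤ r} =
      σ '' {j | j ≠ i ∧ dist ((X ∘ σ) j) ((X ∘ σ) i) ≤ r} := by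
    intro r
    ext j
    rw [σ.image_eq_preimage_symm]
    simp [Equiv.symm_apply_eq]
  simp only [nnDist, this, Set.ncard_image_of_injective _ σ.injective]

theorem nbrs_perm : (nbrs (X ∘ σ) i).map σ.toEmbedding = nbrs X (σ i) := by
  ext j
  obtain ⟨l, rfl⟩ := σ.surjective j
  simp [nbrs, nnDist_perm]

theorem isMaximizer_perm (a : Param d p) :
    IsMaximizer k K (X ∘ σ) i a ↔ IsMaximizer k K X (σ i) a := by
  have h : ∀ (h : ℝ) (b : Param d p), localLogLik K h (X ∘ σ) i b = localLogLik K h X (σ i) b := by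
    intro h b
    rw [localLogLik, localLogLik, ← nbrs_perm, Finset.sum_map]
    rfl
  simp only [IsMaximizer, nnDist_perm, h]
  rfl

theorem solvable_perm : Solvable k p K (X ∘ σ) i ↔ Solvable k p K X (σ i) := by
  simp only [Solvable, isMaximizer_perm]

open Classical in
theorem densityEstimate_eq (X : Fin n → E d) (i : Fin n) : densityEstimate k p K X i =
    if h : ∃ a : Param d p, IsMaximizer k K X i a then Real.exp (constCoeff h.choose) else 0 := by
  simp only [densityEstimate, expPoly, sub_self, tensorPoly_zero]

theorem densityEstimate_perm :
    densityEstimate k p K (X ∘ σ) i = densityEstimate k p K X (σ i) := by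
  have h : (IsMaximizer k K (X ∘ σ) i : Param d p → Prop) = IsMaximizer k K X (σ i) :=
    funext fun a => propext (isMaximizer_perm σ i a)
  rw [densityEstimate_eq, densityEstimate_eq]
  -- Both sides choose a maximizer from predicates that are equal but not by definition; once they
  -- are identified, the chosen maximizers coincide.
  generalize (IsMaximizer k K (X ∘ σ) i : Param d p → Prop) = P at h
  subst h
  rfl

theorem measurePreserving_perm (hf : IsC2Density f) (σ : Equiv.Perm (Fin n)) :
    MeasurePreserving (fun X : Fin n → E d => X ∘ σ) (sampleLaw f n) (sampleLaw f n) := by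
  have := hf.isProbabilityMeasure
  have h := measurePreserving_piCongrLeft (fun _ : Fin n => law f) σ.symm
  have e : ⇑(MeasurableEquiv.piCongrLeft (fun _ : Fin n => E d) σ.symm) =
      fun X : Fin n → E d => X ∘ σ := by
    funext X j
    obtain ⟨l, rfl⟩ := σ.symm.surjective j
    exact (Equiv.piCongrLeft_apply_apply (fun _ : Fin n => E d) σ.symm X l).trans (by simp)
  rw [e] at h
  exact h

end Exchangeability

/-- Swapping the indices 0 and i preserves the sample law, so all summands have the mean of the
first. -/
theorem integral_entropyEstimate (hf : IsC2Density f)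
    (hint : Integrable (fun X : Fin (n + 1) → E d => firstTerm k p K X) (sampleLaw f (n + 1))) :
    ∫ X : Fin (n + 1) → E d, entropyEstimate k p K X ∂(sampleLaw f (n + 1)) =
      ∫ X : Fin (n + 1) → E d, firstTerm k p K X ∂(sampleLaw f (n + 1)) := by
  have hi : ∀ i : Fin (n + 1), Integrable
      (fun X : Fin (n + 1) → E d => Real.log (densityEstimate k p K X i)) (sampleLaw f (n + 1)) ∧
      ∫ X : Fin (n + 1) → E d, Real.log (densityEstimate k p K X i) ∂(sampleLaw f (n + 1)) =
        -∫ X : Fin (n + 1) → E d, firstTerm k p K X ∂(sampleLaw f (n + 1)) := by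
    intro i
    have hmp := measurePreserving_perm (d := d) hf (Equiv.swap 0 i)
    have e : (fun X : Fin (n + 1) → E d => Real.log (densityEstimate k p K X i)) =
        fun X => -firstTerm k p K (X ∘ Equiv.swap 0 i) := by
      funext X
      rw [firstTerm, densityEstimate_perm, Equiv.swap_apply_left, neg_neg]
    rw [e]
    refine ⟨(hmp.integrable_comp_of_integrable hint).neg, ?_⟩
    rw [integral_neg]
    congr 1
    nth_rw 2 [← hmp.map_eq]
    rw [integral_map hmp.measurable.aemeasurable
      (by rw [hmp.map_eq]; exact hint.aestronglyMeasurable)]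
  simp only [entropyEstimate]
  rw [integral_const_mul, integral_finsetSum _ fun i _ => (hi i).1]
  simp only [(hi _).2, Finset.sum_const, Finset.card_univ, Fintype.card_fin, nsmul_eq_mul]
  push_cast
  field_simp

/-- Convergence of the mean of the estimator from the pointwise limit of the conditional
expectations. -/
theorem tendsto_entropyEstimate (hf : IsC2Density f) (hex : ExchangeOfLimit k p K f) {B : ℝ}
    (hB : ∀ᵐ x ∂(law f), ∀ g : ℝ, Tendsto (fun n => condFirstTerm k p K f n x) atTop (𝓝 g) →
      g = B - Real.log (f x)) :
    Integrable (fun x => f x * Real.log (f x)) ∧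
      Tendsto (fun n : ℕ => ∫ X : Fin n → E d, entropyEstimate k p K X ∂(sampleLaw f n)) atTop
        (𝓝 (entropy f + B)) := by
  have hp := hf.isProbabilityMeasure
  have hpn : ∀ n, IsProbabilityMeasure (sampleLaw f n) := fun n => by
    unfold sampleLaw; infer_instance
  obtain ⟨C, hC⟩ := hex.bounded
  obtain ⟨g, hg, hlim⟩ := hex.exchange
  have hgB : g =ᵐ[law f] fun x => B - Real.log (f x) := by
    filter_upwards [hB, hg] with x h1 h2 using h1 _ h2
  obtain ⟨N, hN⟩ := eventually_atTop.1 hC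
  have hint : ∀ n, N ≤ n → Integrable
      (fun q : E d × (Fin n → E d) => firstTermAt k p K q.1 q.2)
      ((law f).prod (sampleLaw f n)) := fun n hn =>
    (measurePreserving_cons hf n).integrable_comp_of_integrable (hN n hn).1
  have hle : ∀ n, N ≤ n → ∫⁻ x, ‖condFirstTerm k p K f n x‖ₑ ∂(law f) ≤ ENNReal.ofReal C := by
    intro n hn
    have h1 : ∫⁻ x, ‖condFirstTerm k p K f n x‖ₑ ∂(law f) ≤
        ∫⁻ x, ∫⁻ Y, ‖firstTermAt k p K x Y‖ₑ ∂(sampleLaw f n) ∂(law f) :=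
      lintegral_mono fun x => enorm_integral_le_lintegral_enorm _
    exact h1.trans (lintegral_enorm_firstTermAt_le hf (hN n hn).1 (hN n hn).2)
  have hmeas : Measurable fun x => B - Real.log (f x) := hf.measurable.log.const_sub B
  -- Fatou's lemma: this function is an almost everywhere limit of conditional expectations with
  -- bounded L^1 norms. Finiteness of the entropy follows.
  have hgi : Integrable (fun x => B - Real.log (f x)) (law f) := by
    refine ⟨hmeas.aestronglyMeasurable, ?_⟩
    have h1 : ∀ᵐ x ∂(law f), ‖B - Real.log (f x)‖ₑ =
        liminf (fun n => ‖condFirstTerm k p K f (n + N) x‖ₑ) atTop := by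
      filter_upwards [hg, hgB] with x hx hx'
      rw [hx'] at hx
      exact ((hx.comp (tendsto_add_atTop_nat N)).enorm.liminf_eq).symm
    rw [HasFiniteIntegral, lintegral_congr_ae h1]
    refine (lintegral_liminf_le' fun n => ?_).trans_lt ?_
    · exact (hint (n + N) (by omega)).aestronglyMeasurable.integral_prod_right'.enorm
    · exact (liminf_le_of_frequently_le' (Eventually.of_forall fun n =>
        hle (n + N) (by omega)).frequently).trans_lt ENNReal.ofReal_lt_top
  have hlogi : Integrable (fun x => Real.log (f x)) (law f) :=
    ((integrable_const B).sub hgi).congr (Eventually.of_forall fun x => by simp)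
  have hnn : ∀ x, (ENNReal.ofReal (f x)).toReal = f x := fun x =>
    ENNReal.toReal_ofReal (hf.nonneg x)
  have hfl : Integrable fun x => f x * Real.log (f x) := by
    rw [law, integrable_withDensity_iff_integrable_smul' hf.measurable.ennreal_ofReal
      (Eventually.of_forall fun _ => ENNReal.ofReal_lt_top)] at hlogi
    simpa [hnn] using hlogi
  refine ⟨hfl, ?_⟩
  have hval : ∫ x, g x ∂(law f) = entropy f + B := by
    rw [integral_congr_ae hgB, integral_sub (integrable_const _) hlogi, entropy]
    have : ∫ x, Real.log (f x) ∂(law f) = ∫ x, f x * Real.log (f x) := by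
      rw [law, integral_withDensity_eq_integral_toReal_smul hf.measurable.ennreal_ofReal
        (Eventually.of_forall fun _ => ENNReal.ofReal_lt_top)]
      simp [hnn]
    rw [this]
    simp
    ring
  rw [hval] at hlim
  -- In `firstTerm` the index n counts the other points, so the sample size is n + 1.
  rw [← tendsto_add_atTop_iff_nat 1]
  refine hlim.congr' ?_
  filter_upwards [hC] with n hn
  rw [integral_entropyEstimate hf hn.1]

/-- The asymptotic bias does not depend on the density. -/
theorem exists_bias (hd : 1 ≤ d) (k p : ℕ) (K : E d → ℝ) :
    ∃ B : ℝ, ∀ f : E d → ℝ, IsC2Density f → MaximizerExists k p K f → ExchangeOfLimit k p K f →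
      Integrable (fun x => f x * Real.log (f x)) ∧
      Tendsto (fun n : ℕ => ∫ X : Fin n → E d, entropyEstimate k p K X ∂(sampleLaw f n)) atTop
        (𝓝 (entropy f + B)) := by
  -- The constant is read off at a single good point of a single admissible density; if there is no
  -- such density, any constant serves.
  by_cases hne : ∃ f₀ : E d → ℝ, IsC2Density f₀ ∧ MaximizerExists k p K f₀ ∧
      ExchangeOfLimit k p K f₀
  · obtain ⟨f₀, hf₀, hmax₀, hex₀⟩ := hne
    have := hf₀.isProbabilityMeasure
    obtain ⟨g₀, hg₀, _⟩ := hex₀.exchange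
    obtain ⟨x₀, hx₀, hlim₀⟩ := ((ae_goodPoint hf₀ hmax₀ hex₀).and hg₀).exists
    refine ⟨g₀ x₀ + Real.log (f₀ x₀), fun f hf hmax hex => tendsto_entropyEstimate hf hex ?_⟩
    filter_upwards [ae_goodPoint hf hmax hex] with x hx g hg
    have := hx.limit_unique hd hf hf₀ hx₀ hg hlim₀
    linarith
  · exact ⟨0, fun f hf hmax hex => absurd ⟨f, hf, hmax, hex⟩ hne⟩

end LLDE
end

/-! ### The step kernel with p = 0: explicit maximizer -/

noncomputable section
namespace LLDE

variable {d p m n k : ℕ} {f : E d → ℝ}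

/-- If the distances to the origin are distinct, exactly `k` points have at most the `k`-th
smallest distance, and one of them attains it. -/
theorem exists_finset_kDist {z : Fin m → E d} (hz : Function.Injective fun j => ‖z j‖)
    (hk : 1 ≤ k) (hkm : k ≤ m) : ∃ S : Finset (Fin m), S.card = k ∧
      (∀ j, j ∈ S ↔ ‖z j‖ ≤ kDist k z) ∧ ∃ j ∈ S, ‖z j‖ = kDist k z := by
  obtain ⟨S, hS, hlt⟩ := exists_finset_lt_compl hz hkm
  obtain ⟨j₀, hj₀, hmax⟩ := S.exists_max_image (fun j => ‖z j‖) (Finset.card_pos.1 (by omega))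
  have hmem : ∀ j, j ∈ S ↔ ‖z j‖ ≤ ‖z j₀‖ := fun j =>
    ⟨hmax j, fun h => by
      by_contra hj
      exact absurd (hlt j₀ hj₀ j hj) (not_lt.2 h)⟩
  have hset : {r : ℝ | 0 ≤ r ∧ k ≤ Set.ncard {j | ‖z j‖ ≤ r}} = Set.Ici ‖z j₀‖ := by
    ext r
    simp only [Set.mem_ofPred_eq, Set.mem_Ici]
    constructor
    · rintro ⟨_, hr⟩
      by_contra! hc
      have hsub : {j | ‖z j‖ ≤ r} ⊆ ((S.erase j₀ : Finset (Fin m)) : Set (Fin m)) := by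
        intro j hj
        have hj' : ‖z j‖ ≤ r := hj
        rw [Finset.mem_coe, Finset.mem_erase]
        refine ⟨?_, (hmem j).2 (by linarith)⟩
        rintro rfl
        linarith
      have h1 := Set.ncard_le_ncard hsub (Set.toFinite _)
      rw [Set.ncard_coe_finset, Finset.card_erase_of_mem hj₀] at h1
      omega
    · intro hr
      refine ⟨(norm_nonneg _).trans hr, ?_⟩
      have hsub : (S : Set (Fin m)) ⊆ {j | ‖z j‖ ≤ r} := fun j hj => (hmax j hj).trans hr
      have h1 := Set.ncard_le_ncard hsub (Set.toFinite _)
      rwa [Set.ncard_coe_finset, hS] at h1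
  have hk' : kDist k z = ‖z j₀‖ := by rw [kDist, hset, csInf_Ici]
  exact ⟨S, hS, by rwa [hk'], j₀, hj₀, hk'.symm⟩

theorem kDist_pos {z : Fin m → E d} (hz : Function.Injective fun j => ‖z j‖) (h0 : ∀ j, z j ≠ 0)
    (hk : 1 ≤ k) (hkm : k ≤ m) : 0 < kDist k z := by
  obtain ⟨S, _, _, j, _, hj⟩ := exists_finset_kDist hz hk hkm
  rw [← hj]
  exact norm_pos_iff.2 (h0 j)

theorem kDist_le_norm {z : Fin m → E d} (hz : Function.Injective fun j => ‖z j‖) (hk : 1 ≤ k)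
    (hkm : k ≤ m) : kDist k z ≤ ‖z‖ := by
  obtain ⟨S, _, _, j, _, hj⟩ := exists_finset_kDist hz hk hkm
  rw [← hj]
  exact norm_le_pi_norm z j

section StepKernel

theorem stepKernel_inv_smul {ρ : ℝ} (hρ : 0 < ρ) (u : E d) :
    stepKernel d (ρ⁻¹ • u) = (Metric.closedBall 0 ρ).indicator (fun _ => 1) u := by
  have : ρ⁻¹ • u ∈ Metric.closedBall (0 : E d) 1 ↔ u ∈ Metric.closedBall 0 ρ := by
    rw [mem_closedBall_zero_iff, mem_closedBall_zero_iff, norm_smul, norm_inv, Real.norm_eq_abs,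
      abs_of_pos hρ, inv_mul_le_iff₀ hρ, mul_one]
  by_cases h : u ∈ Metric.closedBall 0 ρ
  · rw [stepKernel, Set.indicator_of_mem (this.2 h), Set.indicator_of_mem h]
  · rw [stepKernel, Set.indicator_of_notMem (this.not.2 h), Set.indicator_of_notMem h]

theorem tensorPoly_degree_zero (a : Param d 0) (y : E d) : tensorPoly a y = constCoeff a := by
  rw [← tensorPoly_zero]
  simp only [tensorPoly]
  refine Finset.sum_congr rfl fun α _ => Finset.sum_congr rfl fun i _ => ?_
  have : IsEmpty (Fin (α : ℕ)) := by
    have : (α : ℕ) = 0 := by omega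
    rw [this]; infer_instance
  simp

theorem kernelExp_stepKernel {ρ : ℝ} (hρ : 0 < ρ) (a : Param d 0) :
    kernelExp (stepKernel d) ρ a =
      (Metric.closedBall 0 ρ).indicator fun _ => Real.exp (constCoeff a) := by
  funext u
  rw [kernelExp, stepKernel_inv_smul hρ, tensorPoly_degree_zero]
  simp only [Set.indicator]
  split_ifs <;> simp

theorem integrable_kernelExp_stepKernel {ρ : ℝ} (hρ : 0 < ρ) (a : Param d 0) :
    Integrable (kernelExp (stepKernel d) ρ a) := by
  rw [kernelExp_stepKernel hρ, integrable_indicator_iff Metric.isClosed_closedBall.measurableSet]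
  exact integrableOn_const measure_closedBall_lt_top.ne

theorem integral_kernelExp_stepKernel {ρ : ℝ} (hρ : 0 < ρ) (a : Param d 0) :
    ∫ u, kernelExp (stepKernel d) ρ a u = ballVol d * ρ ^ d * Real.exp (constCoeff a) := by
  rw [kernelExp_stepKernel hρ, integral_indicator Metric.isClosed_closedBall.measurableSet,
    setIntegral_const, volume_real_closedBall hρ.le, smul_eq_mul]

/-- Without ties exactly k points, the k-th neighbour included, lie in the closed ball of radius
`kDist k z`; the remaining neighbours get weight 0. -/
theorem locObj_stepKernel {z : Fin m → E d} (hz : Function.Injective fun j => ‖z j‖)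
    (h0 : ∀ j, z j ≠ 0) (hk : 1 ≤ k) (hkm : k ≤ m) (N : ℝ) (a : Param d 0) :
    locObj (stepKernel d) N (kDist k z) z a =
      k * constCoeff a - N * (ballVol d * kDist k z ^ d) * Real.exp (constCoeff a) := by
  have hρ := kDist_pos hz h0 hk hkm
  obtain ⟨S, hS, hmem, _⟩ := exists_finset_kDist hz hk hkm
  rw [locObj, integral_kernelExp_stepKernel hρ]
  simp only [stepKernel_inv_smul hρ, tensorPoly_degree_zero, ← Finset.sum_mul]
  have : ∑ j, (Metric.closedBall (0 : E d) (kDist k z)).indicator (fun _ => (1 : ℝ)) (z j) = k := by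
    simp only [Set.indicator, mem_closedBall_zero_iff, ← hmem]
    simp [hS]
  rw [this]
  ring

/-- Strict inequality 1 + s < e^s for s = t - log(κ / A), the distance to the critical point.
Strictness yields uniqueness of the maximizer. -/
theorem mul_sub_mul_exp_le {κ A : ℝ} (hκ : 0 < κ) (hA : 0 < A) {t : ℝ}
    (ht : t ≠ Real.log (κ / A)) : κ * t - A * Real.exp t <
      κ * Real.log (κ / A) - A * Real.exp (Real.log (κ / A)) := by
  have h := Real.add_one_lt_exp (sub_ne_zero.2 ht)
  have e1 : A * Real.exp t = κ * Real.exp (t - Real.log (κ / A)) := by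
    rw [Real.exp_sub, Real.exp_log (by positivity)]
    field_simp
  have e2 : A * Real.exp (Real.log (κ / A)) = κ := by
    rw [Real.exp_log (by positivity)]
    field_simp
  rw [e1, e2]
  nlinarith

theorem locMax_stepKernel_iff {z : Fin m → E d} (hz : Function.Injective fun j => ‖z j‖)
    (h0 : ∀ j, z j ≠ 0) (hk : 1 ≤ k) (hkm : k ≤ m) {N : ℝ} (hN : 0 < N) (a : Param d 0) :
    LocMax k (stepKernel d) N z a ↔
      constCoeff a = Real.log (k / (N * (ballVol d * kDist k z ^ d))) := by
  have hρ := kDist_pos hz h0 hk hkm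
  have hV := ballVol_pos d
  have hκ : (0 : ℝ) < k := by exact_mod_cast hk
  have hA : 0 < N * (ballVol d * kDist k z ^ d) := by positivity
  simp only [LocMax, integrable_kernelExp_stepKernel hρ, true_and, forall_const,
    locObj_stepKernel hz h0 hk hkm]
  constructor
  · intro h
    by_contra hne
    have h1 := mul_sub_mul_exp_le hκ hA hne
    have h2 := h fun _ _ => Real.log (k / (N * (ballVol d * kDist k z ^ d)))
    exact absurd h1 (not_lt.2 h2)
  · intro h b
    rw [h]
    by_cases hb : constCoeff b = Real.log (k / (N * (ballVol d * kDist k z ^ d)))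
    · rw [hb]
    · exact (mul_sub_mul_exp_le hκ hA hb).le

theorem locSolvable_stepKernel {z : Fin m → E d} (hz : Function.Injective fun j => ‖z j‖)
    (h0 : ∀ j, z j ≠ 0) (hk : 1 ≤ k) (hkm : k ≤ m) {N : ℝ} (hN : 0 < N) :
    LocSolvable k 0 (stepKernel d) N z := by
  refine ⟨fun _ _ => Real.log (k / (N * (ballVol d * kDist k z ^ d))),
    (locMax_stepKernel_iff hz h0 hk hkm hN _).2 rfl, fun b hb => ?_⟩
  rw [(locMax_stepKernel_iff hz h0 hk hkm hN b).1 hb]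
  rfl

theorem locTerm_stepKernel {z : Fin m → E d} (hz : Function.Injective fun j => ‖z j‖)
    (h0 : ∀ j, z j ≠ 0) (hk : 1 ≤ k) (hkm : k ≤ m) :
    locTerm k 0 (stepKernel d) 1 z = Real.log (ballVol d * kDist k z ^ d) - Real.log k := by
  have hρ := kDist_pos hz h0 hk hkm
  have hV := ballVol_pos d
  have hκ : (0 : ℝ) < k := by exact_mod_cast hk
  obtain ⟨a, ha, _⟩ := id (locSolvable_stepKernel (N := 1) hz h0 hk hkm one_pos)
  rw [locTerm_eq (locSolvable_stepKernel hz h0 hk hkm one_pos) ha,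
    (locMax_stepKernel_iff hz h0 hk hkm one_pos a).1 ha, one_mul,
    Real.log_div hκ.ne' (by positivity)]
  ring

theorem unitBallVolume_eq (hd : 1 ≤ d) : unitBallVolume d = ballVol d := by
  have : Nonempty (Fin d) := ⟨⟨0, hd⟩⟩
  have hG : 0 < Real.Gamma ((d : ℝ) / 2 + 1) := Real.Gamma_pos_of_pos (by positivity)
  rw [ballVol, measureReal_def, EuclideanSpace.volume_closedBall, Fintype.card_fin,
    ENNReal.ofReal_one, one_pow, one_mul, ENNReal.toReal_ofReal (by positivity), unitBallVolume,
    Real.sqrt_eq_rpow, ← Real.rpow_natCast, ← Real.rpow_mul Real.pi_pos.le]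
  ring_nf

/-- The Kozachenko--Leonenko form of the estimate at the first sample point. -/
theorem densityEstimate_stepKernel_zero (hd : 1 ≤ d) (hk : 1 ≤ k) {X : Fin (n + 1) → E d}
    (hX : Function.Injective fun j : Fin n => ‖X j.succ - X 0‖)
    (h0 : ∀ j : Fin n, X j.succ - X 0 ≠ 0) (hkm : k ≤ ⌈Real.log ((n + 1 : ℕ) : ℝ)⌉₊)
    (hmn : ⌈Real.log ((n + 1 : ℕ) : ℝ)⌉₊ ≤ n) :
    Solvable k 0 (stepKernel d) X 0 ∧ densityEstimate k 0 (stepKernel d) X 0 =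
      k / (((n + 1 : ℕ) : ℝ) * unitBallVolume d * nnDist k X 0 ^ d) := by
  obtain ⟨S, hS⟩ := exists_isNearest (hk.trans hkm) hmn hX
  have he := (S.1.orderEmbOfFin S.2).injective
  have hz : Function.Injective fun i => ‖X (S.1.orderEmbOfFin S.2 i).succ - X 0‖ := hX.comp he
  have hz0 : ∀ i, X (S.1.orderEmbOfFin S.2 i).succ - X 0 ≠ 0 := fun i => h0 _
  have hN : (0 : ℝ) < (n : ℝ) + 1 := by positivity
  have hs := (solvable_zero_iff (p := 0) (K := stepKernel d) hkm rfl he hS).2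
    (locSolvable_stepKernel hz hz0 hk hkm hN)
  refine ⟨hs, ?_⟩
  obtain ⟨a, ha, _⟩ := id hs
  have hρ : nnDist k X 0 = kDist k fun i => X (S.1.orderEmbOfFin S.2 i).succ - X 0 := by
    rw [nnDist_zero, hS.kDist_eq he hkm]
  have hpos := kDist_pos hz hz0 hk hkm
  have hV := ballVol_pos d
  have hκ : (0 : ℝ) < k := by exact_mod_cast hk
  rw [log_densityEstimate hs ha, (locMax_stepKernel_iff hz hz0 hk hkm hN a).1
    ((isMaximizer_zero_iff hkm rfl he hS a).1 ha), Real.exp_log (by positivity), hρ,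
    unitBallVolume_eq hd]
  push_cast
  rw [mul_assoc]

end StepKernel

/-- For a fixed first point the law of the differences is still absolutely continuous, so ties and
coincidences are null as before. -/
theorem ae_distances (hd : 1 ≤ d) (hf : IsC2Density f) (n : ℕ) :
    ∀ᵐ X ∂(sampleLaw f (n + 1)), (Function.Injective fun j : Fin n => ‖X j.succ - X 0‖) ∧
      ∀ j : Fin n, X j.succ - X 0 ≠ 0 := by
  have hp := hf.isProbabilityMeasure
  have : Nonempty (Fin d) := ⟨⟨0, hd⟩⟩
  have hsub : ∀ x : E d, Measurable fun y : E d => y - x := fun x => by fun_prop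
  have hprob : ∀ x : E d, IsProbabilityMeasure ((law f).map fun y => y - x) := fun x =>
    Measure.isProbabilityMeasure_map (hsub x).aemeasurable
  have hsph : ∀ (x : E d) (t : ℝ), ((law f).map fun y => y - x) (Metric.sphere 0 t) = 0 := by
    intro x t
    rw [Measure.map_apply (hsub x) Metric.isClosed_sphere.measurableSet]
    refine law_ac f ?_
    have : (fun y => y - x) ⁻¹' Metric.sphere 0 t = Metric.sphere x t := by
      ext y; simp
    rw [this]
    exact Measure.addHaar_sphere _ _ _
  have hmp : ∀ x : E d, MeasurePreserving (fun (Y : Fin n → E d) j => Y j - x) (sampleLaw f n)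
      (Measure.pi fun _ => (law f).map fun y => y - x) := fun x =>
    measurePreserving_pi _ _ fun _ => ⟨hsub x, rfl⟩
  have main : ∀ᵐ X ∂(sampleLaw f (n + 1)),
      (∀ i j : Fin n, i ≠ j → ‖X i.succ - X 0‖ ≠ ‖X j.succ - X 0‖) ∧
      ∀ j : Fin n, X j.succ - X 0 ≠ 0 := by
    rw [← (measurePreserving_cons hf n).map_eq,
      ae_map_iff (measurePreserving_cons hf n).measurable.aemeasurable]
    · have hpn : IsProbabilityMeasure (sampleLaw f n) := by unfold sampleLaw; infer_instance
      rw [Measure.ae_prod_iff_ae_ae]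
      · refine Eventually.of_forall fun x => ?_
        filter_upwards [(hmp x).quasiMeasurePreserving.ae (ae_norm_injective _ (hsph x) n),
          (hmp x).quasiMeasurePreserving.ae (ae_ne_zero _ (hsph x) n)] with Y h1 h2
        exact ⟨fun i j hij h => hij (h1 (by simpa using h)), fun j => by simpa using h2 j⟩
      · refine (measurePreserving_cons hf n).measurable (t := {X : Fin (n + 1) → E d |
          (∀ i j : Fin n, i ≠ j → ‖X i.succ - X 0‖ ≠ ‖X j.succ - X 0‖) ∧
            ∀ j : Fin n, X j.succ - X 0 ≠ 0}) ?_
        measurability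
    · measurability
  filter_upwards [main] with X hX
  refine ⟨fun i j hij => ?_, hX.2⟩
  by_contra h
  exact hX.1 i j h hij

theorem eventually_ceil_log (k : ℕ) : ∀ᶠ n : ℕ in atTop,
    k ≤ ⌈Real.log ((n + 1 : ℕ) : ℝ)⌉₊ ∧ ⌈Real.log ((n + 1 : ℕ) : ℝ)⌉₊ ≤ n := by
  have h1 : Tendsto (fun n : ℕ => Real.log ((n + 1 : ℕ) : ℝ)) atTop atTop :=
    Real.tendsto_log_atTop.comp (tendsto_natCast_atTop_atTop.comp (tendsto_add_atTop_nat 1))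
  filter_upwards [h1.eventually_ge_atTop (k : ℝ)] with n hn
  refine ⟨?_, ?_⟩
  · exact_mod_cast hn.trans (Nat.le_ceil _)
  · refine Nat.ceil_le.2 ?_
    have := Real.log_le_sub_one_of_pos (show (0 : ℝ) < ((n + 1 : ℕ) : ℝ) by positivity)
    push_cast at this ⊢
    linarith

/-- With the step kernel and `p = 0` the estimator is the Kozachenko--Leonenko estimator. -/
theorem eventually_densityEstimate_stepKernel (hd : 1 ≤ d) (hk : 1 ≤ k) (hf : IsC2Density f) :
    ∀ᶠ n : ℕ in atTop, ∀ᵐ X ∂(sampleLaw f n), ∀ i : Fin n,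
      Solvable k 0 (stepKernel d) X i ∧ densityEstimate k 0 (stepKernel d) X i =
        k / (n * unitBallVolume d * nnDist k X i ^ d) := by
  have h : ∀ᶠ n : ℕ in atTop, ∀ᵐ X ∂(sampleLaw f (n + 1)), ∀ i : Fin (n + 1),
      Solvable k 0 (stepKernel d) X i ∧ densityEstimate k 0 (stepKernel d) X i =
        k / (((n + 1 : ℕ) : ℝ) * unitBallVolume d * nnDist k X i ^ d) := by
    filter_upwards [eventually_ceil_log k] with n hn
    refine ae_all_iff.2 fun i => ?_
    -- The formula for the first point, applied to the sample with 0 and i swapped, is the formula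
    -- for point i.
    filter_upwards [(measurePreserving_perm hf (Equiv.swap 0 i)).quasiMeasurePreserving.ae
      (ae_distances hd hf n)] with X hX
    have key := densityEstimate_stepKernel_zero hd hk hX.1 hX.2 hn.1 hn.2
    rwa [solvable_perm, densityEstimate_perm, nnDist_perm, Equiv.swap_apply_left] at key
  rw [← map_add_atTop_eq_nat 1, eventually_map]
  exact h

theorem maximizerExists_stepKernel (hd : 1 ≤ d) (hk : 1 ≤ k) (hf : IsC2Density f) :
    MaximizerExists k 0 (stepKernel d) f := by
  filter_upwards [eventually_densityEstimate_stepKernel hd hk hf] with n hn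
  filter_upwards [hn] with X hX i using (hX i).1

end LLDE
end

/-! ### Beta integrals, binomial tails and the radial distribution function -/

noncomputable section
namespace LLDE

section Beta

/-- Integration by parts: t^(j+1) (1 - t)^(l+1) vanishes at both ends, which trades a power of 1 - t
for a power of t. -/
theorem integral_pow_mul_one_sub_pow (l : ℕ) : ∀ j : ℕ,
    ∫ t in (0 : ℝ)..1, t ^ j * (1 - t) ^ l =
      (j.factorial * l.factorial : ℝ) / (j + l + 1).factorial := by
  induction l with
  | zero =>
    intro j
    simp only [pow_zero, mul_one, integral_pow, one_pow, Nat.factorial_zero, Nat.cast_one, add_zero]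
    rw [Nat.factorial_succ]
    have := Nat.factorial_pos j
    push_cast
    field_simp
    simp
  | succ l ih =>
    intro j
    have hderiv : ∀ t ∈ Set.uIcc (0 : ℝ) 1, HasDerivAt (fun t : ℝ => t ^ (j + 1) * (1 - t) ^ (l + 1))
        (((j : ℝ) + 1) * (t ^ j * (1 - t) ^ (l + 1)) -
          ((l : ℝ) + 1) * (t ^ (j + 1) * (1 - t) ^ l)) t := by
      intro t _
      have h1 := hasDerivAt_pow (j + 1) t
      have h2 := ((hasDerivAt_id t).const_sub 1).pow (l + 1)
      refine (h1.mul h2).congr_deriv ?_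
      simp only [id, Nat.add_sub_cancel, Pi.pow_apply]
      push_cast
      ring
    have hc1 : Continuous fun t : ℝ => ((j : ℝ) + 1) * (t ^ j * (1 - t) ^ (l + 1)) := by fun_prop
    have hc2 : Continuous fun t : ℝ => ((l : ℝ) + 1) * (t ^ (j + 1) * (1 - t) ^ l) := by fun_prop
    have h := intervalIntegral.integral_eq_sub_of_hasDerivAt hderiv
      ((hc1.sub hc2).intervalIntegrable 0 1)
    rw [intervalIntegral.integral_sub (hc1.intervalIntegrable 0 1) (hc2.intervalIntegrable 0 1),
      intervalIntegral.integral_const_mul, intervalIntegral.integral_const_mul, ih] at h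
    simp only [one_pow, sub_self, zero_pow (Nat.succ_ne_zero _), mul_zero, zero_mul] at h
    have e : j + 1 + l + 1 = j + (l + 1) + 1 := by ring
    rw [e, Nat.factorial_succ j] at h
    have hj : ((j : ℝ) + 1) ≠ 0 := by positivity
    have hF : (((j + (l + 1) + 1).factorial : ℕ) : ℝ) ≠ 0 := by positivity
    refine mul_left_cancel₀ hj ?_
    rw [sub_eq_zero.1 h, Nat.factorial_succ l]
    push_cast
    ring

/-- Each term of the binomial tail, divided by t, integrates to 1 / j; this produces the harmonic
sum. -/
theorem choose_mul_integral {n j : ℕ} (hj : 1 ≤ j) (hjn : j ≤ n) :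
    (n.choose j : ℝ) * ∫ t in (0 : ℝ)..1, t ^ (j - 1) * (1 - t) ^ (n - j) = (j : ℝ)⁻¹ := by
  obtain ⟨i, rfl⟩ := Nat.exists_eq_add_of_le' hj
  obtain ⟨l, rfl⟩ := Nat.exists_eq_add_of_le hjn
  have e1 : i + 1 + l - (i + 1) = l := by omega
  have e2 : i + l + 1 = i + 1 + l := by ring
  rw [e1, Nat.add_sub_cancel, integral_pow_mul_one_sub_pow, e2]
  have h := Nat.add_choose_mul_factorial_mul_factorial (i + 1) l
  have h' : ((i + 1 + l).choose (i + 1) : ℝ) * (((i : ℝ) + 1) * i.factorial) * l.factorial =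
      (i + 1 + l).factorial := by
    rw [← h, Nat.factorial_succ, Nat.choose_symm_add]; push_cast; rfl
  have hF : (((i + 1 + l).factorial : ℕ) : ℝ) ≠ 0 := by positivity
  push_cast
  field_simp
  linarith

end Beta

section Binomial

variable {α : Type*} [MeasurableSpace α] (ν : Measure α) [IsProbabilityMeasure ν]

open Classical in
/-- Upper tail of the binomial distribution. -/
theorem pi_card_ge {A : Set α} (hA : MeasurableSet A) {t : ℝ} (ht0 : 0 ≤ t) (ht1 : t ≤ 1)
    (hνA : ν A = ENNReal.ofReal t) (n k : ℕ) :
    (Measure.pi fun _ : Fin n => ν) {Y | k ≤ (Finset.univ.filter fun j => Y j ∈ A).card} =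
      ∑ j ∈ Finset.Icc k n, ENNReal.ofReal (n.choose j * (t ^ j * (1 - t) ^ (n - j))) := by
  -- Partition by the exact set of indices whose points fall in A; each cell is a box.
  have hbox : ∀ S : Finset (Fin n), {Y : Fin n → α | (Finset.univ.filter fun j => Y j ∈ A) = S} =
      Set.univ.pi fun j => if j ∈ S then A else Aᶜ := by
    intro S
    ext Y
    simp only [Set.mem_ofPred_eq, Finset.ext_iff, Finset.mem_filter, Finset.mem_univ, true_and,
      Set.mem_univ_pi]
    refine forall_congr' fun j => ?_
    by_cases h : j ∈ S <;> simp [h]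
  have hmeas : ∀ S : Finset (Fin n),
      MeasurableSet {Y : Fin n → α | (Finset.univ.filter fun j => Y j ∈ A) = S} := by
    intro S
    rw [hbox]
    refine MeasurableSet.univ_pi fun j => ?_
    split_ifs
    · exact hA
    · exact hA.compl
  have hval : ∀ S : Finset (Fin n), (Measure.pi fun _ : Fin n => ν)
      {Y : Fin n → α | (Finset.univ.filter fun j => Y j ∈ A) = S} =
        ENNReal.ofReal (t ^ S.card * (1 - t) ^ (n - S.card)) := by
    intro S
    have hc : ν Aᶜ = ENNReal.ofReal (1 - t) := by
      rw [prob_compl_eq_one_sub hA, hνA, ENNReal.ofReal_sub _ ht0, ENNReal.ofReal_one]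
    rw [hbox, Measure.pi_pi]
    have : ∀ j, ν (if j ∈ S then A else Aᶜ) =
        if j ∈ S then ENNReal.ofReal t else ENNReal.ofReal (1 - t) := by
      intro j
      split_ifs
      · exact hνA
      · exact hc
    simp only [this]
    rw [Finset.prod_ite, Finset.prod_const, Finset.prod_const, ENNReal.ofReal_mul (by positivity),
      ENNReal.ofReal_pow ht0, ENNReal.ofReal_pow (by linarith)]
    congr 2
    · simp
    · have : (Finset.univ.filter fun j => j ∉ S) = Sᶜ := by ext j; simp
      rw [this, Finset.card_compl, Fintype.card_fin]
  have hunion : {Y : Fin n → α | k ≤ (Finset.univ.filter fun j => Y j ∈ A).card} =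
      ⋃ S ∈ (Finset.univ.powerset.filter fun S : Finset (Fin n) => k ≤ S.card),
        {Y : Fin n → α | (Finset.univ.filter fun j => Y j ∈ A) = S} := by
    ext Y
    simp
  rw [hunion, measure_biUnion_finset (fun S _ S' _ h => ?_) fun S _ => hmeas S]
  · simp only [hval]
    rw [Finset.sum_filter, Finset.sum_powerset_apply_card (fun j => if k ≤ j then
      ENNReal.ofReal (t ^ j * (1 - t) ^ (n - j)) else 0), Finset.card_univ, Fintype.card_fin]
    have hI : Finset.Icc k n = (Finset.range (n + 1)).filter fun j => k ≤ j := by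
      ext j; simp; omega
    rw [hI, Finset.sum_filter]
    refine Finset.sum_congr rfl fun j _ => ?_
    split_ifs
    · rw [nsmul_eq_mul, ← ENNReal.ofReal_natCast, ← ENNReal.ofReal_mul (by positivity)]
    · simp
  · rw [Function.onFun, Set.disjoint_left]
    intro Y h1 h2
    exact h (h1.symm.trans h2)

end Binomial

section Radial

variable {d : ℕ} (ν : Measure (E d)) [IsProbabilityMeasure ν]

/-- Mass of the ball of radius `r` about the origin. -/
def radialCDF (r : ℝ) : ℝ := ν.real (Metric.closedBall 0 r)

theorem monotone_radialCDF : Monotone (radialCDF ν) := fun _ _ h =>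
  measureReal_mono (Metric.closedBall_subset_closedBall h)

theorem radialCDF_le_one (r : ℝ) : radialCDF ν r ≤ 1 := measureReal_le_one

theorem tendsto_radialCDF : Tendsto (fun n : ℕ => radialCDF ν n) atTop (𝓝 1) := by
  have := tendsto_measure_iUnion_atTop (μ := ν)
    (s := fun n : ℕ => Metric.closedBall (0 : E d) (n : ℝ))
    fun a b h => Metric.closedBall_subset_closedBall (by exact_mod_cast h)
  rw [Metric.iUnion_closedBall_nat, measure_univ] at this
  exact (ENNReal.tendsto_toReal ENNReal.one_ne_top).comp this

variable {ν}

/-- This is the distribution function of the norm, which has no atoms because spheres are null. -/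
theorem continuous_radialCDF (hν : ∀ t, ν (Metric.sphere 0 t) = 0) : Continuous (radialCDF ν) := by
  have hprob : IsProbabilityMeasure (ν.map norm) :=
    Measure.isProbabilityMeasure_map measurable_norm.aemeasurable
  have heq : radialCDF ν = ProbabilityTheory.cdf (ν.map norm) := by
    funext r
    rw [ProbabilityTheory.cdf_eq_real, measureReal_def, Measure.map_apply measurable_norm
      measurableSet_Iic, radialCDF, measureReal_def]
    congr 2
    ext y; simp
  rw [heq, continuous_iff_continuousAt]
  intro r
  have hz : (ν.map norm) {r} = 0 := by
    rw [Measure.map_apply measurable_norm (measurableSet_singleton r)]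
    convert hν r using 2
    ext y; simp
  rw [← ProbabilityTheory.measure_cdf (ν.map norm), StieltjesFunction.measure_singleton,
    ENNReal.ofReal_eq_zero] at hz
  have hmono := ProbabilityTheory.monotone_cdf (ν.map norm)
  rw [hmono.continuousAt_iff_leftLim_eq_rightLim, StieltjesFunction.rightLim_eq]
  have := hmono.leftLim_le (le_refl r)
  linarith

/-- Probability integral transform: the mass of the ball reaching out to a ν-random point is uniform
on (0, 1). Since `radialCDF ν` may have flat stretches, the sublevel set is described by its
supremum. -/
theorem measure_radialCDF_le (hν : ∀ t, ν (Metric.sphere 0 t) = 0) {t : ℝ} (ht0 : 0 < t) (ht1 : t < 1) :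
    ν {y | radialCDF ν ‖y‖ ≤ t} = ENNReal.ofReal t := by
  have hcont := continuous_radialCDF hν
  have hmono := monotone_radialCDF ν
  obtain ⟨r₀, hr₀⟩ : ∃ r, radialCDF ν r = t := by
    have hneg : radialCDF ν (-1) = 0 := by
      rw [radialCDF, Metric.closedBall_eq_empty.2 (by norm_num), measureReal_empty]
    have htop : ∃ r, t ≤ radialCDF ν r := by
      obtain ⟨n, hn⟩ := ((tendsto_radialCDF ν).eventually_const_le ht1).exists
      exact ⟨n, hn⟩
    exact mem_range_of_exists_le_of_exists_ge hcont ⟨-1, by linarith⟩ htop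
  set A : Set ℝ := {r | radialCDF ν r ≤ t} with hA
  have hAne : A.Nonempty := ⟨r₀, hr₀.le⟩
  by_cases hbdd : BddAbove A
  · have hclosed : IsClosed A := isClosed_le hcont continuous_const
    have hmem := hclosed.csSup_mem hAne hbdd
    have hge : t ≤ radialCDF ν (sSup A) := hr₀ ▸ hmono (le_csSup hbdd hr₀.le)
    have hset : {y : E d | radialCDF ν ‖y‖ ≤ t} = Metric.closedBall 0 (sSup A) := by
      ext y
      rw [mem_closedBall_zero_iff]
      exact ⟨fun h => le_csSup hbdd h, fun h => (hmono h).trans hmem⟩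
    rw [hset, ← ofReal_measureReal]
    congr 1
    exact le_antisymm hmem hge
  · exfalso
    have hall : ∀ r, radialCDF ν r ≤ t := by
      intro r
      rw [not_bddAbove_iff] at hbdd
      obtain ⟨s, hs, hrs⟩ := hbdd r
      exact (hmono hrs.le).trans hs
    have := le_of_tendsto' (tendsto_radialCDF ν) fun n => hall n
    linarith

end Radial

end LLDE
end

/-! ### Logarithmic moment of the k-th order statistic -/

noncomputable section
namespace LLDE

section OrderStatistic

variable {d n k : ℕ} {ν : Measure (E d)} [IsProbabilityMeasure ν]

/-- The infimum is below r exactly if some rational radius below r captures k points. For k ≤ n the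
set of radii is nonempty, so `sInf` is not the default 0. -/
theorem measurable_kDist (hkn : k ≤ n) : Measurable (kDist k : (Fin n → E d) → ℝ) := by
  classical
  have hcount : ∀ q : ℝ, MeasurableSet {Y : Fin n → E d | k ≤ Set.ncard {j | ‖Y j‖ ≤ q}} := by
    intro q
    have hm : Measurable fun Y : Fin n → E d => ∑ j, if ‖Y j‖ ≤ q then 1 else 0 := by
      refine Finset.measurable_sum _ fun j _ => Measurable.ite ?_ measurable_const measurable_const
      exact measurableSet_le (by fun_prop) measurable_const
    have he : ∀ Y : Fin n → E d, Set.ncard {j | ‖Y j‖ ≤ q} = ∑ j, if ‖Y j‖ ≤ q then 1 else 0 := by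
      intro Y
      rw [Set.ncard_eq_toFinset_card', Finset.sum_boole]
      simp
    simp only [he]
    exact measurableSet_le measurable_const hm
  refine measurable_of_Iio fun r => ?_
  have hset : kDist k ⁻¹' Set.Iio r =
      ⋃ q : ℚ, {Y : Fin n → E d | (0 ≤ (q : ℝ) ∧ (q : ℝ) < r) ∧
        k ≤ Set.ncard {j | ‖Y j‖ ≤ (q : ℝ)}} := by
    ext Y
    have hne : {s : ℝ | 0 ≤ s ∧ k ≤ Set.ncard {j | ‖Y j‖ ≤ s}}.Nonempty :=
      ⟨‖Y‖, norm_nonneg _, by rw [ncard_norm_le_of_norm_le le_rfl]; exact hkn⟩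
    have hbdd : BddBelow {s : ℝ | 0 ≤ s ∧ k ≤ Set.ncard {j | ‖Y j‖ ≤ s}} := ⟨0, fun s hs => hs.1⟩
    rw [Set.mem_preimage, Set.mem_Iio, kDist, csInf_lt_iff hbdd hne]
    simp only [Set.mem_iUnion, Set.mem_ofPred_eq]
    constructor
    · rintro ⟨s, ⟨hs0, hs⟩, hsr⟩
      obtain ⟨q, hq1, hq2⟩ := exists_rat_btwn hsr
      exact ⟨q, ⟨hs0.trans hq1.le, hq2⟩, hs.trans (Set.ncard_le_ncard
        (fun j (hj : ‖Y j‖ ≤ s) => hj.trans hq1.le) (Set.toFinite _))⟩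
    · rintro ⟨q, ⟨h0, hr⟩, hc⟩
      exact ⟨q, ⟨h0, hc⟩, hr⟩
  rw [hset]
  refine MeasurableSet.iUnion fun q => ?_
  exact (MeasurableSet.const _).inter (hcount q)

/-- Writing -log u as the integral of 1/t over [u, 1] lets Tonelli express the mean of -log through
the distribution function. -/
theorem lintegral_inv_of_le {u : ℝ} (hu0 : 0 < u) (hu1 : u ≤ 1) :
    ∫⁻ t in Set.Ioo (0 : ℝ) 1, (if u ≤ t then ENNReal.ofReal t⁻¹ else 0) =
      ENNReal.ofReal (-Real.log u) := by
  have h1 : (fun t : ℝ => if u ≤ t then ENNReal.ofReal t⁻¹ else 0) =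
      (Set.Ici u).indicator fun t => ENNReal.ofReal t⁻¹ := by
    funext t
    simp [Set.indicator]
  have h2 : Set.Ici u ∩ Set.Ioo 0 1 = Set.Ico u 1 := by
    ext t
    simp only [Set.mem_inter_iff, Set.mem_Ici, Set.mem_Ioo, Set.mem_Ico]
    exact ⟨fun h => ⟨h.1, h.2.2⟩, fun h => ⟨h.1, hu0.trans_le h.1, h.2⟩⟩
  have hint : IntervalIntegrable (fun t : ℝ => t⁻¹) volume u 1 := by
    refine ContinuousOn.intervalIntegrable fun t ht => ?_
    rw [Set.uIcc_of_le hu1] at ht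
    exact (continuousAt_inv₀ (hu0.trans_le ht.1).ne').continuousWithinAt
  rw [h1, setLIntegral_indicator measurableSet_Ici, h2, setLIntegral_congr Ico_ae_eq_Ioc,
    ← ofReal_integral_eq_lintegral_ofReal ((intervalIntegrable_iff_integrableOn_Ioc_of_le hu1).1 hint)
      ((ae_restrict_iff' measurableSet_Ioc).2 (Eventually.of_forall fun t ht =>
        inv_nonneg.2 (hu0.trans ht.1).le)),
    ← intervalIntegral.integral_of_le hu1, integral_inv_of_pos hu0 one_pos, one_div, Real.log_inv]

/-- Distribution of the `k`-th order statistic of independent uniform variables. -/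
theorem measure_radialCDF_kDist_le (hν : ∀ t, ν (Metric.sphere 0 t) = 0) (hk : 1 ≤ k) (hkn : k ≤ n)
    {t : ℝ} (ht0 : 0 < t) (ht1 : t < 1) :
    (Measure.pi fun _ : Fin n => ν) {Y | radialCDF ν (kDist k Y) ≤ t} =
      ∑ j ∈ Finset.Icc k n, ENNReal.ofReal (n.choose j * (t ^ j * (1 - t) ^ (n - j))) := by
  classical
  have hmono := monotone_radialCDF ν
  have hA : MeasurableSet {y : E d | radialCDF ν ‖y‖ ≤ t} :=
    measurableSet_le (hmono.measurable.comp measurable_norm) measurable_const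
  rw [← pi_card_ge ν hA ht0.le ht1.le (measure_radialCDF_le hν ht0 ht1) n k]
  refine measure_congr ?_
  filter_upwards [ae_norm_injective ν hν n] with Y hY
  obtain ⟨S, hS, hmem, j₀, hj₀, hj₀'⟩ := exists_finset_kDist hY hk hkn
  refine propext ?_
  change radialCDF ν (kDist k Y) ≤ t ↔
    k ≤ (Finset.univ.filter fun j => radialCDF ν ‖Y j‖ ≤ t).card
  constructor
  · intro h
    rw [← hS]
    refine Finset.card_le_card fun j hj => ?_
    rw [Finset.mem_filter]
    exact ⟨Finset.mem_univ j, (hmono ((hmem j).1 hj)).trans h⟩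
  · intro h
    by_contra! hc
    have hsub : (Finset.univ.filter fun j => radialCDF ν ‖Y j‖ ≤ t) ⊆ S.erase j₀ := by
      intro j hj
      have hj' := (Finset.mem_filter.1 hj).2
      have hlt : ‖Y j‖ < kDist k Y := by
        by_contra! hge
        linarith [hmono hge]
      rw [Finset.mem_erase]
      refine ⟨?_, (hmem j).2 hlt.le⟩
      rintro rfl
      exact hlt.ne hj₀'
    have := Finset.card_le_card hsub
    rw [Finset.card_erase_of_mem hj₀, hS] at this
    omega

/-- By Tonelli the mean is the integral over (0, 1) of the binomial tail divided by t, evaluated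
termwise by `choose_mul_integral`. `hpos` rules out the conventional value log 0 = 0. -/
theorem lintegral_neg_log_radialCDF (hν : ∀ t, ν (Metric.sphere 0 t) = 0)
    (hpos : ∀ t, 0 < t → 0 < radialCDF ν t) (hk : 1 ≤ k) (hkn : k ≤ n) :
    ∫⁻ Y, ENNReal.ofReal (-Real.log (radialCDF ν (kDist k Y))) ∂(Measure.pi fun _ : Fin n => ν) =
      ENNReal.ofReal (∑ j ∈ Finset.Icc k n, (j : ℝ)⁻¹) := by
  have hu : Measurable fun Y : Fin n → E d => radialCDF ν (kDist k Y) :=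
    (monotone_radialCDF ν).measurable.comp (measurable_kDist hkn)
  have hae : ∀ᵐ Y ∂(Measure.pi fun _ : Fin n => ν),
      ENNReal.ofReal (-Real.log (radialCDF ν (kDist k Y))) = ∫⁻ t in Set.Ioo (0 : ℝ) 1,
        (if radialCDF ν (kDist k Y) ≤ t then ENNReal.ofReal t⁻¹ else 0) := by
    filter_upwards [ae_norm_injective ν hν n, ae_ne_zero ν hν n] with Y h1 h2
    rw [lintegral_inv_of_le (hpos _ (kDist_pos h1 h2 hk hkn)) (radialCDF_le_one ν _)]
  rw [lintegral_congr_ae hae, lintegral_lintegral_swap]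
  · have hinner : ∀ t ∈ Set.Ioo (0 : ℝ) 1, ∫⁻ Y : Fin n → E d,
        (if radialCDF ν (kDist k Y) ≤ t then ENNReal.ofReal t⁻¹ else 0)
          ∂(Measure.pi fun _ : Fin n => ν) = ∑ j ∈ Finset.Icc k n,
        ENNReal.ofReal (n.choose j * (t ^ (j - 1) * (1 - t) ^ (n - j))) := by
      intro t ht
      have h1 : (fun Y : Fin n → E d => if radialCDF ν (kDist k Y) ≤ t then ENNReal.ofReal t⁻¹
          else 0) = {Y | radialCDF ν (kDist k Y) ≤ t}.indicator fun _ => ENNReal.ofReal t⁻¹ := by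
        funext Y
        simp [Set.indicator]
      rw [h1, lintegral_indicator (measurableSet_le hu measurable_const), setLIntegral_const,
        measure_radialCDF_kDist_le hν hk hkn ht.1 ht.2, Finset.mul_sum]
      refine Finset.sum_congr rfl fun j hj => ?_
      have hj1 : 1 ≤ j := hk.trans (Finset.mem_Icc.1 hj).1
      rw [← ENNReal.ofReal_mul (inv_nonneg.2 ht.1.le)]
      congr 1
      have : t ^ j = t ^ (j - 1) * t := by rw [← pow_succ, Nat.sub_add_cancel hj1]
      rw [this]
      have := ht.1.ne'
      field_simp
    rw [setLIntegral_congr_fun measurableSet_Ioo hinner, lintegral_finsetSum _ fun j _ => by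
      fun_prop, ENNReal.ofReal_sum_of_nonneg fun j _ => by positivity]
    refine Finset.sum_congr rfl fun j hj => ?_
    obtain ⟨hj1, hj2⟩ := Finset.mem_Icc.1 hj
    rw [← choose_mul_integral (hk.trans hj1) hj2, ← intervalIntegral.integral_const_mul,
      intervalIntegral.integral_of_le zero_le_one, integral_Ioc_eq_integral_Ioo]
    refine (ofReal_integral_eq_lintegral_ofReal ?_ ?_).symm
    · have hc : Continuous fun t : ℝ => (n.choose j : ℝ) * (t ^ (j - 1) * (1 - t) ^ (n - j)) := by
        fun_prop
      exact (hc.integrableOn_Icc (a := 0) (b := 1)).mono_set Set.Ioo_subset_Icc_self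
    · refine (ae_restrict_iff' measurableSet_Ioo).2 (Eventually.of_forall fun t ht => ?_)
      have h1 := ht.1.le
      have h2 : 0 ≤ 1 - t := by linarith [ht.2]
      simp only [Pi.zero_apply]
      positivity
  · refine Measurable.aemeasurable ?_
    refine Measurable.ite ?_ (by fun_prop) measurable_const
    exact measurableSet_le (hu.comp measurable_fst) measurable_snd

theorem integral_log_radialCDF (hν : ∀ t, ν (Metric.sphere 0 t) = 0)
    (hpos : ∀ t, 0 < t → 0 < radialCDF ν t) (hk : 1 ≤ k) (hkn : k ≤ n) :
    Integrable (fun Y => Real.log (radialCDF ν (kDist k Y))) (Measure.pi fun _ : Fin n => ν) ∧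
    ∫ Y, Real.log (radialCDF ν (kDist k Y)) ∂(Measure.pi fun _ : Fin n => ν) =
      -∑ j ∈ Finset.Icc k n, (j : ℝ)⁻¹ := by
  have hl := lintegral_neg_log_radialCDF hν hpos hk hkn
  have hm : Measurable fun Y : Fin n → E d => Real.log (radialCDF ν (kDist k Y)) :=
    ((monotone_radialCDF ν).measurable.comp (measurable_kDist hkn)).log
  have hneg : ∀ Y : Fin n → E d, Real.log (radialCDF ν (kDist k Y)) ≤ 0 := fun Y =>
    Real.log_nonpos measureReal_nonneg (radialCDF_le_one ν _)
  constructor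
  · refine ⟨hm.aestronglyMeasurable, ?_⟩
    rw [HasFiniteIntegral]
    have : ∀ Y : Fin n → E d, ‖Real.log (radialCDF ν (kDist k Y))‖ₑ =
        ENNReal.ofReal (-Real.log (radialCDF ν (kDist k Y))) := fun Y => by
      rw [← abs_of_nonpos (hneg Y), ← Real.norm_eq_abs, ofReal_norm]
    simp only [this, hl]
    exact ENNReal.ofReal_lt_top
  · have h := integral_eq_lintegral_of_nonneg_ae (μ := Measure.pi fun _ : Fin n => ν)
      (f := fun Y => -Real.log (radialCDF ν (kDist k Y)))
      (Eventually.of_forall fun Y => neg_nonneg.2 (hneg Y)) hm.neg.aestronglyMeasurable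
    rw [hl, ENNReal.toReal_ofReal (Finset.sum_nonneg fun j _ => by positivity), integral_neg] at h
    linarith

end OrderStatistic

theorem sum_Icc_inv {k n : ℕ} (hk : 1 ≤ k) (hkn : k ≤ n) :
    ∑ j ∈ Finset.Icc k n, (j : ℝ)⁻¹ = harmonic n - harmonic (k - 1) := by
  induction n, hkn using Nat.le_induction with
  | base =>
    obtain ⟨i, rfl⟩ := Nat.exists_eq_add_of_le' hk
    simp [harmonic_succ]
  | succ n hkn ih =>
    rw [← Finset.insert_Icc_right_eq_Icc_add_one (by omega), Finset.sum_insert (by simp), ih,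
      harmonic_succ]
    push_cast
    ring

theorem digamma_natCast {k : ℕ} (hk : 1 ≤ k) :
    digamma k = harmonic (k - 1) - Real.eulerMascheroniConstant := by
  obtain ⟨i, rfl⟩ := Nat.exists_eq_add_of_le' hk
  have hF : ((i.factorial : ℕ) : ℝ) ≠ 0 := by positivity
  rw [digamma, Nat.add_sub_cancel, Nat.cast_succ, Real.deriv_Gamma_nat, Real.Gamma_nat_eq_factorial]
  field_simp
  ring

/-! ### The Kozachenko–Leonenko bias -/

section StepKernelLimit

variable {d k : ℕ} {f : E d → ℝ} {ν : Measure (E d)} {L δ : ℝ}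

theorem NearLebesgue.radialCDF_pos (h : NearLebesgue ν L δ) {t : ℝ} (ht : 0 < t) :
    0 < radialCDF ν t := by
  have := h.isProb
  have hL := h.nonneg
  have hδ := h.pos
  have hV := ballVol_pos d
  set s := min t (min δ (1 / (2 * (L + 1)))) with hs
  have hs0 : 0 < s := lt_min ht (lt_min hδ (by positivity))
  have hs1 : s ≤ δ := (min_le_right _ _).trans (min_le_left _ _)
  have hs2 : s ≤ 1 / (2 * (L + 1)) := (min_le_right _ _).trans (min_le_right _ _)
  have hLs : L * s ≤ 1 / 2 := by
    rw [le_div_iff₀ (by positivity)] at hs2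
    nlinarith
  have h1 := h.le_real hs0.le hs1 (by linarith)
  have h2 : 0 < (1 - L * s) * (ballVol d * s ^ d) := by
    have : 0 < 1 - L * s := by linarith
    positivity
  exact (h2.trans_le h1).trans_le (monotone_radialCDF ν (min_le_left _ _))

/-- The mass of a small ball lies between (1 - L t) and (1 + L t) times its volume; L t ≤ 1/2 makes
both logarithmic errors at most 2 L t. -/
theorem NearLebesgue.abs_log_sub_le (h : NearLebesgue ν L δ) {t r : ℝ} (ht : 0 < t) (htr : t ≤ r)
    (hr : r ≤ δ) (hLr : L * r ≤ 1 / 2) :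
    |Real.log (ballVol d * t ^ d) - Real.log (radialCDF ν t)| ≤ 2 * L * r := by
  have hL := h.nonneg
  have hV := ballVol_pos d
  have hLt : L * t ≤ L * r := by gcongr
  have hLt0 : 0 ≤ L * t := by positivity
  have h1 := h.le_real ht.le (htr.trans hr) (by linarith)
  have h2 := h.real_le ht.le (htr.trans hr)
  have hF : 0 < radialCDF ν t := h.radialCDF_pos ht
  have hq : 0 < ballVol d * t ^ d := by positivity
  have hx : 0 < 1 - L * t := by linarith
  have u1 : Real.log (radialCDF ν t) ≤ Real.log (1 + L * t) + Real.log (ballVol d * t ^ d) := by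
    rw [← Real.log_mul (by positivity) hq.ne']
    exact Real.log_le_log hF h2
  have u2 : Real.log (1 - L * t) + Real.log (ballVol d * t ^ d) ≤ Real.log (radialCDF ν t) := by
    rw [← Real.log_mul hx.ne' hq.ne']
    exact Real.log_le_log (by positivity) h1
  have u3 := Real.log_le_sub_one_of_pos (show 0 < 1 + L * t by positivity)
  have u4 := Real.one_sub_inv_le_log_of_pos hx
  have u5 : (1 - L * t)⁻¹ ≤ 1 + 2 * (L * t) := by
    rw [inv_le_iff_one_le_mul₀ hx]
    nlinarith
  rw [abs_le]
  constructor <;> linarith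

/-- Logarithm of the mass of the ball that reaches to the `k`-th nearest point. -/
def logMass (ν : Measure (E d)) (k m : ℕ) (z : Fin m → E d) : ℝ :=
  Real.log (radialCDF ν (kDist k z))

/-- The k-th distance is determined by the m nearest points, so the order-statistic moment of the
full sample transfers to `nearMeasure`. -/
theorem NearLebesgue.integral_logMass (hd : 1 ≤ d) (h : NearLebesgue ν L δ) (hk : 1 ≤ k) {m n : ℕ}
    (hkm : k ≤ m) (hmn : m ≤ n) :
    Integrable (logMass ν k m) (nearMeasure ν n m) ∧
      ∫ z, logMass ν k m z ∂(nearMeasure ν n m) = -(harmonic n - harmonic (k - 1)) ∧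
      ∫ z, |logMass ν k m z| ∂(nearMeasure ν n m) = harmonic n - harmonic (k - 1) := by
  have := h.isProb
  have hν := h.sphere_null hd
  obtain ⟨h1, h2⟩ := integral_log_radialCDF hν (fun t ht => h.radialCDF_pos ht) hk (hkm.trans hmn)
  obtain ⟨r1, r2⟩ := integral_nearMeasure ν hν (hk.trans hkm) hmn (h := logMass ν k m) h1
    (Eventually.of_forall fun Y e he hn => by rw [logMass, hn.kDist_eq he hkm])
  rw [h2, sum_Icc_inv hk (hkm.trans hmn)] at r2
  refine ⟨r1, r2, ?_⟩
  have hneg : ∀ z, |logMass ν k m z| = -logMass ν k m z := fun z =>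
    abs_of_nonpos (Real.log_nonpos measureReal_nonneg (radialCDF_le_one ν _))
  simp only [hneg]
  rw [integral_neg, r2, neg_neg]

theorem harmonic_nonneg (n : ℕ) : (0 : ℝ) ≤ harmonic n := by
  have : (0 : ℚ) ≤ harmonic n := Finset.sum_nonneg fun i _ => by positivity
  exact_mod_cast this

theorem harmonic_le_of_le_exp {m n : ℕ} (h : (n : ℝ) ≤ Real.exp m) : (harmonic n : ℝ) ≤ 1 + m := by
  rcases Nat.eq_zero_or_pos n with rfl | hn
  · simp; positivity
  · have hn' : (0 : ℝ) < n := by exact_mod_cast hn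
    have h1 := harmonic_le_one_add_log n
    have h2 := (Real.log_le_iff_le_exp hn').2 h
    linarith

/-- The absolute moments are known exactly and bounded by harmonic numbers at most 1 + m, below m²
for m ≥ 3. -/
theorem NearLebesgue.controlled_logMass (hd : 1 ≤ d) (h : NearLebesgue ν L δ) (hk : 1 ≤ k) :
    Controlled ν (logMass ν k) (logMass ν k) := by
  filter_upwards [eventually_ge_atTop (max k 3), eventually_two_mul_le_growth] with m hm hq
  have hkm : k ≤ m := (le_max_left _ _).trans hm
  have hm3 : 3 ≤ m := (le_max_right _ _).trans hm
  obtain ⟨a1, _, a3⟩ := h.integral_logMass hd hk hkm (show m ≤ growth m by omega)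
  obtain ⟨b1, _, b3⟩ := h.integral_logMass hd hk hkm (show m ≤ 2 * growth m + 1 by omega)
  have hg := two_mul_growth_add_two_le hm3
  have hg0 := Nat.cast_nonneg (α := ℝ) (growth m)
  have hm3' : (3 : ℝ) ≤ m := by exact_mod_cast hm3
  have hk0 := harmonic_nonneg (k - 1)
  have e1 := harmonic_le_of_le_exp (m := m) (n := growth m) (by linarith)
  have e2 := harmonic_le_of_le_exp (m := m) (n := 2 * growth m + 1) (by push_cast; linarith)
  refine ⟨fun z => by linarith, ⟨a1, ?_⟩, ⟨b1, ?_⟩⟩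
  · rw [a3]; nlinarith
  · rw [b3]; nlinarith

/-- Through `Controlled.tendsto_far`, the far region has vanishing mass even when weighted by |c m|.
-/
theorem NearLebesgue.controlled_const (hd : 1 ≤ d) (h : NearLebesgue ν L δ) {c : ℕ → ℝ}
    (hc : ∀ᶠ m : ℕ in atTop, |c m| ≤ (m : ℝ) ^ 2) :
    Controlled ν (fun m _ => c m) (fun m _ => c m) := by
  have := h.isProb
  filter_upwards [hc, eventually_ge_atTop 1, eventually_two_mul_le_growth] with m hcm hm hq
  have p0 := isProbabilityMeasure_nearMeasure ν (h.sphere_null hd) hm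
    (show m ≤ growth m by omega)
  have p1 := isProbabilityMeasure_nearMeasure ν (h.sphere_null hd) hm
    (show m ≤ 2 * growth m + 1 by omega)
  refine ⟨fun z => by linarith, ⟨integrable_const _, ?_⟩, ⟨integrable_const _, ?_⟩⟩
  · simpa using hcm
  · simpa using hcm

/-- A function that is small near the origin, up to controlled errors elsewhere. -/
theorem abs_integral_le_add {α : Type*} [MeasurableSpace α] {μ : Measure α} [IsProbabilityMeasure μ]
    {R : Set α} (hR : MeasurableSet R) {g w : α → ℝ} {ε : ℝ} (hε : 0 ≤ ε) (hg : Integrable g μ)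
    (hw : Integrable w μ) (hgR : ∀ᵐ x ∂μ, x ∈ R → |g x| ≤ ε) (hgw : ∀ x, |g x| ≤ w x) :
    |∫ x, g x ∂μ| ≤ ε + ∫ x in Rᶜ, w x ∂μ := by
  calc |∫ x, g x ∂μ| ≤ ∫ x, |g x| ∂μ := abs_integral_le_integral_abs
    _ = ∫ x in R, |g x| ∂μ + ∫ x in Rᶜ, |g x| ∂μ := (integral_add_compl hR hg.abs).symm
    _ ≤ ε + ∫ x in Rᶜ, w x ∂μ := by
      refine add_le_add ?_ (setIntegral_mono hg.abs.integrableOn hw.integrableOn hgw)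
      calc ∫ x in R, |g x| ∂μ ≤ ∫ _ in R, ε ∂μ :=
            setIntegral_mono_on_ae hg.abs.integrableOn (integrable_const _).integrableOn hR hgR
        _ = μ.real R * ε := by rw [setIntegral_const, smul_eq_mul]
        _ ≤ ε := mul_le_of_le_one_left hε measureReal_le_one

theorem nearMeasure_ac (ν : Measure (E d)) (n m : ℕ) :
    nearMeasure ν n m ≪ Measure.pi fun _ : Fin m => ν :=
  (Measure.smul_absolutelyContinuous).trans (withDensity_absolutelyContinuous _ _)

theorem eventually_log_le_sq (k : ℕ) : ∀ᶠ m : ℕ in atTop,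
    |Real.log (((2 * growth m + 1 : ℕ) : ℝ) + 1) - Real.log k| ≤ (m : ℝ) ^ 2 := by
  filter_upwards [eventually_ge_atTop (max 3 (⌈|Real.log k|⌉₊))] with m hm
  have hm3 : 3 ≤ m := (le_max_left _ _).trans hm
  have hmk : |Real.log k| ≤ m := (Nat.le_ceil _).trans (by exact_mod_cast (le_max_right _ _).trans hm)
  have hg := two_mul_growth_add_two_le hm3
  have hg0 := Nat.cast_nonneg (α := ℝ) (growth m)
  have e : ((2 * growth m + 1 : ℕ) : ℝ) + 1 = 2 * (growth m : ℝ) + 2 := by push_cast; ring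
  rw [e]
  have h1 : Real.log (2 * (growth m : ℝ) + 2) ≤ m := (Real.log_le_iff_le_exp (by linarith)).2 hg
  have h2 : 0 ≤ Real.log (2 * (growth m : ℝ) + 2) := Real.log_nonneg (by linarith)
  have hm3' : (3 : ℝ) ≤ m := by exact_mod_cast hm3
  rw [abs_le] at hmk ⊢
  constructor <;> nlinarith

/-- The pointwise comparison is needed only near the origin; outside, the tails of the three terms
vanish separately by `Controlled.tendsto_far`. -/
theorem Controlled.tendsto_integral_sub (hd : 1 ≤ d) (h : NearLebesgue ν L δ)
    {ψ₀ ψ₁ φ₀ φ₁ : (m : ℕ) → (Fin m → E d) → ℝ} {c ε : ℕ → ℝ} (hψ : Controlled ν ψ₀ ψ₁)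
    (hφ : Controlled ν φ₀ φ₁) (hc : ∀ᶠ m : ℕ in atTop, |c m| ≤ (m : ℝ) ^ 2)
    (hε : Tendsto ε atTop (𝓝 0))
    (hle : ∀ᶠ m : ℕ in atTop, 0 ≤ ε m ∧ ∀ᵐ z ∂(nearMeasure ν (2 * growth m + 1) m),
      ‖z‖ ≤ radius d m → |ψ₁ m z - φ₁ m z - c m| ≤ ε m) :
    Tendsto (fun m => ∫ z, ψ₁ m z ∂(nearMeasure ν (2 * growth m + 1) m) -
      ∫ z, φ₁ m z ∂(nearMeasure ν (2 * growth m + 1) m) - c m) atTop (𝓝 0) := by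
  have hprob := h.isProb
  have hcc := h.controlled_const hd hc
  have hlim := hε.add (((hψ.tendsto_far hd h).add (hφ.tendsto_far hd h)).add
    (hcc.tendsto_far hd h))
  simp only [add_zero] at hlim
  refine squeeze_zero_norm' ?_ hlim
  filter_upwards [hψ, hφ, hle, eventually_ge_atTop 1, eventually_two_mul_le_growth]
    with m ⟨_, _, i1, _⟩ ⟨_, _, i2, _⟩ ⟨hε0, hm⟩ hm1 hq
  have hp := isProbabilityMeasure_nearMeasure ν (h.sphere_null hd) hm1
    (show m ≤ 2 * growth m + 1 by omega)
  have i12 : Integrable (fun z => ψ₁ m z - φ₁ m z) (nearMeasure ν (2 * growth m + 1) m) := i1.sub i2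
  have a1 : Integrable (fun z => |ψ₁ m z|) (nearMeasure ν (2 * growth m + 1) m) := i1.abs
  have a2 : Integrable (fun z => |φ₁ m z|) (nearMeasure ν (2 * growth m + 1) m) := i2.abs
  have a12 : Integrable (fun z => |ψ₁ m z| + |φ₁ m z|) (nearMeasure ν (2 * growth m + 1) m) :=
    a1.add a2
  have e1 : ∫ z, (ψ₁ m z - φ₁ m z - c m) ∂(nearMeasure ν (2 * growth m + 1) m) =
      ∫ z, ψ₁ m z ∂(nearMeasure ν (2 * growth m + 1) m) -
      ∫ z, φ₁ m z ∂(nearMeasure ν (2 * growth m + 1) m) - c m := by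
    rw [integral_sub i12 (integrable_const _), integral_sub i1 i2]
    simp
  have hb := abs_integral_le_add (μ := nearMeasure ν (2 * growth m + 1) m)
    (measurableSet_norm_le (radius d m)) (g := fun z => ψ₁ m z - φ₁ m z - c m)
    (w := fun z => |ψ₁ m z| + |φ₁ m z| + |c m|) hε0 (i12.sub (integrable_const _))
    (a12.add (integrable_const _)) hm
    fun z => (abs_sub _ _).trans (add_le_add (abs_sub _ _) le_rfl)
  rw [e1, integral_add a12.integrableOn (integrable_const _),
    integral_add a1.integrableOn a2.integrableOn] at hb
  exact hb

/-- The asymptotic bias for the step kernel. -/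
theorem GoodPoint.limit_stepKernel (hd : 1 ≤ d) (hf : IsC2Density f) (hk : 1 ≤ k) {x : E d}
    (h : GoodPoint k 0 (stepKernel d) f x) {g : ℝ}
    (hg : Tendsto (fun n => condFirstTerm k 0 (stepKernel d) f n x) atTop (𝓝 g)) :
    g = digamma k - Real.log k - Real.log (f x) := by
  obtain ⟨L, δ, hnl⟩ := exists_nearLebesgue_normLaw hd hf h.pos
  have hprob := hnl.isProb
  have hsph := hnl.sphere_null hd
  have hrad : Tendsto (fun m => 2 * L * radius d m) atTop (𝓝 0) := by
    simpa using (tendsto_radius d).const_mul (2 * L)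
  -- Here c m = log(N + 1) - log k with N = 2 `growth m` + 1. What remains is log(V ρ^d) minus the
  -- logarithm of the ν-mass of the ball of radius ρ = `kDist k z`.
  have hsmall := (h.controlled hd hf).tendsto_integral_sub hd hnl
    (hnl.controlled_logMass hd hk) (eventually_log_le_sq k) hrad (by
      filter_upwards [eventually_radius_small hd L hnl.pos, eventually_ge_atTop k]
        with m ⟨hr, hLr, _⟩ hkm
      have hL := hnl.nonneg
      have hr0 := radius_pos d m
      refine ⟨by positivity, ?_⟩
      filter_upwards [(nearMeasure_ac (normLaw f x) (2 * growth m + 1) m).ae_le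
          (ae_norm_injective _ hsph m),
        (nearMeasure_ac (normLaw f x) (2 * growth m + 1) m).ae_le (ae_ne_zero _ hsph m)]
        with z hz h0 hzR
      have hρ := kDist_pos hz h0 hk hkm
      have hρr : kDist k z ≤ radius d m := (kDist_le_norm hz hk hkm).trans hzR
      have e := hnl.abs_log_sub_le hρ hρr hr hLr
      rw [nearTerm, locTerm_stepKernel hz h0 hk hkm, logMass]
      convert e using 2
      ring)
  have hlim1 : Tendsto (fun m => condFirstTerm k 0 (stepKernel d) f (2 * growth m + 1) x +
      Real.log (f x)) atTop (𝓝 (g + Real.log (f x))) :=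
    (hg.comp tendsto_two_mul_growth).add_const _
  -- `Real.eulerMascheroniSeq n` is H_n - log(n + 1), which matches a sample of n + 1 points with n
  -- of them other than X_1.
  have hlim2 := hsmall.add ((tendsto_const_nhds (x := (harmonic (k - 1) : ℝ) - Real.log k)).sub
    (Real.tendsto_eulerMascheroniSeq.comp tendsto_two_mul_growth))
  have huniq := tendsto_nhds_unique hlim1 (hlim2.congr' ?_)
  · rw [digamma_natCast hk]
    linarith
  · filter_upwards [h.eventually_near hd hf, eventually_ge_atTop k,
      eventually_two_mul_le_growth] with m hm hkm hq
    rw [← hm.2.2,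
      (hnl.integral_logMass hd hk hkm (show m ≤ 2 * growth m + 1 by omega)).2.1]
    simp only [Function.comp, Real.eulerMascheroniSeq]
    ring

end StepKernelLimit

/-- The asymptotic bias of the Kozachenko--Leonenko estimator. -/
theorem tendsto_entropyEstimate_stepKernel {d k : ℕ} (hd : 1 ≤ d) (hk : 1 ≤ k) {f : E d → ℝ}
    (hf : IsC2Density f) (hex : ExchangeOfLimit k 0 (stepKernel d) f) :
    Tendsto (fun n : ℕ => ∫ X : Fin n → E d, entropyEstimate k 0 (stepKernel d) X
      ∂(sampleLaw f n)) atTop (𝓝 (entropy f + (digamma k - Real.log k))) := by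
  refine (tendsto_entropyEstimate hf hex ?_).2
  filter_upwards [ae_goodPoint hf (maximizerExists_stepKernel hd hk hf) hex] with x hx g hg
  exact hx.limit_stepKernel hd hf hk hg

end LLDE
end

theorem theorem2 (d : ℕ) (hd : 1 ≤ d) :
    (∀ (k p : ℕ) (K : LLDE.E d → ℝ), p + 1 ≤ k → Measurable K →
      ∃ B : ℝ, ∀ f : LLDE.E d → ℝ, LLDE.IsC2Density f →
        LLDE.MaximizerExists k p K f → LLDE.ExchangeOfLimit k p K f →
          Integrable (fun x => f x * Real.log (f x)) ∧
          Tendsto (fun n : ℕ =>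
              ∫ X : Fin n → LLDE.E d, LLDE.entropyEstimate k p K X ∂(LLDE.sampleLaw f n))
            atTop (𝓝 (LLDE.entropy f + B))) ∧
    (∀ k : ℕ, 1 ≤ k → ∀ f : LLDE.E d → ℝ, LLDE.IsC2Density f →
      (∀ᶠ n : ℕ in atTop, ∀ᵐ X ∂(LLDE.sampleLaw f n), ∀ i : Fin n,
        LLDE.Solvable k 0 (LLDE.stepKernel d) X i ∧
        LLDE.densityEstimate k 0 (LLDE.stepKernel d) X i
          = k / (n * LLDE.unitBallVolume d * LLDE.nnDist k X i ^ d)) ∧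
      (LLDE.ExchangeOfLimit k 0 (LLDE.stepKernel d) f →
        Tendsto (fun n : ℕ =>
            ∫ X : Fin n → LLDE.E d, LLDE.entropyEstimate k 0 (LLDE.stepKernel d) X
              ∂(LLDE.sampleLaw f n))
          atTop (𝓝 (LLDE.entropy f + (LLDE.digamma k - Real.log k))))) :=
  ⟨fun k p K _ _ => LLDE.exists_bias hd k p K, fun _ hk _ hf =>
    ⟨LLDE.eventually_densityEstimate_stepKernel hd hk hf, fun hex =>
      LLDE.tendsto_entropyEstimate_stepKernel hd hk hf hex⟩⟩
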